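/- **Setting.** Let $N\in\{2,3\}$ and let $\Omega\subset\mathbb R^N$ be a bounded connected open set of class $C^{1,1}$ with outward unit normal $\mathbf n$. Let $\Gamma_U,\Gamma_T,\Gamma_C$ be pairwise disjoint relatively open subsets of $\partial\Omega$ with $\partial\Omega=\overline\Gamma_U\cup\overline\Gamma_T\cup\overline\Gamma_C$, $\mathcal H^{N-1}(\Gamma_U)>0$, $\Gamma_C$ of class $C^{0,1}$ in $\partial\Omega$, and $\mathrm{dist}(\Gamma_U,\Gamma_C)>0$. Let $\boldsymbol\Lambda\in L^\infty(\Omega)$ be a field of symmetric, uniformly elliptic linear maps on the symmetric $N\times N$ matrices, and write $\boldsymbol\varepsilon(\mathbf u)=(\nabla\mathbf u+{}^t\nabla\mathbf u)/2$, $\boldsymbol\sigma(\mathbf u)=\boldsymbol\Lambda\boldsymbol\varepsilon(\mathbf u)$, $a(\mathbf u,\mathbf v)=\int_\Omega\boldsymbol\varepsilon(\mathbf u):\boldsymbol\Lambda\boldsymbol\varepsilon(\mathbf v)$, $\|\mathbf u\|_a=a(\mathbf u,\mathbf u)^{1/2}$, $V=\{\mathbf u\in H^1(\Omega;\mathbb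 R^N): \mathbf u=\mathbf 0\text{ on }\Gamma_U\}$. Boundary fields are split as $\mathbf v=v_{\rm n}\mathbf n+\mathbf v_{\rm t}$ with $\mathbf v_{\rm t}\cdot\mathbf n=0$. Let $f\in W^{1,\infty}(\Gamma_C;[0,+\infty[)$ and $g\in H^{1/2}(\Gamma_C)$; $H^{-1/2}(\Gamma_C)$ is the dual of $H^{1/2}(\Gamma_C)$, and $\int_{\Gamma_C}$ stands for the duality pairing where necessary. For $\mathbf F\in L^2(\Omega;\mathbb R^N)$ and $\mathbf T\in L^2(\Gamma_T;\mathbb R^N)$, say that $t_{\rm n}\in H^{-1/2}(\Gamma_C)$ is a *contact pressure* of $\mathbf u\in V$ for $(\mathbf F,\mathbf T)$ if $\mathrm{div}\,\boldsymbol\sigma(\mathbf u)+\mathbf F=\mathbf 0$ in $\Omega$, $\boldsymbol\sigma(\mathbf u)\mathbf n=\mathbf T$ on $\Gamma_T$, $t_{\rm n}$ is the normal component of $\boldsymbol\sigma(\mathbf u)\mathbf n$ on $\Gamma_C$, $t_{\rm n}\le 0$, and $$\int_{\Gamma_C}(u_{\rm n}-g)(t-t_{\rm n})\ge 0\qquad\text{for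 all } t\in H^{-1/2}(\Gamma_C),\ t\le 0 .$$ * $\mathscr A(\mathbf F,\mathbf T,f)$ is the set of the $\mathbf u\in V$ with a contact pressure $t_{\rm n}$ for $(\mathbf F,\mathbf T)$ such that, for all $\mathbf v\in V$, $$a(\mathbf u,\mathbf v)\ge\int_\Omega\mathbf F\cdot\mathbf v+\int_{\Gamma_T}\mathbf T\cdot\mathbf v+\int_{\Gamma_C}t_{\rm n}v_{\rm n}+f\,t_{\rm n}|\mathbf v_{\rm t}| .$$ * $\mathbf u\in V$ is a solution of the *incremental problem* for $(\mathbf F,\mathbf T)$ and $\mathbf w_{\rm t}$ if it has a contact pressure $t_{\rm n}$ for $(\mathbf F,\mathbf T)$ such that, for all $\mathbf v\in V$, $$a(\mathbf u,\mathbf v-\mathbf u)\ge\int_\Omega\mathbf F\cdot(\mathbf v-\mathbf u)+\int_{\Gamma_T}\mathbf T\cdot(\mathbf v-\mathbf u)+\int_{\Gamma_C}t_{\rm n}(v_{\rm n}-u_{\rm n})+\int_{\Gamma_C}f\,t_{\rm n}\bigl(|\mathbf v_{\rm t}-\mathbf w_{\rm t}|-|\mathbf u_{\rm t}-\mathbf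 w_{\rm t}|\bigr).$$ For a set $A\subset V$ of displacements of the above kind, put $$q(A)=\sup_{\mathbf u,\mathbf v\in A,\ \mathbf u\ne\mathbf v}\frac{\bigl\langle f\,\boldsymbol\sigma(\mathbf u-\mathbf v)\mathbf n,\ |\mathbf u_{\rm t}-\mathbf v_{\rm t}|\,\mathbf n\bigr\rangle_{\Gamma_C}}{\|\mathbf u-\mathbf v\|_a\bigl\{\|\mathbf u-\mathbf v\|_a+\|\mathrm{div}\,\boldsymbol\sigma(\mathbf u-\mathbf v)\|_{L^2(\Omega)}+\|\boldsymbol\sigma(\mathbf u-\mathbf v)\mathbf n\|_{L^2(\Gamma_T)}\bigr\}} .$$ Let $BV^+([0,S];H)$ be the space of right-continuous functions of bounded variation from $[0,S]$ to $H$. For $\mathbf F\in BV^+([0,S];L^2(\Omega;\mathbb R^N))$ and $\mathbf T\in BV^+([0,S];L^2(\Gamma_T;\mathbb R^N))$, $f$ fulfils *condition $\mathscr C$ for $\mathbf F,\mathbf T$* if $q\bigl(\bigcup_{s\in[0,S]}\mathscr A(\mathbf F(s),\mathbf T(s),f)\bigr)<1$; it fulfils *uniform condition $\mathscr C$* if $q\bigl(\bigcup_{\mathbf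 F\in L^2,\mathbf T\in L^2}\mathscr A(\mathbf F,\mathbf T,f)\bigr)<1$. **Proposition.** 1. Let $S\ge 0$, $\mathbf F\in BV^+([0,S];L^2(\Omega;\mathbb R^N))$, $\mathbf T\in BV^+([0,S];L^2(\Gamma_T;\mathbb R^N))$, and let $f$ fulfil condition $\mathscr C$ for $\mathbf F,\mathbf T$. There is a constant $C>0$, depending only on $f,\boldsymbol\Lambda,\Omega,\Gamma_U,\Gamma_T,\Gamma_C,g$ and on $\mathbf F,\mathbf T$, such that for all $s_1,s_2\in[0,S]$, all $\mathbf u_1\in\mathscr A(\mathbf F(s_1),\mathbf T(s_1),f)$ and every solution $\mathbf u_2\in V$ of the incremental problem for $\mathbf F(s_2),\mathbf T(s_2)$ and $\mathbf w_{\rm t}=\mathbf u_{1,{\rm t}}$, $$\|\mathbf u_2-\mathbf u_1\|_{H^1}\le C\bigl(\|\mathbf F(s_2)-\mathbf F(s_1)\|_{L^2(\Omega)}+\|\mathbf T(s_2)-\mathbf T(s_1)\|_{L^2(\Gamma_T)}\bigr).$$ 2. If $f$ fulfils uniform condition $\mathscr C$, the same estimate holds for all such $S,\mathbf F,\mathbf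 T,s_1,s_2,\mathbf u_1,\mathbf u_2$, with a constant $C>0$ depending only on $f,\boldsymbol\Lambda,\Omega,\Gamma_U,\Gamma_T,\Gamma_C,g$. -/

import Mathlib

open MeasureTheory Set Filter Topology
open scoped ENNReal NNReal ContDiff RealInnerProductSpace

namespace Coulomb

/-! ### Euclidean space, matrices, strains -/

/-- The space `ℝ^N` with its Euclidean norm. -/
abbrev E (N : ℕ) := EuclideanSpace ℝ (Fin N)

/-- Real `N × N` matrices with the Frobenius scalar product `A : B = ∑ A_ij B_ij`. -/
abbrev Mat (N : ℕ) := EuclideanSpace ℝ (Fin N × Fin N)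

/-- Symmetric matrices, with the Frobenius scalar product. -/
def Sym (N : ℕ) : Submodule ℝ (Mat N) where
  carrier := {A | ∀ i j, A (i, j) = A (j, i)}
  add_mem' := by
    intro A B hA hB i j
    simp [hA i j, hB i j]
  zero_mem' := by
    intro i j
    simp
  smul_mem' := by
    intro c A hA i j
    simp [hA i j]

/-- The symmetric part `(G + ᵗG) / 2` of a matrix. -/
noncomputable def symPart {N : ℕ} (G : Mat N) : Sym N :=
  ⟨WithLp.toLp 2 fun p => (G (p.1, p.2) + G (p.2, p.1)) / 2, by
    intro i j
    simp [add_comm]⟩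

/-- The gradient matrix `(∂_j φ_i)_{ij}` of a differentiable vector field. -/
noncomputable def gradMat {N : ℕ} (φ : E N → E N) (x : E N) : Mat N :=
  WithLp.toLp 2 fun p => fderiv ℝ φ x (EuclideanSpace.single p.2 1) p.1

/-! ### The Sobolev space `H¹(Ω; ℝ^N)` -/

/-- The measurable field `G` is the weak gradient of `u` in `Ω`: `G_ij = ∂_j u_i`. -/
def IsWeakGrad {N : ℕ} (Ω : Set (E N)) (u : E N → E N) (G : E N → Mat N) : Prop :=
  ∀ φ : E N → ℝ, ContDiff ℝ ∞ φ → HasCompactSupport φ → tsupport φ ⊆ Ω → ∀ i j : Fin N,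
    ∫ x in Ω, u x i * fderiv ℝ φ x (EuclideanSpace.single j 1) = -∫ x in Ω, G x (i, j) * φ x

/-- The Hilbert space of pairs made of a displacement field and a matrix field, both in `L²(Ω)`. -/
abbrev SobolevPair {N : ℕ} (Ω : Set (E N)) :=
  WithLp 2 (Lp (E N) 2 (volume.restrict Ω) × Lp (Mat N) 2 (volume.restrict Ω))

lemma memLp_coord {N : ℕ} {ι : Type*} [Fintype ι] {μ : Measure (E N)}
    {u : E N → EuclideanSpace ℝ ι} (hu : MemLp u 2 μ) (i : ι) : MemLp (fun x => u x i) 2 μ :=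
  (EuclideanSpace.proj i : EuclideanSpace ℝ ι →L[ℝ] ℝ).comp_memLp' hu

lemma integrable_coord_mul {N : ℕ} {ι : Type*} [Fintype ι] {Ω : Set (E N)}
    {u : E N → EuclideanSpace ℝ ι} (hu : MemLp u 2 (volume.restrict Ω)) (i : ι)
    {ψ : E N → ℝ} (hψ : Continuous ψ) (hs : HasCompactSupport ψ) :
    Integrable (fun x => u x i * ψ x) (volume.restrict Ω) := by
  have h : MemLp ψ 2 (volume.restrict Ω) :=
    (hψ.memLp_of_hasCompactSupport (μ := volume) hs).restrict Ω
  exact (memLp_coord hu i).integrable_mul h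

lemma continuous_partial {N : ℕ} {φ : E N → ℝ} (hφ : ContDiff ℝ ∞ φ) (e : E N) :
    Continuous fun x => fderiv ℝ φ x e :=
  (hφ.continuous_fderiv (by simp)).clm_apply continuous_const

/-- `H¹(Ω; ℝ^N)`: pairs `(u, ∇u)` in `L²`, where `∇u` is the weak gradient of `u`. The norm is
`(‖u‖_{L²}² + ‖∇u‖_{L²}²)^{1/2}`. -/
def H1 {N : ℕ} (Ω : Set (E N)) : Submodule ℝ (SobolevPair Ω) where
  carrier := {p | IsWeakGrad Ω p.fst p.snd}
  add_mem' := by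
    intro p q hp hq φ hφ hc hs i j
    have hpf := Lp.memLp p.fst
    have hqf := Lp.memLp q.fst
    have hpg := Lp.memLp p.snd
    have hqg := Lp.memLp q.snd
    have hd : HasCompactSupport fun x => fderiv ℝ φ x (EuclideanSpace.single j 1) :=
      hc.fderiv_apply ℝ _
    have hdc := continuous_partial hφ (EuclideanSpace.single j 1)
    have e1 : (fun x => (p + q).fst x i * fderiv ℝ φ x (EuclideanSpace.single j 1))
        =ᵐ[volume.restrict Ω] fun x => p.fst x i * fderiv ℝ φ x (EuclideanSpace.single j 1)
          + q.fst x i * fderiv ℝ φ x (EuclideanSpace.single j 1) := by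
      filter_upwards [Lp.coeFn_add p.fst q.fst] with x hx
      rw [WithLp.add_fst, hx]
      simp [add_mul]
    have e2 : (fun x => (p + q).snd x (i, j) * φ x)
        =ᵐ[volume.restrict Ω] fun x => p.snd x (i, j) * φ x + q.snd x (i, j) * φ x := by
      filter_upwards [Lp.coeFn_add p.snd q.snd] with x hx
      rw [WithLp.add_snd, hx]
      simp [add_mul]
    rw [integral_congr_ae e1, integral_congr_ae e2,
      integral_add (integrable_coord_mul hpf i hdc hd) (integrable_coord_mul hqf i hdc hd),
      integral_add (integrable_coord_mul hpg (i, j) hφ.continuous hc)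
        (integrable_coord_mul hqg (i, j) hφ.continuous hc),
      hp φ hφ hc hs i j, hq φ hφ hc hs i j]
    ring
  zero_mem' := by
    intro φ hφ hc hs i j
    have e1 : (fun x => (0 : SobolevPair Ω).fst x i
        * fderiv ℝ φ x (EuclideanSpace.single j 1)) =ᵐ[volume.restrict Ω] fun _ => 0 := by
      filter_upwards [Lp.coeFn_zero (E N) 2 (volume.restrict Ω)] with x hx
      rw [WithLp.zero_fst, hx]
      simp
    have e2 : (fun x => (0 : SobolevPair Ω).snd x (i, j) * φ x)
        =ᵐ[volume.restrict Ω] fun _ => 0 := by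
      filter_upwards [Lp.coeFn_zero (Mat N) 2 (volume.restrict Ω)] with x hx
      rw [WithLp.zero_snd, hx]
      simp
    rw [integral_congr_ae e1, integral_congr_ae e2]
    simp
  smul_mem' := by
    intro c p hp φ hφ hc hs i j
    have e1 : (fun x => (c • p).fst x i * fderiv ℝ φ x (EuclideanSpace.single j 1))
        =ᵐ[volume.restrict Ω]
          fun x => c * (p.fst x i * fderiv ℝ φ x (EuclideanSpace.single j 1)) := by
      filter_upwards [Lp.coeFn_smul c p.fst] with x hx
      rw [WithLp.smul_fst, hx]
      simp [mul_assoc]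
    have e2 : (fun x => (c • p).snd x (i, j) * φ x)
        =ᵐ[volume.restrict Ω] fun x => c * (p.snd x (i, j) * φ x) := by
      filter_upwards [Lp.coeFn_smul c p.snd] with x hx
      rw [WithLp.smul_snd, hx]
      simp [mul_assoc]
    rw [integral_congr_ae e1, integral_congr_ae e2, integral_const_mul, integral_const_mul,
      hp φ hφ hc hs i j]
    ring

/-- The class in `L²(Ω; ℝ^N)` of an element of `H¹(Ω; ℝ^N)`. -/
noncomputable def disp {N : ℕ} {Ω : Set (E N)} (u : H1 Ω) : Lp (E N) 2 (volume.restrict Ω) :=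
  (u : SobolevPair Ω).fst

/-- The weak gradient of an element of `H¹(Ω; ℝ^N)`. -/
noncomputable def wgrad {N : ℕ} {Ω : Set (E N)} (u : H1 Ω) : Lp (Mat N) 2 (volume.restrict Ω) :=
  (u : SobolevPair Ω).snd

/-- The linearized strain `ε(u) = (∇u + ᵗ∇u) / 2`. -/
noncomputable def strain {N : ℕ} {Ω : Set (E N)} (u : H1 Ω) (x : E N) : Sym N :=
  symPart (wgrad u x)

/-! ### The spaces `H^{1/2}` and `H^{-1/2}` on a hypersurface -/

/-- The surface measure `ℋ^{N-1}` (normalized to agree with the area) on `Γ`. -/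
noncomputable def surf {N : ℕ} (Γ : Set (E N)) : Measure (E N) :=
  (μHE[N - 1] : Measure (E N)).restrict Γ

/-- The measure `|x - y|^{-N} dℋ^{N-1}(x) dℋ^{N-1}(y)` on `Γ × Γ`; note `N = d + 1` for
`d = N - 1` the dimension of `Γ`. -/
noncomputable def surfPair {N : ℕ} (Γ : Set (E N)) : Measure (E N × E N) :=
  ((surf Γ).prod (surf Γ)).withDensity fun z => ENNReal.ofReal (1 / ‖z.1 - z.2‖ ^ N)

lemma quasiMeasurePreserving_fst_aux {α : Type*} [MeasurableSpace α] (μ : Measure α) :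
    Measure.QuasiMeasurePreserving Prod.fst (μ.prod μ) μ := by
  refine ⟨measurable_fst, ?_⟩
  refine Measure.AbsolutelyContinuous.mk fun s hs h0 => ?_
  rw [Measure.map_apply measurable_fst hs, Measure.prod]
  by_cases hm : AEMeasurable (fun x => Measure.map (Prod.mk x) μ) μ
  · rw [Measure.bind_apply (measurable_fst hs) hm, lintegral_eq_zero_of_ae_eq_zero]
    have hs' : ∀ᵐ x ∂μ, x ∉ s := measure_eq_zero_iff_ae_notMem.1 h0
    filter_upwards [hs'] with x hx
    rw [Measure.map_apply measurable_prodMk_left (measurable_fst hs)]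
    have : Prod.mk x ⁻¹' (Prod.fst ⁻¹' s) = (∅ : Set α) := by
      ext y
      simp [hx]
    simp [this]
  · simp [Measure.bind, Measure.map_of_not_aemeasurable hm]

lemma quasiMeasurePreserving_snd_aux {α : Type*} [MeasurableSpace α] (μ : Measure α) :
    Measure.QuasiMeasurePreserving Prod.snd (μ.prod μ) μ := by
  refine ⟨measurable_snd, ?_⟩
  refine Measure.AbsolutelyContinuous.mk fun s hs h0 => ?_
  rw [Measure.map_apply measurable_snd hs, Measure.prod]
  by_cases hm : AEMeasurable (fun x => Measure.map (Prod.mk x) μ) μ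
  · rw [Measure.bind_apply (measurable_snd hs) hm, lintegral_eq_zero_of_ae_eq_zero]
    refine Eventually.of_forall fun x => ?_
    simp only [Pi.zero_apply]
    rw [Measure.map_apply measurable_prodMk_left (measurable_snd hs)]
    exact h0
  · simp [Measure.bind, Measure.map_of_not_aemeasurable hm]

lemma ae_surfPair {N : ℕ} {Γ : Set (E N)} {p : E N → Prop} (h : ∀ᵐ x ∂(surf Γ), p x) :
    ∀ᵐ z ∂(surfPair Γ), p z.1 ∧ p z.2 :=
  (withDensity_absolutelyContinuous _ _).ae_le
    (((quasiMeasurePreserving_fst_aux (surf Γ)).ae h).and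
      ((quasiMeasurePreserving_snd_aux (surf Γ)).ae h))

/-- The Hilbert space in which `H^{1/2}(Γ; F)` is embedded by `v ↦ (v, v(x) - v(y))`. -/
abbrev HalfPair {N : ℕ} (Γ : Set (E N)) (F : Type*) [NormedAddCommGroup F] :=
  WithLp 2 (Lp F 2 (surf Γ) × Lp F 2 (surfPair Γ))

/-- `H^{1/2}(Γ; F)`: the pairs `(v, w)` with `v ∈ L²(Γ)` and `w(x, y) = v(x) - v(y)`. The norm is
`(∫_Γ |v|² + ∫_{Γ×Γ} |v(x) - v(y)|² / |x - y|^{d+1})^{1/2}`, with `d = N - 1`. -/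
def HHalf {N : ℕ} (Γ : Set (E N)) (F : Type*) [NormedAddCommGroup F] [NormedSpace ℝ F] :
    Submodule ℝ (HalfPair Γ F) where
  carrier := {p | p.snd =ᵐ[surfPair Γ] fun z => p.fst z.1 - p.fst z.2}
  add_mem' := by
    intro p q hp hq
    simp only [Set.mem_ofPred_eq, WithLp.add_fst, WithLp.add_snd] at hp hq ⊢
    filter_upwards [hp, hq, Lp.coeFn_add p.snd q.snd,
      ae_surfPair (Lp.coeFn_add p.fst q.fst)] with z h1 h2 h3 h4
    rw [h3, h4.1, h4.2, Pi.add_apply, Pi.add_apply, Pi.add_apply, h1, h2]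
    abel
  zero_mem' := by
    simp only [Set.mem_ofPred_eq, WithLp.zero_fst, WithLp.zero_snd]
    filter_upwards [Lp.coeFn_zero F 2 (surfPair Γ),
      ae_surfPair (Lp.coeFn_zero F 2 (surf Γ))] with z h3 h4
    rw [h3, h4.1, h4.2]
    simp
  smul_mem' := by
    intro c p hp
    simp only [Set.mem_ofPred_eq, WithLp.smul_fst, WithLp.smul_snd] at hp ⊢
    filter_upwards [hp, Lp.coeFn_smul c p.snd,
      ae_surfPair (Lp.coeFn_smul c p.fst)] with z h1 h3 h4
    rw [h3, h4.1, h4.2, Pi.smul_apply, Pi.smul_apply, Pi.smul_apply, h1, smul_sub]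

section Half

variable {N : ℕ} {Γ : Set (E N)} {F : Type*} [NormedAddCommGroup F] [NormedSpace ℝ F]

/-- The function `φ` belongs to `H^{1/2}(Γ; F)`. -/
def MemHHalf (Γ : Set (E N)) (φ : E N → F) : Prop :=
  MemLp φ 2 (surf Γ) ∧ MemLp (fun z : E N × E N => φ z.1 - φ z.2) 2 (surfPair Γ)

/-- The element of `H^{1/2}(Γ; F)` given by a function. -/
noncomputable def toHHalf (φ : E N → F) (h : MemHHalf Γ φ) : HHalf Γ F :=
  ⟨WithLp.toLp 2 (h.1.toLp φ, h.2.toLp _), by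
    change h.2.toLp _ =ᵐ[surfPair Γ] fun z => h.1.toLp φ z.1 - h.1.toLp φ z.2
    filter_upwards [h.2.coeFn_toLp, ae_surfPair h.1.coeFn_toLp] with z h1 h2
    rw [h1, h2.1, h2.2]⟩

/-- `H^{-1/2}(Γ; F)`: the dual of `H^{1/2}(Γ; F)`. -/
abbrev HMinusHalf (Γ : Set (E N)) (F : Type*) [NormedAddCommGroup F] [NormedSpace ℝ F] :=
  StrongDual ℝ (HHalf Γ F)

open Classical in
/-- The duality pairing `⟨τ, φ⟩` of `τ ∈ H^{-1/2}(Γ; F)` with a function `φ ∈ H^{1/2}(Γ; F)`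
(by convention `0` for a function outside of `H^{1/2}`). -/
noncomputable def pair (τ : HMinusHalf Γ F) (φ : E N → F) : ℝ :=
  if h : MemHHalf Γ φ then τ (toHHalf φ h) else 0

/-- `t ≤ 0` in `H^{-1/2}(Γ)`. -/
def IsNonpos (t : HMinusHalf Γ ℝ) : Prop :=
  ∀ φ : E N → ℝ, MemHHalf Γ φ → (∀ᵐ x ∂(surf Γ), 0 ≤ φ x) → pair t φ ≤ 0

end Half

/-! ### Geometry -/

/-- Near `x₀`, the set `Ω` is the strict subgraph, in the direction of the unit vector `ν`, of a
`C^{1,1}` function `γ` of the coordinates orthogonal to `ν`. -/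
def IsC11Graph {N : ℕ} (Ω : Set (E N)) (x₀ ν : E N) (γ : E N → ℝ) (r : ℝ) : Prop :=
  ‖ν‖ = 1 ∧ ContDiff ℝ 1 γ ∧ (∃ K : ℝ≥0, LipschitzWith K (fderiv ℝ γ)) ∧
  (∀ (y : E N) (t : ℝ), γ (y + t • ν) = γ y) ∧ 0 < r ∧
  ∀ y ∈ Metric.ball x₀ r, y ∈ Ω ↔ ⟪y, ν⟫ < γ y

/-- `Ω` is of class `C^{1,1}`. -/
def IsC11 {N : ℕ} (Ω : Set (E N)) : Prop :=
  ∀ x₀ ∈ frontier Ω, ∃ ν γ r, IsC11Graph Ω x₀ ν γ r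

/-- `Γ` is an open subset of `∂Ω` for the relative topology. -/
def IsRelOpen {N : ℕ} (Ω Γ : Set (E N)) : Prop :=
  ∃ O : Set (E N), IsOpen O ∧ Γ = O ∩ frontier Ω

/-- The relatively open subset `Γ` of `∂Ω` is of class `C^{0,1}`: near each point `x₀` of its
relative boundary, in the coordinates orthogonal to `ν` in which `∂Ω` is a graph, `Γ` is the strict
subgraph, in the direction of the unit vector `e ⟂ ν`, of a Lipschitz function `h` of the
coordinates orthogonal to `ν` and `e`. -/
def IsLipschitzSubset {N : ℕ} (Ω Γ : Set (E N)) : Prop :=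
  ∀ x₀ ∈ closure Γ \ Γ, ∃ ν γ r, IsC11Graph Ω x₀ ν γ r ∧
    ∃ (e : E N) (h : E N → ℝ), ‖e‖ = 1 ∧ ⟪e, ν⟫ = 0 ∧ (∃ K : ℝ≥0, LipschitzWith K h) ∧
      (∀ (y : E N) (s t : ℝ), h (y + s • ν + t • e) = h y) ∧
      ∀ y ∈ Metric.ball x₀ r ∩ frontier Ω, y ∈ Γ ↔ ⟪y, e⟫ < h y

/-- The unit vector `n` is the outward unit normal to `Ω` at `x`: every closed cone around `-n`
(resp. `n`) with angle smaller than a right angle is, near `x`, inside (resp. outside) `Ω`. -/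
def IsOutwardNormal {N : ℕ} (Ω : Set (E N)) (x n : E N) : Prop :=
  ‖n‖ = 1 ∧ ∀ ε > 0, ∀ᶠ y in 𝓝 x,
    (⟪y - x, n⟫ < -ε * ‖y - x‖ → y ∈ Ω) ∧ (ε * ‖y - x‖ < ⟪y - x, n⟫ → y ∉ Ω)

open Classical in
/-- The outward unit normal to `Ω` (and `0` where it does not exist; it is unique). -/
noncomputable def outwardNormal {N : ℕ} (Ω : Set (E N)) (x : E N) : E N :=
  if h : ∃ n, IsOutwardNormal Ω x n then h.choose else 0

/-! ### Traces -/

/-- The function `w` on `∂Ω` is the trace of `u ∈ H¹(Ω; ℝ^N)`, for the trace operator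
`H¹(Ω; ℝ^N) → H^{1/2}(∂Ω; ℝ^N)`, the continuous extension of the restriction to `∂Ω` of smooth
functions: there are smooth `φ_k` with `φ_k → u` in `H¹(Ω)` and `φ_k → w` in `H^{1/2}(∂Ω)`. -/
def IsTrace {N : ℕ} (Ω : Set (E N)) (u : H1 Ω) (w : E N → E N) : Prop :=
  MemHHalf (frontier Ω) w ∧ ∃ φ : ℕ → E N → E N,
    (∀ k, ContDiff ℝ ∞ (φ k) ∧ HasCompactSupport (φ k)) ∧
    Tendsto (fun k => eLpNorm (fun x => φ k x - disp u x) 2 (volume.restrict Ω)) atTop (𝓝 0) ∧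
    Tendsto (fun k => eLpNorm (fun x => gradMat (φ k) x - wgrad u x) 2 (volume.restrict Ω))
      atTop (𝓝 0) ∧
    Tendsto (fun k => eLpNorm (fun x => φ k x - w x) 2 (surf (frontier Ω))) atTop (𝓝 0) ∧
    Tendsto (fun k => eLpNorm (fun z : E N × E N => (φ k z.1 - w z.1) - (φ k z.2 - w z.2)) 2
      (surfPair (frontier Ω))) atTop (𝓝 0)

open Classical in
/-- The trace of `u` on `∂Ω`. -/
noncomputable def trace {N : ℕ} {Ω : Set (E N)} (u : H1 Ω) : E N → E N :=
  if h : ∃ w, IsTrace Ω u w then h.choose else 0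

/-! ### The contact problem -/

/-- The geometry, the elastic moduli, the friction coefficient and the gap. -/
structure Setting (N : ℕ) where
  /-- the reference configuration -/
  Ω : Set (E N)
  /-- the part of the boundary with a homogeneous Dirichlet condition -/
  ΓU : Set (E N)
  /-- the part of the boundary with a Neumann condition -/
  ΓT : Set (E N)
  /-- the part of the boundary with the contact condition -/
  ΓC : Set (E N)
  /-- the elastic moduli -/
  Λ : E N → (Sym N →L[ℝ] Sym N)
  /-- the friction coefficient -/
  f : E N → ℝ
  /-- the initial gap -/
  g : E N → ℝ
  isOpen_Ω : IsOpen Ω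
  isBounded_Ω : Bornology.IsBounded Ω
  isConnected_Ω : IsConnected Ω
  isC11_Ω : IsC11 Ω
  isRelOpen_ΓU : IsRelOpen Ω ΓU
  isRelOpen_ΓT : IsRelOpen Ω ΓT
  isRelOpen_ΓC : IsRelOpen Ω ΓC
  disjoint_UT : Disjoint ΓU ΓT
  disjoint_UC : Disjoint ΓU ΓC
  disjoint_TC : Disjoint ΓT ΓC
  frontier_eq : frontier Ω = closure ΓU ∪ closure ΓT ∪ closure ΓC
  ΓU_pos : 0 < surf ΓU univ
  isLipschitz_ΓC : IsLipschitzSubset Ω ΓC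
  dist_pos : ∃ δ > 0, ∀ x ∈ ΓU, ∀ y ∈ ΓC, δ ≤ dist x y
  Λ_bounded : MemLp Λ ∞ (volume.restrict Ω)
  Λ_symm : ∀ᵐ x ∂(volume.restrict Ω), ∀ e₁ e₂ : Sym N, ⟪e₁, Λ x e₂⟫ = ⟪e₂, Λ x e₁⟫
  Λ_elliptic : ∃ α > 0, ∀ᵐ x ∂(volume.restrict Ω), ∀ e : Sym N, α * ⟪e, e⟫ ≤ ⟪e, Λ x e⟫
  f_nonneg : ∀ x ∈ ΓC, 0 ≤ f x
  f_lipschitz : ∃ K : ℝ≥0, LipschitzOnWith K f ΓC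
  g_mem : MemHHalf ΓC g

namespace Setting

variable {N : ℕ} (P : Setting N)

/-- `L²(Ω; ℝ^N)`. -/
noncomputable abbrev L2Ω := Lp (E N) 2 (volume.restrict P.Ω)

/-- `L²(Γ_T; ℝ^N)`. -/
noncomputable abbrev L2T := Lp (E N) 2 (surf P.ΓT)

/-- `V`: the functions in `H¹(Ω; ℝ^N)` whose trace vanishes on `Γ_U`. -/
def V : Set (H1 P.Ω) := {u | ∃ w, IsTrace P.Ω u w ∧ ∀ᵐ x ∂(surf P.ΓU), w x = 0}

/-- `a(u, v) = ∫_Ω ε(u) : Λ ε(v)`. -/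
noncomputable def a (u v : H1 P.Ω) : ℝ :=
  ∫ x in P.Ω, ⟪strain u x, P.Λ x (strain v x)⟫

/-- The energy norm `‖u‖_a = a(u, u)^{1/2}`. -/
noncomputable def normA (u : H1 P.Ω) : ℝ := Real.sqrt (P.a u u)

/-- The work `∫_{Γ_T} T · v` of a surface force. -/
noncomputable def workT (T : P.L2T) (v : H1 P.Ω) : ℝ := ∫ x, ⟪T x, trace v x⟫ ∂(surf P.ΓT)

/-- The outward unit normal to `Ω`. -/
noncomputable def n : E N → E N := outwardNormal P.Ω

/-- The normal component `v · n` of a vector field on the boundary. -/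
noncomputable def normal (v : E N → E N) (x : E N) : ℝ := ⟪v x, P.n x⟫

/-- The tangential part `v - (v · n) n` of a vector field on the boundary. -/
noncomputable def tang (v : E N → E N) (x : E N) : E N := v x - ⟪v x, P.n x⟫ • P.n x

/-- `div σ(u) = h` in `Ω`, `σ(u) n = p` on `Γ_T` and `σ(u) n = τ` on `Γ_C`, for the stress
`σ(u) = Λ ε(u)`, in the weak sense of Green's formula. -/
def HasStressData (u : H1 P.Ω) (h : P.L2Ω) (p : P.L2T) (τ : HMinusHalf P.ΓC (E N)) : Prop :=
  ∀ v ∈ P.V, pair τ (trace v) = P.a u v + ⟪h, disp v⟫ - P.workT p v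

/-- `tn ∈ H^{-1/2}(Γ_C)` is the normal component of `τ ∈ H^{-1/2}(Γ_C; ℝ^N)`. -/
def IsNormalComponent (τ : HMinusHalf P.ΓC (E N)) (tn : HMinusHalf P.ΓC ℝ) : Prop :=
  ∀ φ : E N → ℝ, MemHHalf P.ΓC φ → pair tn φ = pair τ fun x => φ x • P.n x

/-- `t_n ≤ 0` is the normal component of the surface traction `σ(u) n` on `Γ_C` of a displacement
`u` with `div σ(u) + F = 0` in `Ω` and `σ(u) n = T` on `Γ_T`, and `t_n` satisfies the contact
conditions, written as a variational inequality. -/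
def IsContactPressure (F : P.L2Ω) (T : P.L2T) (u : H1 P.Ω) (tn : HMinusHalf P.ΓC ℝ) : Prop :=
  (∃ τ : HMinusHalf P.ΓC (E N), P.HasStressData u (-F) T τ ∧ P.IsNormalComponent τ tn) ∧
  IsNonpos tn ∧
  ∀ t : HMinusHalf P.ΓC ℝ, IsNonpos t →
    0 ≤ pair (t - tn) fun x => P.normal (trace u) x - P.g x

/-- The set `𝒜(F, T, f)` of admissible displacements for the load `(F, T)`. -/
def Admissible (F : P.L2Ω) (T : P.L2T) : Set (H1 P.Ω) :=
  {u | u ∈ P.V ∧ ∃ tn : HMinusHalf P.ΓC ℝ, P.IsContactPressure F T u tn ∧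
    ∀ v ∈ P.V, ⟪F, disp v⟫ + P.workT T v + pair tn (P.normal (trace v))
      + pair tn (fun x => P.f x * ‖P.tang (trace v) x‖) ≤ P.a u v}

/-- `u` is a solution of the incremental problem for the load `(F, T)` and the previous tangential
displacement `wt` on `Γ_C`. -/
def IsIncrementalSolution (F : P.L2Ω) (T : P.L2T) (wt : E N → E N) (u : H1 P.Ω) : Prop :=
  u ∈ P.V ∧ ∃ tn : HMinusHalf P.ΓC ℝ, P.IsContactPressure F T u tn ∧
    ∀ v ∈ P.V, ⟪F, disp (v - u)⟫ + P.workT T (v - u)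
      + pair tn (fun x => P.normal (trace v) x - P.normal (trace u) x)
      + pair tn (fun x => P.f x *
          (‖P.tang (trace v) x - wt x‖ - ‖P.tang (trace u) x - wt x‖)) ≤ P.a u (v - u)

/-- The supremum over distinct `u, v ∈ A` of the quotient of
`⟨f σ(u - v) n, |u_t - v_t| n⟩` by
`‖u - v‖_a (‖u - v‖_a + ‖div σ(u - v)‖_{L²(Ω)} + ‖σ(u - v) n‖_{L²(Γ_T)})` is `< 1`. -/
def FrictionQuotientLtOne (A : Set (H1 P.Ω)) : Prop :=
  ∃ κ < (1 : ℝ), ∀ u ∈ A, ∀ v ∈ A, u ≠ v →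
    ∀ (h : P.L2Ω) (p : P.L2T) (τ : HMinusHalf P.ΓC (E N)), P.HasStressData (u - v) h p τ →
      pair τ (fun x => (P.f x * ‖P.tang (trace u) x - P.tang (trace v) x‖) • P.n x)
        / (P.normA (u - v) * (P.normA (u - v) + ‖h‖ + ‖p‖)) ≤ κ

/-- Condition `𝒞` for the data `F`, `T` on `[0, S]`. -/
def ConditionC (S : ℝ) (F : ℝ → P.L2Ω) (T : ℝ → P.L2T) : Prop :=
  P.FrictionQuotientLtOne (⋃ s ∈ Icc 0 S, P.Admissible (F s) (T s))

/-- Uniform condition `𝒞`. -/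
def UniformConditionC : Prop :=
  P.FrictionQuotientLtOne (⋃ (F : P.L2Ω) (T : P.L2T), P.Admissible F T)

end Setting

/-- `BV⁺([0, S]; X)`: right-continuous functions with bounded variation on `[0, S]`. -/
def IsBVPlus {X : Type*} [NormedAddCommGroup X] (S : ℝ) (u : ℝ → X) : Prop :=
  BoundedVariationOn u (Icc 0 S) ∧ ∀ s ∈ Ico 0 S, ContinuousWithinAt u (Ici s) s

end Coulomb

namespace Coulomb

/-! Put w = u₂ - u₁, and let t₁, t₂ be the contact pressures. Test the inequality that defines 𝒜 for
u₁ with w, test the incremental inequality for u₂ with u₁, and add. This bounds a(w, w) by the work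
of the load increments on w, plus ∫ (t₂ - t₁) w_n, plus ∫ f (t₂ - t₁) |w_t|. The contact inequality
of each state, tested with the pressure of the other, makes the second term nonpositive. The third
term is the numerator of the friction quotient of the pair (u₂, u₁), since t₂ - t₁ is the normal
component of σ(w)n. This is `a_sub_le`.

By the triangle inequality and t₂ ≤ 0, the state u₂ is itself in 𝒜
(`IsIncrementalSolution.mem_admissible`), so the condition on f applies to the pair. The third term
is then at most κ ‖w‖_a (‖w‖_a + δF + δT) with κ < 1, where δF and δT are the norms of the load
increments. The part κ ‖w‖_a² is absorbed on the left, and a bound of ‖w‖_a by δF + δT remains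
(`estimate_of_energy`). The constant depends on the condition only through κ, which gives both
statements at once (`exists_estimate`).

The analysis behind this is Korn's inequality on V (`exists_norm_le_normA`) and the trace inequality
(`exists_workT_le`). Korn's inequality is proved in a half-space by Nitsche's reflection
(`korn_halfSpace_components`), carried to C¹ subgraphs by volume-preserving shears close to the
identity (`korn_local`), and globalized by cutoffs (`korn_second`). The version with a boundary
condition (`korn_first`) follows by contradiction: a sequence of normalized counterexamples
converges in L² by Rellich compactness, its limit has no strain, hence is a rigid displacement, and
it vanishes on a set of positive surface measure, hence everywhere.

Finally, the manipulations of duality pairings need every field involved to be in H^{1/2}(Γ_C). This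
rests on the normal n and the coefficient f being Lipschitz, and Lipschitz functions being
multipliers of H^{1/2} (`MemHHalf.of_bound`). -/

lemma exists_basis_zero_eq {n : ℕ} {ν : E (n + 1)} (hν : ‖ν‖ = 1) :
    ∃ b : OrthonormalBasis (Fin (n + 1)) ℝ (E (n + 1)), b 0 = ν := by
  have h := Orthonormal.exists_orthonormalBasis_extension_of_card_eq (𝕜 := ℝ) (E := E (n + 1))
    (ι := Fin (n + 1)) (by simp) (v := fun _ => ν) (s := {0}) (by
      constructor
      · intro i; simpa using hν
      · intro i j hij
        exact absurd (Subsingleton.elim i j) hij)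
  obtain ⟨b, hb⟩ := h
  exact ⟨b, hb 0 rfl⟩

/-- The coordinates `(s, y) ↦ s b₀ + ∑ yᵢ bᵢ₊₁` adapted to an orthonormal basis `b`. -/
noncomputable def cyl {n : ℕ} (b : OrthonormalBasis (Fin (n + 1)) ℝ (E (n + 1)))
    (p : ℝ × E n) : E (n + 1) :=
  b.repr.symm (WithLp.toLp 2 (Fin.cons p.1 p.2.ofLp : Fin (n + 1) → ℝ))

/-! ### Coordinates adapted to an orthonormal basis. -/

section Cyl

variable {n : ℕ} (b : OrthonormalBasis (Fin (n + 1)) ℝ (E (n + 1)))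

lemma cyl_apply (p : ℝ × E n) : cyl b p = p.1 • b 0 + ∑ i : Fin n, p.2 i • b i.succ := by
  rw [cyl, ← b.sum_repr (b.repr.symm _)]
  simp [Fin.sum_univ_succ]

/-- The adapted coordinates as a measurable equivalence. -/
noncomputable def cylEquiv : ℝ × E n ≃ᵐ E (n + 1) :=
  ((MeasurableEquiv.refl ℝ).prodCongr (MeasurableEquiv.toLp 2 (Fin n → ℝ)).symm).trans
    ((MeasurableEquiv.piFinSuccAbove (fun _ => ℝ) 0).symm.trans
      ((MeasurableEquiv.toLp 2 (Fin (n + 1) → ℝ)).trans b.repr.symm.toMeasurableEquiv))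

lemma coe_cylEquiv : ⇑(cylEquiv b) = cyl b := by
  ext1 p
  simp only [cylEquiv, cyl, MeasurableEquiv.trans_apply]
  change b.repr.symm _ = b.repr.symm _
  refine congrArg _ (congrArg (WithLp.toLp 2) ?_)
  change Fin.insertNth (α := fun _ => ℝ) 0 p.1 _ = _
  rw [Fin.insertNth_zero]
  rfl

lemma measurePreserving_cyl : MeasurePreserving (cyl b) volume volume := by
  rw [← coe_cylEquiv]
  have h1 : MeasurePreserving ((MeasurableEquiv.refl ℝ).prodCongr
      (MeasurableEquiv.toLp 2 (Fin n → ℝ)).symm) (volume : Measure (ℝ × E n)) volume :=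
    (MeasurePreserving.id volume).prod (EuclideanSpace.volume_preserving_symm_measurableEquiv_toLp _)
  have h2 := (volume_preserving_piFinSuccAbove (fun _ : Fin (n + 1) => ℝ) 0).symm
  have h3 := (EuclideanSpace.volume_preserving_symm_measurableEquiv_toLp (Fin (n + 1))).symm
  exact b.measurePreserving_repr_symm.comp (h3.comp (h2.comp h1))

lemma measurableEmbedding_cyl : MeasurableEmbedding (cyl b) := by
  rw [← coe_cylEquiv]
  exact (cylEquiv b).measurableEmbedding

lemma cyl_injective : Function.Injective (cyl b) := by
  rw [← coe_cylEquiv]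
  exact (cylEquiv b).injective

lemma cyl_sub (p q : ℝ × E n) : cyl b (p - q) = cyl b p - cyl b q := by
  simp only [cyl_apply, Prod.fst_sub, Prod.snd_sub, sub_smul, PiLp.sub_apply,
    Finset.sum_sub_distrib]
  abel

lemma cyl_add_smul (s t : ℝ) (y : E n) : cyl b (s + t, y) = cyl b (s, y) + t • b 0 := by
  simp only [cyl_apply, add_smul]
  abel

lemma inner_cyl (p : ℝ × E n) : ⟪cyl b p, b 0⟫ = p.1 := by
  rw [real_inner_comm, ← b.repr_apply_apply]
  simp [cyl]

lemma norm_cyl_sq (p : ℝ × E n) : ‖cyl b p‖ ^ 2 = p.1 ^ 2 + ‖p.2‖ ^ 2 := by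
  rw [cyl, LinearIsometryEquiv.norm_map, EuclideanSpace.norm_sq_eq, EuclideanSpace.norm_sq_eq,
    Fin.sum_univ_succ]
  simp

lemma norm_cyl_le (p : ℝ × E n) : ‖cyl b p‖ ≤ |p.1| + ‖p.2‖ := by
  have := norm_cyl_sq b p
  refine abs_le_of_sq_le_sq' ?_ (by positivity) |>.2
  nlinarith [abs_nonneg p.1, norm_nonneg p.2, sq_abs p.1, mul_nonneg (abs_nonneg p.1) (norm_nonneg p.2)]

lemma norm_snd_le_norm_cyl (p : ℝ × E n) : ‖p.2‖ ≤ ‖cyl b p‖ := by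
  have := norm_cyl_sq b p
  refine abs_le_of_sq_le_sq' ?_ (by positivity) |>.2
  nlinarith [sq_nonneg p.1]

lemma contDiff_cyl {m : ℕ∞ω} : ContDiff ℝ m (cyl b) := by
  have : cyl b = fun p => p.1 • b 0 + ∑ i : Fin n, p.2 i • b i.succ := by
    ext1 p; exact cyl_apply b p
  rw [this]
  fun_prop

@[fun_prop]
lemma continuous_cyl : Continuous (cyl b) := (contDiff_cyl b (m := 0)).continuous

lemma lintegral_cyl {f : E (n + 1) → ℝ≥0∞} (hf : Measurable f) :
    ∫⁻ x, f x = ∫⁻ y : E n, ∫⁻ s : ℝ, f (cyl b (s, y)) := by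
  rw [← (measurePreserving_cyl b).lintegral_comp hf, Measure.volume_eq_prod,
    lintegral_prod_symm (fun p => f (cyl b p))
      (hf.comp (measurePreserving_cyl b).measurable).aemeasurable]

lemma integral_cyl {F : Type*} [NormedAddCommGroup F] [NormedSpace ℝ F]
    {f : E (n + 1) → F} (hf : Integrable f) :
    ∫ x, f x = ∫ y : E n, ∫ s : ℝ, f (cyl b (s, y)) := by
  have h := (measurePreserving_cyl b).integrable_comp_emb (measurableEmbedding_cyl b) (g := f)
  rw [← (measurePreserving_cyl b).integral_comp (measurableEmbedding_cyl b),
    Measure.volume_eq_prod, integral_prod_symm (fun p => f (cyl b p))]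
  exact h.2 hf

end Cyl

/-! ### Korn's inequality in a half-space -/

section HalfSpace

variable {n : ℕ} (b : OrthonormalBasis (Fin (n + 1)) ℝ (E (n + 1))) (c : ℝ)

/-- The derivative of `f` in the direction of `bᵢ`. -/
noncomputable def pd (i : Fin (n + 1)) (f : E (n + 1) → ℝ) (x : E (n + 1)) : ℝ :=
  fderiv ℝ f x (b i)

/-- The half-space `⟪x, b₀⟫ < c`. -/
def halfSpace : Set (E (n + 1)) := {x | ⟪x, b 0⟫ < c}

/-- The dilation by `2` in the direction of `b₀` that fixes the hyperplane `⟪x, b₀⟫ = c`. -/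
noncomputable def dil (x : E (n + 1)) : E (n + 1) := x + (⟪x, b 0⟫ - c) • b 0

variable {b c}

lemma measurableSet_halfSpace : MeasurableSet (halfSpace b c) :=
  (isOpen_lt (by fun_prop) continuous_const).measurableSet

lemma contDiff_pd {i : Fin (n + 1)} {f : E (n + 1) → ℝ} (hf : ContDiff ℝ ∞ f) :
    ContDiff ℝ ∞ (pd b i f) :=
  (hf.fderiv_right (m := ∞) (by simp)).clm_apply contDiff_const

lemma hasCompactSupport_pd {i : Fin (n + 1)} {f : E (n + 1) → ℝ} (hf : HasCompactSupport f) :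
    HasCompactSupport (pd b i f) := hf.fderiv_apply ℝ _

lemma integrable_of_smooth {f : E (n + 1) → ℝ} (hf : ContDiff ℝ ∞ f) (hc : HasCompactSupport f) :
    Integrable f := hf.continuous.integrable_of_hasCompactSupport hc

lemma pd_mul {i : Fin (n + 1)} {f g : E (n + 1) → ℝ} (hf : ContDiff ℝ ∞ f)
    (hg : ContDiff ℝ ∞ g) (x : E (n + 1)) :
    pd b i (fun x => f x * g x) x = pd b i f x * g x + f x * pd b i g x := by
  simp only [pd]
  rw [fderiv_fun_mul (hf.differentiable (by simp) x) (hg.differentiable (by simp) x)]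
  simp
  ring

lemma pd_sub {i : Fin (n + 1)} {f g : E (n + 1) → ℝ} (hf : ContDiff ℝ ∞ f)
    (hg : ContDiff ℝ ∞ g) (x : E (n + 1)) :
    pd b i (f - g) x = pd b i f x - pd b i g x := by
  simp only [pd]
  rw [fderiv_sub (hf.differentiable (by simp) x) (hg.differentiable (by simp) x)]
  simp

lemma pd_comm {i j : Fin (n + 1)} {f : E (n + 1) → ℝ} (hf : ContDiff ℝ ∞ f) (x : E (n + 1)) :
    pd b i (pd b j f) x = pd b j (pd b i f) x := by
  have h : IsSymmSndFDerivAt ℝ f x := hf.contDiffAt.isSymmSndFDerivAt (by simp; exact ENat.LEInfty.out)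
  have hd : DifferentiableAt ℝ (fderiv ℝ f) x :=
    (hf.fderiv_right (m := ∞) (by simp)).differentiable (by simp) x
  simp only [pd]
  unfold pd
  rw [fderiv_clm_apply hd (by fun_prop), fderiv_clm_apply hd (by fun_prop)]
  simpa using h.eq (b i) (b j)

/-- The indicator of the half-space is constant along bᵢ, so integrating by parts against it leaves
nothing. -/
lemma integral_pd_tangential {i : Fin (n + 1)} (hi : i ≠ 0) {f : E (n + 1) → ℝ}
    (hf : ContDiff ℝ ∞ f) (hc : HasCompactSupport f) :
    ∫ x in halfSpace b c, pd b i f x = 0 := by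
  classical
  have hH := measurableSet_halfSpace (b := b) (c := c)
  have h1 : Integrable (pd b i f) := integrable_of_smooth (contDiff_pd hf) (hasCompactSupport_pd hc)
  have h2 := integrable_of_smooth hf hc
  have key := integral_bilinear_hasLineDerivAt_right_eq_neg_left_of_integrable
    (μ := (volume : Measure (E (n + 1)))) (f := (halfSpace b c).indicator fun _ => (1 : ℝ))
    (f' := fun _ => 0) (g := f) (g' := pd b i f) (v := b i) (B := ContinuousLinearMap.mul ℝ ℝ)
    (by simp) (by
      have : (fun x => ContinuousLinearMap.mul ℝ ℝ ((halfSpace b c).indicator (fun _ => (1 : ℝ)) x)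
          (pd b i f x)) = (halfSpace b c).indicator (pd b i f) := by
        ext x; by_cases hx : x ∈ halfSpace b c <;> simp [hx]
      rw [this]; exact h1.indicator hH) (by
      have : (fun x => ContinuousLinearMap.mul ℝ ℝ ((halfSpace b c).indicator (fun _ => (1 : ℝ)) x)
          (f x)) = (halfSpace b c).indicator f := by
        ext x; by_cases hx : x ∈ halfSpace b c <;> simp [hx]
      rw [this]; exact h2.indicator hH) (by
      intro x _
      have : (fun t : ℝ => (halfSpace b c).indicator (fun _ => (1 : ℝ)) (x + t • b i))
          = fun _ => (halfSpace b c).indicator (fun _ => (1 : ℝ)) x := by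
        ext t
        have : x + t • b i ∈ halfSpace b c ↔ x ∈ halfSpace b c := by
          simp [halfSpace, inner_add_left, inner_smul_left, b.inner_eq_ite, hi]
        by_cases hx : x ∈ halfSpace b c <;> simp [this, hx]
      unfold HasLineDerivAt
      rw [this]
      exact hasDerivAt_const _ _) (by
      intro x _
      exact (hf.differentiable (by simp) x).hasFDerivAt.hasLineDerivAt _)
  simp only [map_zero, zero_apply, integral_zero, neg_zero] at key
  rw [← key, ← integral_indicator hH]
  congr 1
  ext x; by_cases hx : x ∈ halfSpace b c <;> simp [hx]

lemma hasCompactSupport_comp_cyl {f : E (n + 1) → ℝ} (hc : HasCompactSupport f) (y : E n) :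
    HasCompactSupport fun s => f (cyl b (s, y)) := by
  obtain ⟨R, hR⟩ := hc.isCompact.isBounded.exists_norm_le
  refine HasCompactSupport.intro (isCompact_Icc (a := -R) (b := R)) fun s hs => ?_
  by_contra h
  have h1 := hR _ (subset_tsupport _ h)
  have h2 := norm_cyl_sq b (s, y)
  have h3 : |s| ≤ R := by
    refine le_trans (abs_le_of_sq_le_sq ?_ (norm_nonneg _)) h1
    simp only at h2
    nlinarith [sq_nonneg ‖y‖]
  exact hs (abs_le.1 h3)

/-- By Fubini and the fundamental theorem of calculus on each line of direction b₀, only the values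
of f on the hyperplane remain. -/
lemma integral_pd_normal {f : E (n + 1) → ℝ}
    (hf : ContDiff ℝ ∞ f) (hc : HasCompactSupport f) (h0 : ∀ x, ⟪x, b 0⟫ = c → f x = 0) :
    ∫ x in halfSpace b c, pd b 0 f x = 0 := by
  classical
  have hH := measurableSet_halfSpace (b := b) (c := c)
  have h1 : Integrable (pd b 0 f) := integrable_of_smooth (contDiff_pd hf) (hasCompactSupport_pd hc)
  rw [← integral_indicator hH, integral_cyl b (h1.indicator hH)]
  have : ∀ y : E n, ∫ s : ℝ, (halfSpace b c).indicator (pd b 0 f) (cyl b (s, y)) = 0 := by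
    intro y
    have e : (fun s : ℝ => (halfSpace b c).indicator (pd b 0 f) (cyl b (s, y)))
        = (Iio c).indicator (deriv fun s => f (cyl b (s, y))) := by
      ext s
      have hd : HasDerivAt (fun s => f (cyl b (s, y))) (pd b 0 f (cyl b (s, y))) s := by
        have h3 : HasDerivAt (fun s => cyl b (s, y)) (b 0) s := by
          simp only [cyl_apply]
          simpa using ((hasDerivAt_id s).smul_const (b 0)).add_const
            (∑ i : Fin n, y i • b i.succ)
        exact (hf.differentiable (by simp) _).hasFDerivAt.comp_hasDerivAt s h3
      have hm : cyl b (s, y) ∈ halfSpace b c ↔ s < c := by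
        simp [halfSpace, inner_cyl]
      by_cases hs : s < c
      · rw [indicator_of_mem (hm.2 hs), indicator_of_mem (by exact hs), hd.deriv]
      · rw [indicator_of_notMem (fun h => hs (hm.1 h)), indicator_of_notMem (by exact hs)]
    rw [e, integral_indicator measurableSet_Iio, ← integral_Iic_eq_integral_Iio,
      HasCompactSupport.integral_Iic_deriv_eq _ (hasCompactSupport_comp_cyl hc y)]
    · exact h0 _ (inner_cyl b (c, y))
    · exact (hf.comp ((contDiff_cyl b).comp (contDiff_id.prodMk contDiff_const))).of_le (by simp)
  simp [this]

lemma inner_dil (x : E (n + 1)) : ⟪dil b c x, b 0⟫ = 2 * ⟪x, b 0⟫ - c := by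
  simp [dil, inner_add_left, inner_smul_left]
  ring

lemma dil_mem_halfSpace {x : E (n + 1)} : dil b c x ∈ halfSpace b c ↔ x ∈ halfSpace b c := by
  simp only [halfSpace, mem_ofPred_eq, inner_dil]
  constructor <;> intro h <;> linarith

lemma contDiff_dil : ContDiff ℝ ∞ (dil b c) := by
  exact contDiff_id.add
    (((contDiff_id.inner ℝ contDiff_const).sub contDiff_const).smul contDiff_const)

lemma dil_of_inner_eq {x : E (n + 1)} (hx : ⟪x, b 0⟫ = c) : dil b c x = x := by
  simp [dil, hx]

lemma hasCompactSupport_comp_dil {f : E (n + 1) → ℝ} (hc : HasCompactSupport f) :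
    HasCompactSupport fun x => f (dil b c x) := by
  let e : E (n + 1) ≃ₜ E (n + 1) :=
    { toFun := dil b c
      invFun := fun x => x - ((⟪x, b 0⟫ - c) / 2) • b 0
      left_inv := by
        intro x
        simp only [inner_dil]
        simp only [dil]
        rw [show (2 * ⟪x, b 0⟫ - c - c) / 2 = ⟪x, b 0⟫ - c by ring]
        abel
      right_inv := by
        intro x
        simp only [dil, inner_sub_left, inner_smul_left, b.inner_eq_one]
        simp
        rw [sub_add, ← sub_smul]
        simp
        left
        ring
      continuous_toFun := contDiff_dil.continuous
      continuous_invFun := by fun_prop }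
  exact hc.comp_homeomorph e

lemma integral_comp_dil {f : E (n + 1) → ℝ} (hf : Integrable f)
    (hf' : Integrable fun x => f (dil b c x)) :
    ∫ x, f (dil b c x) = 2⁻¹ * ∫ x, f x := by
  rw [integral_cyl b hf', integral_cyl b hf, ← integral_const_mul]
  congr 1
  ext y
  have : ∀ s : ℝ, dil b c (cyl b (s, y)) = cyl b (2 * s - c, y) := by
    intro s
    rw [dil, inner_cyl, ← cyl_add_smul]
    congr 2
    ring
  simp only [this]
  rw [Measure.integral_comp_mul_left (fun s => f (cyl b (s - c, y))) 2,
    integral_sub_right_eq_self (fun s => f (cyl b (s, y)))]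
  norm_num

lemma pd_comp_dil (i : Fin (n + 1)) {f : E (n + 1) → ℝ} (hf : ContDiff ℝ ∞ f) (x : E (n + 1)) :
    pd b i (fun x => f (dil b c x)) x = (if i = 0 then 2 else 1) * pd b i f (dil b c x) := by
  have hd : HasFDerivAt (dil b c)
      (ContinuousLinearMap.id ℝ (E (n + 1)) + (innerSL ℝ (b 0)).smulRight (b 0)) x := by
    have h1 : HasFDerivAt (fun x : E (n + 1) => ⟪x, b 0⟫ - c) (innerSL ℝ (b 0)) x := by
      have := ((innerSL ℝ (b 0)).hasFDerivAt (x := x)).sub_const c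
      refine this.congr_of_eventuallyEq (Eventually.of_forall fun y => ?_)
      simp [real_inner_comm]
    exact (hasFDerivAt_id x).add (h1.smul_const (b 0))
  have h2 := ((hf.differentiable (by simp) (dil b c x)).hasFDerivAt.comp x hd).fderiv
  simp only [pd]
  rw [show (fun x => f (dil b c x)) = f ∘ dil b c from rfl, h2]
  by_cases hi : i = 0
  · subst hi
    simp
    ring
  · have : ⟪b 0, b i⟫ = 0 := b.inner_eq_zero (Ne.symm hi)
    simp [hi, this]

/-- `1` in the tangential directions and `-1` in the normal direction. -/
def flipSign (i : Fin (n + 1)) : ℝ := if i = 0 then -1 else 1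

/-- The dilation factor of `dil` in the direction `i`, with the sign of `flipSign`. -/
def flipDil (i : Fin (n + 1)) : ℝ := if i = 0 then -2 else 1

variable (b c) in
/-- Nitsche's reflection of a displacement across the hyperplane `⟪x, b₀⟫ = c`, written as a
function on the same side as the original one. -/
noncomputable def nitsche (U : Fin (n + 1) → E (n + 1) → ℝ) (i : Fin (n + 1)) (x : E (n + 1)) : ℝ :=
  3 * flipSign i * U i x + -2 * flipDil i * U i (dil b c x)

variable {U : Fin (n + 1) → E (n + 1) → ℝ}

lemma contDiff_nitsche (hU : ∀ i, ContDiff ℝ ∞ (U i)) (i : Fin (n + 1)) :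
    ContDiff ℝ ∞ (nitsche b c U i) :=
  (contDiff_const.mul (hU i)).add (contDiff_const.mul ((hU i).comp contDiff_dil))

lemma hasCompactSupport_nitsche (hc : ∀ i, HasCompactSupport (U i)) (i : Fin (n + 1)) :
    HasCompactSupport (nitsche b c U i) :=
  HasCompactSupport.add (HasCompactSupport.mul_left (hc i))
    (HasCompactSupport.mul_left (hasCompactSupport_comp_dil (hc i)))

lemma pd_nitsche (hU : ∀ i, ContDiff ℝ ∞ (U i)) (i j : Fin (n + 1)) (x : E (n + 1)) :
    pd b j (nitsche b c U i) x = 3 * flipSign i * pd b j (U i) x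
      + -2 * flipDil i * (flipSign j * flipDil j) * pd b j (U i) (dil b c x) := by
  have h1 := (hU i).differentiable (by simp) x
  have h2 := (((hU i).comp (contDiff_dil (b := b) (c := c))).differentiable (by simp) x)
  have h3 := pd_comp_dil (b := b) (c := c) j (hU i) x
  have : pd b j (nitsche b c U i) x = 3 * flipSign i * pd b j (U i) x
      + -2 * flipDil i * pd b j (fun x => U i (dil b c x)) x := by
    simp only [pd]
    have h4 : DifferentiableAt ℝ (fun x => U i (dil b c x)) x := h2
    change fderiv ℝ (fun x => 3 * flipSign i * U i x + -2 * flipDil i * U i (dil b c x)) x _ = _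
    rw [fderiv_fun_add (h1.const_mul _) (h4.const_mul _), fderiv_const_mul h1,
      fderiv_const_mul h4]
    simp
  rw [this, h3]
  simp only [flipSign, flipDil]
  split_ifs <;> ring

/-- Since `nitsche` is read on the original side, differentiating the reflected field in direction j
brings the sign `flipSign j`; the left side is thus twice a strain of the reflected field. Weighting
component i by the same factor as the derivative in direction i makes it depend on the strain of U
alone, at x and at its dilate. -/
lemma nitsche_strain (hU : ∀ i, ContDiff ℝ ∞ (U i)) (i j : Fin (n + 1)) (x : E (n + 1)) :
    flipSign j * pd b j (nitsche b c U i) x + flipSign i * pd b i (nitsche b c U j) x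
      = 3 * flipSign i * flipSign j * (pd b j (U i) x + pd b i (U j) x)
        - 2 * flipDil i * flipDil j *
          (pd b j (U i) (dil b c x) + pd b i (U j) (dil b c x)) := by
  rw [pd_nitsche hU, pd_nitsche hU]
  have h : ∀ i : Fin (n + 1), flipSign i * flipSign i = 1 := by
    intro i; simp only [flipSign]; split_ifs <;> norm_num
  linear_combination (-2 * flipDil i * flipDil j * pd b j (U i) (dil b c x)) * h j
    + (-2 * flipDil i * flipDil j * pd b i (U j) (dil b c x)) * h i

/-- A 2 × 2 minor of the gradient is a divergence, ∂ⱼ(Uᵢ ∂ᵢUⱼ) - ∂ᵢ(Uᵢ ∂ⱼUⱼ), and the tangential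
part of it integrates to zero. -/
lemma integral_minor_eq (hU : ∀ i, ContDiff ℝ ∞ (U i)) (hc : ∀ i, HasCompactSupport (U i))
    {i j : Fin (n + 1)} (hj : j ≠ 0) :
    ∫ x in halfSpace b c, (pd b j (U i) x * pd b i (U j) x - pd b i (U i) x * pd b j (U j) x)
      = -∫ x in halfSpace b c, pd b i (fun x => U i x * pd b j (U j) x) x := by
  have e : ∀ x, pd b j (U i) x * pd b i (U j) x - pd b i (U i) x * pd b j (U j) x
      = pd b j (fun x => U i x * pd b i (U j) x) x - pd b i (fun x => U i x * pd b j (U j) x) x := by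
    intro x
    rw [pd_mul (hU i) (contDiff_pd (hU j)), pd_mul (hU i) (contDiff_pd (hU j)), pd_comm (hU j)]
    ring
  have s1 : ∀ k l, ContDiff ℝ ∞ (fun x => U i x * pd b k (U l) x) := fun k l =>
    (hU i).mul (contDiff_pd (hU l))
  have s2 : ∀ k l, HasCompactSupport (fun x => U i x * pd b k (U l) x) := fun k l =>
    (hc i).mul_right
  simp only [e]
  rw [integral_sub, integral_pd_tangential hj (s1 i j) (s2 i j), zero_sub]
  · exact (integrable_of_smooth (contDiff_pd (s1 _ _)) (hasCompactSupport_pd (s2 _ _))).integrableOn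
  · exact (integrable_of_smooth (contDiff_pd (s1 _ _)) (hasCompactSupport_pd (s2 _ _))).integrableOn

lemma integrable_pd_mul_pd {V : Fin (n + 1) → E (n + 1) → ℝ} (hU : ∀ i, ContDiff ℝ ∞ (U i))
    (hV : ∀ i, ContDiff ℝ ∞ (V i)) (hc : ∀ i, HasCompactSupport (U i)) (i j k l : Fin (n + 1)) :
    Integrable (fun x => pd b i (U j) x * pd b k (V l) x) :=
  integrable_of_smooth ((contDiff_pd (hU j)).mul (contDiff_pd (hV l)))
    (hasCompactSupport_pd (hc j)).mul_right

/-- U and its reflection form a continuous field on the whole space, where the integral of a minor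
is zero: the boundary terms from the two sides cancel. -/
lemma integral_minor_add_nitsche (hU : ∀ i, ContDiff ℝ ∞ (U i))
    (hc : ∀ i, HasCompactSupport (U i)) (i j : Fin (n + 1)) :
    ∫ x in halfSpace b c, ((pd b j (U i) x * pd b i (U j) x - pd b i (U i) x * pd b j (U j) x)
      + flipSign i * flipSign j * (pd b j (nitsche b c U i) x * pd b i (nitsche b c U j) x
        - pd b i (nitsche b c U i) x * pd b j (nitsche b c U j) x)) = 0 := by
  have hW := contDiff_nitsche (b := b) (c := c) hU
  have hWc := hasCompactSupport_nitsche (b := b) (c := c) hc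
  rcases eq_or_ne i j with rfl | hij
  · simp
  -- The integrand is symmetric in i and j, and two distinct indices cannot both be normal.
  wlog hj : j ≠ 0 generalizing i j
  · have := this j i hij.symm (by rintro rfl; exact hj (Ne.symm hij))
    rw [← this]
    congr 1
    ext x
    ring
  have i1 : ∀ {V : Fin (n + 1) → E (n + 1) → ℝ}, (∀ i, ContDiff ℝ ∞ (V i)) →
      (∀ i, HasCompactSupport (V i)) → IntegrableOn (fun x => pd b j (V i) x * pd b i (V j) x
        - pd b i (V i) x * pd b j (V j) x) (halfSpace b c) := fun h1 h2 =>
    ((integrable_pd_mul_pd h1 h1 h2 _ _ _ _).sub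
      (integrable_pd_mul_pd h1 h1 h2 _ _ _ _)).integrableOn
  rw [integral_add (i1 hU hc) ((i1 hW hWc).const_mul _), integral_const_mul,
    integral_minor_eq hU hc hj, integral_minor_eq hW hWc hj]
  have s1 : ∀ {V : Fin (n + 1) → E (n + 1) → ℝ}, (∀ i, ContDiff ℝ ∞ (V i)) →
      ContDiff ℝ ∞ (fun x => V i x * pd b j (V j) x) := fun h => (h i).mul (contDiff_pd (h j))
  have s2 : ∀ {V : Fin (n + 1) → E (n + 1) → ℝ}, (∀ i, HasCompactSupport (V i)) →
      HasCompactSupport (fun x => V i x * pd b j (V j) x) := fun h => (h i).mul_right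
  by_cases hi : i = 0
  · subst hi
    -- On the hyperplane `dil` is the identity and the weights add up to 3 - 2 = 1 for tangential
    -- components and -3 + 4 = 1 for the normal one, so the two fluxes agree there.
    have h1 := integral_pd_normal (b := b) (c := c) ((s1 hW).sub (s1 hU))
      ((s2 hWc).sub (s2 hc)) (by
        intro x hx
        simp only [nitsche, pd_nitsche hU, dil_of_inner_eq hx]
        simp [flipSign, flipDil, hj]
        ring)
    have h2 : ∀ x, pd b 0 ((fun x => nitsche b c U 0 x * pd b j (nitsche b c U j) x)
        - fun x => U 0 x * pd b j (U j) x) x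
        = pd b 0 (fun x => nitsche b c U 0 x * pd b j (nitsche b c U j) x) x
          - pd b 0 (fun x => U 0 x * pd b j (U j) x) x := by
      intro x
      exact pd_sub (s1 hW) (s1 hU) x
    replace h1 := (integral_congr_ae (μ := volume.restrict (halfSpace b c))
      (Eventually.of_forall h2)).symm.trans h1
    rw [integral_sub
      (integrable_of_smooth (contDiff_pd (s1 hW)) (hasCompactSupport_pd (s2 hWc))).integrableOn
      (integrable_of_smooth (contDiff_pd (s1 hU)) (hasCompactSupport_pd (s2 hc))).integrableOn]
      at h1
    simp only [flipSign, hj, if_true, if_false]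
    linarith
  · rw [integral_pd_tangential hi (s1 hU) (s2 hc), integral_pd_tangential hi (s1 hW) (s2 hWc)]
    simp

/-- The constants are 18 = 2·3² and 128 = 2·2²·16, where 16 is the largest square of a product of
two dilation factors. -/
lemma sq_nitsche_strain_le (hU : ∀ i, ContDiff ℝ ∞ (U i)) (i j : Fin (n + 1)) (x : E (n + 1)) :
    (flipSign j * pd b j (nitsche b c U i) x + flipSign i * pd b i (nitsche b c U j) x) ^ 2
      ≤ 18 * (pd b j (U i) x + pd b i (U j) x) ^ 2
        + 128 * (pd b j (U i) (dil b c x) + pd b i (U j) (dil b c x)) ^ 2 := by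
  rw [nitsche_strain hU]
  set e := pd b j (U i) x + pd b i (U j) x
  set e' := pd b j (U i) (dil b c x) + pd b i (U j) (dil b c x)
  have h1 : (flipSign i * flipSign j) ^ 2 = 1 := by
    simp only [flipSign]; split_ifs <;> norm_num
  have h2 : (flipDil i * flipDil j) ^ 2 ≤ 16 := by
    simp only [flipDil]; split_ifs <;> norm_num
  have h3 : (3 * flipSign i * flipSign j * e - 2 * flipDil i * flipDil j * e') ^ 2
      ≤ 2 * (9 * (flipSign i * flipSign j) ^ 2 * e ^ 2)
        + 2 * (4 * (flipDil i * flipDil j) ^ 2 * e' ^ 2) := by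
    nlinarith [sq_nonneg (3 * flipSign i * flipSign j * e + 2 * flipDil i * flipDil j * e')]
  rw [h1] at h3
  nlinarith [mul_le_mul_of_nonneg_right h2 (sq_nonneg e')]

/-- Korn's inequality in a half-space for the components of a displacement in an orthonormal
basis. -/
lemma korn_halfSpace_components (hU : ∀ i, ContDiff ℝ ∞ (U i))
    (hc : ∀ i, HasCompactSupport (U i)) :
    ∑ i, ∑ j, ∫ x in halfSpace b c, pd b j (U i) x ^ 2
      ≤ 50 * ∑ i, ∑ j, ∫ x in halfSpace b c, (pd b j (U i) x + pd b i (U j) x) ^ 2 := by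
  have hW := contDiff_nitsche (b := b) (c := c) hU
  have hWc := hasCompactSupport_nitsche (b := b) (c := c) hc
  set W := nitsche b c U with hWdef
  set H := halfSpace b c
  have ie : ∀ i j, Integrable (fun x => (pd b j (U i) x + pd b i (U j) x) ^ 2) := fun i j =>
    integrable_of_smooth (((contDiff_pd (hU i)).add (contDiff_pd (hU j))).pow 2) (by
      have : HasCompactSupport (fun x => pd b j (U i) x + pd b i (U j) x) :=
        HasCompactSupport.add (hasCompactSupport_pd (hc i)) (hasCompactSupport_pd (hc j))
      exact this.comp_left (g := fun t => t ^ 2) (by norm_num))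
  have isq : ∀ i j, Integrable (fun x => pd b j (U i) x ^ 2) := fun i j => by
    simpa only [sq] using integrable_pd_mul_pd hU hU hc j i j i
  have ied : ∀ i j, Integrable
      (fun x => (pd b j (U i) (dil b c x) + pd b i (U j) (dil b c x)) ^ 2) := fun i j =>
    integrable_of_smooth ((((contDiff_pd (hU i)).comp contDiff_dil).add
      ((contDiff_pd (hU j)).comp contDiff_dil)).pow 2) (by
      have : HasCompactSupport (fun x => (pd b j (U i) (dil b c x) + pd b i (U j) (dil b c x))) :=
        HasCompactSupport.add (hasCompactSupport_comp_dil (hasCompactSupport_pd (hc i)))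
          (hasCompactSupport_comp_dil (hasCompactSupport_pd (hc j)))
      exact this.comp_left (g := fun t => t ^ 2) (by norm_num))
  have hH : MeasurableSet H := measurableSet_halfSpace
  have dl : ∀ i j, ∫ x in H, (pd b j (U i) (dil b c x) + pd b i (U j) (dil b c x)) ^ 2
      = 2⁻¹ * ∫ x in H, (pd b j (U i) x + pd b i (U j) x) ^ 2 := by
    intro i j
    have e : ∀ x, H.indicator
        (fun x => (pd b j (U i) (dil b c x) + pd b i (U j) (dil b c x)) ^ 2) x
        = H.indicator (fun x => (pd b j (U i) x + pd b i (U j) x) ^ 2) (dil b c x) := by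
      intro x
      by_cases hx : x ∈ H
      · rw [indicator_of_mem hx, indicator_of_mem (dil_mem_halfSpace.2 hx)]
      · rw [indicator_of_notMem hx, indicator_of_notMem (fun h => hx (dil_mem_halfSpace.1 h))]
    rw [← integral_indicator hH, ← integral_indicator hH, ← integral_comp_dil (b := b) (c := c)]
    · exact integral_congr_ae (Eventually.of_forall e)
    · exact (ie i j).indicator hH
    · exact ((ied i j).indicator hH).congr (Eventually.of_forall e)
  -- The square of the strain is the sum of the squares of the derivatives and of a mixed product.
  -- Up to minors, the mixed products sum to the square of the divergence, which is dropped, as are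
  -- the squares of the derivatives of W.
  have pt : ∀ x, 2 * ∑ i, ∑ j, pd b j (U i) x ^ 2 ≤
      ∑ i, ∑ j, (19 * (pd b j (U i) x + pd b i (U j) x) ^ 2
        + 128 * (pd b j (U i) (dil b c x) + pd b i (U j) (dil b c x)) ^ 2
        - 2 * ((pd b j (U i) x * pd b i (U j) x - pd b i (U i) x * pd b j (U j) x)
      + flipSign i * flipSign j * (pd b j (W i) x * pd b i (W j) x
        - pd b i (W i) x * pd b j (W j) x))) := by
    intro x
    have h1 : ∀ i j, (pd b j (U i) x ^ 2 + pd b i (U j) x ^ 2)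
        + 2 * (pd b i (U i) x * pd b j (U j) x)
        + 2 * ((flipSign i * pd b i (W i) x) * (flipSign j * pd b j (W j) x)) ≤
        (19 * (pd b j (U i) x + pd b i (U j) x) ^ 2
        + 128 * (pd b j (U i) (dil b c x) + pd b i (U j) (dil b c x)) ^ 2
        - 2 * ((pd b j (U i) x * pd b i (U j) x - pd b i (U i) x * pd b j (U j) x)
      + flipSign i * flipSign j * (pd b j (W i) x * pd b i (W j) x
        - pd b i (W i) x * pd b j (W j) x))) := by
      intro i j
      have := sq_nitsche_strain_le (b := b) (c := c) hU i j x
      nlinarith [sq_nonneg (flipSign j * pd b j (W i) x), sq_nonneg (flipSign i * pd b i (W j) x)]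
    have h2 := Finset.sum_le_sum fun i (_ : i ∈ Finset.univ) =>
      Finset.sum_le_sum fun j (_ : j ∈ Finset.univ) => h1 i j
    refine le_trans ?_ h2
    simp only [Finset.sum_add_distrib, ← Finset.mul_sum, ← Finset.sum_mul]
    rw [Finset.sum_comm (f := fun i j => pd b i (U j) x ^ 2)]
    nlinarith [mul_self_nonneg (∑ i, pd b i (U i) x), mul_self_nonneg (∑ i, flipSign i * pd b i (W i) x)]
  have im : ∀ i j, Integrable (fun x =>
      (pd b j (U i) x * pd b i (U j) x - pd b i (U i) x * pd b j (U j) x)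
      + flipSign i * flipSign j * (pd b j (W i) x * pd b i (W j) x
        - pd b i (W i) x * pd b j (W j) x)) := fun i j =>
    ((integrable_pd_mul_pd hU hU hc _ _ _ _).sub (integrable_pd_mul_pd hU hU hc _ _ _ _)).add
      (((integrable_pd_mul_pd hW hW hWc _ _ _ _).sub
        (integrable_pd_mul_pd hW hW hWc _ _ _ _)).const_mul _)
  have ir : ∀ i j, Integrable (fun x => 19 * (pd b j (U i) x + pd b i (U j) x) ^ 2
        + 128 * (pd b j (U i) (dil b c x) + pd b i (U j) (dil b c x)) ^ 2
        - 2 * ((pd b j (U i) x * pd b i (U j) x - pd b i (U i) x * pd b j (U j) x)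
      + flipSign i * flipSign j * (pd b j (W i) x * pd b i (W j) x
        - pd b i (W i) x * pd b j (W j) x))) := fun i j =>
    (((ie i j).const_mul 19).add ((ied i j).const_mul 128)).sub ((im i j).const_mul 2)
  have ia : ∀ i j, Integrable (fun x => 19 * (pd b j (U i) x + pd b i (U j) x) ^ 2
        + 128 * (pd b j (U i) (dil b c x) + pd b i (U j) (dil b c x)) ^ 2) := fun i j =>
    ((ie i j).const_mul 19).add ((ied i j).const_mul 128)
  have key := setIntegral_mono (μ := volume) (s := H)
    ((integrable_finsetSum _ fun i _ => integrable_finsetSum _ fun j _ =>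
      isq i j).const_mul 2).integrableOn
    (integrable_finsetSum _ fun i _ => integrable_finsetSum _ fun j _ => ir i j).integrableOn pt
  rw [integral_const_mul, integral_finsetSum _ fun i _ =>
      (integrable_finsetSum _ fun j _ => isq i j).integrableOn,
    integral_finsetSum _ fun i _ => (integrable_finsetSum _ fun j _ =>
      ir i j).integrableOn] at key
  have k1 : ∀ i, ∫ x in H, ∑ j, pd b j (U i) x ^ 2 = ∑ j, ∫ x in H, pd b j (U i) x ^ 2 :=
    fun i => integral_finsetSum _ fun j _ => (isq i j).integrableOn
  -- The minors disappear and 83 = 19 + 128/2, the dilation halving the second integral. Dividing by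
  -- the factor 2 of `pt` gives 83/2 ≤ 50.
  have k2 : ∀ i, ∫ x in H, ∑ j, (19 * (pd b j (U i) x + pd b i (U j) x) ^ 2
        + 128 * (pd b j (U i) (dil b c x) + pd b i (U j) (dil b c x)) ^ 2
        - 2 * ((pd b j (U i) x * pd b i (U j) x - pd b i (U i) x * pd b j (U j) x)
      + flipSign i * flipSign j * (pd b j (W i) x * pd b i (W j) x
        - pd b i (W i) x * pd b j (W j) x)))
      = ∑ j, 83 * ∫ x in H, (pd b j (U i) x + pd b i (U j) x) ^ 2 := by
    intro i
    rw [integral_finsetSum _ fun j _ => (ir i j).integrableOn]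
    refine Finset.sum_congr rfl fun j _ => ?_
    have m := integral_minor_add_nitsche (b := b) (c := c) hU hc i j
    rw [integral_sub (ia i j).integrableOn
      ((im i j).const_mul 2).integrableOn, integral_add ((ie i j).const_mul 19).integrableOn
      ((ied i j).const_mul 128).integrableOn, integral_const_mul, integral_const_mul,
      integral_const_mul, dl, m]
    ring
  simp only [k1, k2, ← Finset.mul_sum] at key
  have : 0 ≤ ∑ i, ∑ j, ∫ x in H, (pd b j (U i) x + pd b i (U j) x) ^ 2 :=
    Finset.sum_nonneg fun i _ => Finset.sum_nonneg fun j _ => integral_nonneg fun x => sq_nonneg _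
  linarith

end HalfSpace

/-! ### Korn's inequality in a half-space, in invariant form and for C¹ fields. -/

section KornVector

variable {n : ℕ}

/-- `L + Lᵗ`, twice the symmetric part of an endomorphism. -/
noncomputable def symAdd (L : E (n + 1) →L[ℝ] E (n + 1)) : E (n + 1) →L[ℝ] E (n + 1) :=
  L + ContinuousLinearMap.adjoint L

@[fun_prop]
lemma continuous_symAdd : Continuous (symAdd (n := n)) := by
  unfold symAdd
  exact continuous_id.add (LinearIsometryEquiv.continuous _)

lemma symAdd_sub (L M : E (n + 1) →L[ℝ] E (n + 1)) : symAdd (L - M) = symAdd L - symAdd M := by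
  simp only [symAdd, map_sub]
  abel

lemma symAdd_add (L M : E (n + 1) →L[ℝ] E (n + 1)) : symAdd (L + M) = symAdd L + symAdd M := by
  simp only [symAdd, map_add]
  abel

lemma symAdd_smul (a : ℝ) (L : E (n + 1) →L[ℝ] E (n + 1)) : symAdd (a • L) = a • symAdd L := by
  simp [symAdd]

lemma symAdd_zero : symAdd (0 : E (n + 1) →L[ℝ] E (n + 1)) = 0 := by
  simp [symAdd]

lemma norm_symAdd_le (L : E (n + 1) →L[ℝ] E (n + 1)) : ‖symAdd L‖ ≤ 2 * ‖L‖ := by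
  refine (norm_add_le _ _).trans ?_
  rw [LinearIsometryEquiv.norm_map]
  linarith

lemma inner_symAdd (L : E (n + 1) →L[ℝ] E (n + 1)) (x y : E (n + 1)) :
    ⟪symAdd L x, y⟫ = ⟪L x, y⟫ + ⟪L y, x⟫ := by
  simp only [symAdd, add_apply, inner_add_left, ContinuousLinearMap.adjoint_inner_left]
  rw [real_inner_comm x]

lemma norm_sq_le_sum_inner_sq (b : OrthonormalBasis (Fin (n + 1)) ℝ (E (n + 1)))
    (L : E (n + 1) →L[ℝ] E (n + 1)) : ‖L‖ ^ 2 ≤ ∑ i, ∑ j, ⟪L (b j), b i⟫ ^ 2 := by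
  have h1 : ∀ j, ‖L (b j)‖ ^ 2 = ∑ i, ⟪L (b j), b i⟫ ^ 2 := fun j => by
    rw [← b.sum_sq_inner_left (L (b j))]
  rw [Finset.sum_comm]
  simp only [← h1]
  have hS : 0 ≤ ∑ j, ‖L (b j)‖ ^ 2 := Finset.sum_nonneg fun _ _ => sq_nonneg _
  have : ‖L‖ ≤ √(∑ j, ‖L (b j)‖ ^ 2) := by
    refine ContinuousLinearMap.opNorm_le_bound _ (Real.sqrt_nonneg _) fun x => ?_
    conv_lhs => rw [← b.sum_repr x]
    rw [map_sum]
    calc ‖∑ j, L (b.repr x j • b j)‖ ≤ ∑ j, ‖L (b j)‖ * |b.repr x j| := by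
          refine (norm_sum_le _ _).trans (Finset.sum_le_sum fun j _ => ?_)
          rw [map_smul, norm_smul, Real.norm_eq_abs, mul_comm]
      _ ≤ √(∑ j, ‖L (b j)‖ ^ 2) * √(∑ j, |b.repr x j| ^ 2) :=
          Real.sum_mul_le_sqrt_mul_sqrt _ _ _
      _ = √(∑ j, ‖L (b j)‖ ^ 2) * ‖x‖ := by
          congr 1
          rw [← b.repr.norm_map x, EuclideanSpace.norm_eq]
          simp
  calc ‖L‖ ^ 2 ≤ (√(∑ j, ‖L (b j)‖ ^ 2)) ^ 2 := by gcongr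
    _ = _ := Real.sq_sqrt hS

variable {b : OrthonormalBasis (Fin (n + 1)) ℝ (E (n + 1))} {c : ℝ}

lemma integrable_comp_fderiv {F : Type*} [NormedAddCommGroup F] {u : E (n + 1) → E (n + 1)}
    (hu : ContDiff ℝ 1 u) (hc : HasCompactSupport u)
    {g : (E (n + 1) →L[ℝ] E (n + 1)) → F} (hg : Continuous g) (h0 : g 0 = 0) :
    Integrable fun x => g (fderiv ℝ u x) :=
  (hg.comp (hu.continuous_fderiv one_ne_zero)).integrable_of_hasCompactSupport
    ((hc.fderiv ℝ).comp_left h0)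

/-- The factor (n + 1)² counts the entries of the strain, each bounded by the operator norm. -/
lemma korn_halfSpace_smooth {u : E (n + 1) → E (n + 1)} (hu : ContDiff ℝ ∞ u)
    (hc : HasCompactSupport u) :
    ∫ x in halfSpace b c, ‖fderiv ℝ u x‖ ^ 2
      ≤ 50 * (n + 1) ^ 2 * ∫ x in halfSpace b c, ‖symAdd (fderiv ℝ u x)‖ ^ 2 := by
  set U : Fin (n + 1) → E (n + 1) → ℝ := fun i x => ⟪u x, b i⟫
  have hu1 : ContDiff ℝ 1 u := hu.of_le (by simp)
  have hU : ∀ i, ContDiff ℝ ∞ (U i) := fun i => hu.inner ℝ contDiff_const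
  have hUc : ∀ i, HasCompactSupport (U i) := fun i =>
    hc.comp_left (g := fun v => ⟪v, b i⟫) (by simp)
  have hpd : ∀ i j x, pd b j (U i) x = ⟪fderiv ℝ u x (b j), b i⟫ := fun i j x => by
    simp only [pd, U]
    rw [fderiv_inner_apply ℝ (hu.differentiable (by simp) x) (by fun_prop)]
    simp
  have key := korn_halfSpace_components (b := b) (c := c) hU hUc
  simp only [hpd] at key
  have h1 : ∫ x in halfSpace b c, ‖fderiv ℝ u x‖ ^ 2
      ≤ ∑ i, ∑ j, ∫ x in halfSpace b c, ⟪fderiv ℝ u x (b j), b i⟫ ^ 2 := by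
    have hi : ∀ i j, Integrable (fun x => ⟪fderiv ℝ u x (b j), b i⟫ ^ 2) := fun i j =>
      integrable_comp_fderiv hu1 hc (g := fun L => ⟪L (b j), b i⟫ ^ 2) (by fun_prop) (by simp)
    rw [← Finset.sum_congr rfl fun i _ =>
      integral_finsetSum Finset.univ fun j _ => (hi i j).integrableOn,
      ← integral_finsetSum Finset.univ fun i _ =>
        (integrable_finsetSum Finset.univ fun j _ => hi i j).integrableOn]
    refine setIntegral_mono ?_ ?_ fun x => norm_sq_le_sum_inner_sq b _
    · exact (integrable_comp_fderiv hu1 hc (g := fun L => ‖L‖ ^ 2) (by fun_prop)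
        (by simp)).integrableOn
    · exact (integrable_finsetSum Finset.univ fun i _ =>
        integrable_finsetSum Finset.univ fun j _ => hi i j).integrableOn
  have h2 : ∀ i j, ∫ x in halfSpace b c,
      (⟪fderiv ℝ u x (b j), b i⟫ + ⟪fderiv ℝ u x (b i), b j⟫) ^ 2
      ≤ ∫ x in halfSpace b c, ‖symAdd (fderiv ℝ u x)‖ ^ 2 := by
    intro i j
    refine setIntegral_mono ?_ ?_ fun x => ?_
    · exact (integrable_comp_fderiv hu1 hc (g := fun L => (⟪L (b j), b i⟫ + ⟪L (b i), b j⟫) ^ 2)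
        (by fun_prop) (by simp)).integrableOn
    · exact (integrable_comp_fderiv hu1 hc (g := fun L => ‖symAdd L‖ ^ 2)
        (by fun_prop) (by simp [symAdd_zero])).integrableOn
    · simp only
      rw [← inner_symAdd, ← sq_abs]
      gcongr
      refine (abs_real_inner_le_norm _ _).trans ?_
      rw [b.norm_eq_one, mul_one]
      simpa using (symAdd (fderiv ℝ u x)).le_opNorm (b j)
  refine h1.trans (key.trans ?_)
  have h3 := Finset.sum_le_sum fun i (_ : i ∈ Finset.univ) =>
    Finset.sum_le_sum fun j (_ : j ∈ Finset.univ) => h2 i j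
  simp only [Finset.sum_const, Finset.card_univ, Fintype.card_fin, nsmul_eq_mul] at h3
  push_cast at h3
  nlinarith [h3]

/-- A `C¹` function with compact support is approximated by smooth functions. -/
lemma exists_smooth_approx {u : E (n + 1) → E (n + 1)} (hu : ContDiff ℝ 1 u)
    (hc : HasCompactSupport u) :
    ∃ v : ℕ → E (n + 1) → E (n + 1), (∀ k, ContDiff ℝ ∞ (v k)) ∧ (∀ k, HasCompactSupport (v k)) ∧
      (∃ M R : ℝ, ∀ k x, ‖fderiv ℝ (v k) x‖ ≤ M ∧ (R < ‖x‖ → fderiv ℝ (v k) x = 0)) ∧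
      ∀ x, Tendsto (fun k => fderiv ℝ (v k) x) atTop (𝓝 (fderiv ℝ u x)) := by
  let φ : ℕ → ContDiffBump (0 : E (n + 1)) := fun k =>
    ⟨1 / (2 * (k + 1)), 1 / (k + 1), by positivity, by
      rw [div_lt_div_iff₀ (by positivity) (by positivity)]
      have : (0 : ℝ) ≤ k := k.cast_nonneg
      linarith⟩
  -- The mollifiers live in the unit ball, so all the approximations are supported in the ball of
  -- radius R + 1.
  have hφ1 : ∀ k, (φ k).rOut ≤ 1 := fun k => by
    change 1 / ((k : ℝ) + 1) ≤ 1
    rw [div_le_one (by positivity)]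
    linarith [k.cast_nonneg (α := ℝ)]
  have hφ0 : Tendsto (fun k => (φ k).rOut) atTop (𝓝 0) := tendsto_one_div_add_atTop_nhds_zero_nat
  have hli : ∀ k, LocallyIntegrable ((φ k).normed volume) := fun k =>
    (φ k).continuous_normed.locallyIntegrable
  have hli' : LocallyIntegrable u := hu.continuous.locallyIntegrable
  have hD : ∀ k x, HasFDerivAt
      (convolution ((φ k).normed volume) u (ContinuousLinearMap.lsmul ℝ ℝ) volume)
      (convolution ((φ k).normed volume) (fderiv ℝ u) (ContinuousLinearMap.lsmul ℝ ℝ) volume x) x :=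
    fun k x => hc.hasFDerivAt_convolution_right (ContinuousLinearMap.lsmul ℝ ℝ) (hli k) hu x
  obtain ⟨M, hM⟩ : ∃ M, ∀ x, ‖fderiv ℝ u x‖ ≤ M :=
    (hc.fderiv ℝ).exists_bound_of_continuous (hu.continuous_fderiv one_ne_zero)
  obtain ⟨R, hR⟩ := hc.isCompact.isBounded.exists_norm_le
  refine ⟨fun k => convolution ((φ k).normed volume) u (ContinuousLinearMap.lsmul ℝ ℝ) volume,
    fun k => ?_, fun k => ?_, ⟨M, R + 1, fun k x => ⟨?_, fun hx => ?_⟩⟩, fun x => ?_⟩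
  · exact (φ k).hasCompactSupport_normed.contDiff_convolution_left _ (φ k).contDiff_normed hli'
  · exact (φ k).hasCompactSupport_normed.convolution _ hc
  · rw [(hD k x).fderiv, convolution_def]
    refine (norm_integral_le_of_norm_le (g := fun t => M * (φ k).normed volume t)
      ((φ k).integrable_normed.const_mul M) (Eventually.of_forall fun t => ?_)).trans ?_
    · simp only [ContinuousLinearMap.lsmul_apply, norm_smul,
        Real.norm_of_nonneg ((φ k).nonneg_normed t)]
      rw [mul_comm]
      gcongr
      · exact (φ k).nonneg_normed t
      · exact hM _
    · rw [integral_const_mul, (φ k).integral_normed, mul_one]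
  · rw [(hD k x).fderiv, convolution_def]
    refine integral_eq_zero_of_ae (Eventually.of_forall fun t => ?_)
    simp only [ContinuousLinearMap.lsmul_apply, Pi.zero_apply, smul_eq_zero]
    by_contra! h
    have h1 : t ∈ Function.support ((φ k).normed volume) := h.1
    rw [(φ k).support_normed_eq, mem_ball_zero_iff] at h1
    have h2 := hR (x - t) (tsupport_fderiv_subset ℝ (subset_tsupport _ h.2))
    have h3 : ‖x‖ ≤ ‖x - t‖ + ‖t‖ := by simpa using norm_add_le (x - t) t
    linarith [hφ1 k]
  · simp only [fun k => (hD k x).fderiv]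
    exact ContDiffBump.convolution_tendsto_right_of_continuous hφ0
      (hu.continuous_fderiv one_ne_zero) x

/-- Korn's inequality in a half-space. -/
lemma korn_halfSpace {u : E (n + 1) → E (n + 1)} (hu : ContDiff ℝ 1 u)
    (hc : HasCompactSupport u) :
    ∫ x in halfSpace b c, ‖fderiv ℝ u x‖ ^ 2
      ≤ 50 * (n + 1) ^ 2 * ∫ x in halfSpace b c, ‖symAdd (fderiv ℝ u x)‖ ^ 2 := by
  obtain ⟨v, hv, hvc, ⟨M, R, hMR⟩, hlim⟩ := exists_smooth_approx hu hc
  -- Dominated convergence applies because the mollified gradients have a common bound and vanish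
  -- outside a common ball.
  have conv : ∀ g : (E (n + 1) →L[ℝ] E (n + 1)) → ℝ, Continuous g → g 0 = 0 →
      (∀ L, ‖L‖ ≤ M → ‖g L‖ ≤ 4 * M ^ 2) →
      Tendsto (fun k => ∫ x in halfSpace b c, g (fderiv ℝ (v k) x)) atTop
        (𝓝 (∫ x in halfSpace b c, g (fderiv ℝ u x))) := by
    intro g hg h0 hb
    refine tendsto_integral_of_dominated_convergence
      ((Metric.closedBall (0 : E (n + 1)) R).indicator fun _ => 4 * M ^ 2) (fun k => ?_) ?_
      (fun k => Eventually.of_forall fun x => ?_) (Eventually.of_forall fun x => ?_)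
    · exact (hg.comp ((hv k).continuous_fderiv (by simp))).aestronglyMeasurable
    · exact (integrable_indicator_iff Metric.isClosed_closedBall.measurableSet).2
        (integrableOn_const
          ((Measure.restrict_apply_le _ _).trans_lt measure_closedBall_lt_top).ne enorm_ne_top)
    · by_cases hx : x ∈ Metric.closedBall (0 : E (n + 1)) R
      · rw [indicator_of_mem hx]
        exact hb _ (hMR k x).1
      · rw [indicator_of_notMem hx, (hMR k x).2 (by simpa using hx), h0, norm_zero]
    · exact (hg.tendsto _).comp (hlim x)
  have h1 := conv (fun L => ‖L‖ ^ 2) (by fun_prop) (by simp) (fun L hL => by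
    have := norm_nonneg L
    rw [norm_pow, norm_norm]; nlinarith)
  have h2 := conv (fun L => ‖symAdd L‖ ^ 2) (by fun_prop) (by simp [symAdd_zero]) (fun L hL => by
    have := norm_symAdd_le L
    rw [norm_pow, norm_norm]; nlinarith [norm_nonneg (symAdd L)])
  exact le_of_tendsto_of_tendsto' h1 (h2.const_mul _) fun k => korn_halfSpace_smooth (hv k) (hvc k)

end KornVector

/-! ### Shears along a direction. -/

section Shear

variable {n : ℕ}

/-- The shear `x ↦ x + ρ(x) ν`. -/
noncomputable def shear (ν : E (n + 1)) (ρ : E (n + 1) → ℝ) (x : E (n + 1)) : E (n + 1) :=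
  x + ρ x • ν

/-- On each line of direction ν the function ρ is constant and the shear is a translation; Fubini
concludes. -/
lemma measurePreserving_shear {ν : E (n + 1)} (hν : ‖ν‖ = 1) {ρ : E (n + 1) → ℝ}
    (hρ : Measurable ρ) (hinv : ∀ (y : E (n + 1)) (t : ℝ), ρ (y + t • ν) = ρ y) :
    MeasurePreserving (shear ν ρ) := by
  obtain ⟨b, rfl⟩ := exists_basis_zero_eq hν
  have h1 : MeasurePreserving (fun p : E n × ℝ => (p.1, p.2 + ρ (cyl b (0, p.1))))
      (volume.prod volume) (volume.prod volume) := by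
    refine (MeasurePreserving.id (volume : Measure (E n))).skew_product
      (g := fun y s => s + ρ (cyl b (0, y))) (by fun_prop) (Eventually.of_forall fun y => ?_)
    exact (measurePreserving_add_right volume _).map_eq
  have h2 := (Measure.measurePreserving_swap (μ := (volume : Measure (E n)))
    (ν := (volume : Measure ℝ))).comp (h1.comp Measure.measurePreserving_swap)
  have h3 := (measurePreserving_cyl b).comp h2
  have h4 : cyl b ∘ Prod.swap ∘ (fun p : E n × ℝ => (p.1, p.2 + ρ (cyl b (0, p.1)))) ∘ Prod.swap
      = shear (b 0) ρ ∘ cyl b := by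
    ext1 p
    obtain ⟨s, y⟩ := p
    have : cyl b (s, y) = cyl b (0, y) + s • b 0 := by
      rw [← cyl_add_smul, zero_add]
    simp only [Function.comp, Prod.swap_prod_mk, shear, cyl_add_smul]
    rw [this, hinv]
  rw [h4] at h3
  have hm : Measurable (shear (b 0) ρ) := by unfold shear; fun_prop
  refine ⟨hm, ?_⟩
  rw [← (measurePreserving_cyl b).map_eq, Measure.map_map hm (measurePreserving_cyl b).measurable]
  exact h3.map_eq.trans (measurePreserving_cyl b).map_eq.symm

variable {ν : E (n + 1)} {ρ : E (n + 1) → ℝ}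
  (hinv : ∀ (y : E (n + 1)) (t : ℝ), ρ (y + t • ν) = ρ y)

/-- The shear `x ↦ x + ρ(x) ν` as a homeomorphism. -/
noncomputable def shearHomeo (hρ : Continuous ρ) : E (n + 1) ≃ₜ E (n + 1) where
  toFun := shear ν ρ
  invFun := shear ν (-ρ)
  left_inv x := by
    simp [shear, hinv]
  right_inv x := by
    have := hinv x (-ρ x)
    rw [neg_smul] at this
    simp [shear, this]
  continuous_toFun := by unfold shear; fun_prop
  continuous_invFun := by unfold shear; fun_prop

include hinv in
lemma fderiv_add_smul (x : E (n + 1)) (t : ℝ) : fderiv ℝ ρ (x + t • ν) = fderiv ℝ ρ x := by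
  have : (fun y => ρ (y + t • ν)) = ρ := funext fun y => hinv y t
  conv_rhs => rw [← this]
  rw [fderiv_comp_add_right]

include hinv in
lemma fderiv_apply_eq_zero (hρ : ContDiff ℝ 1 ρ) (x : E (n + 1)) : fderiv ℝ ρ x ν = 0 := by
  have h1 : HasDerivAt (fun t : ℝ => x + t • ν) ν 0 := by
    simpa using ((hasDerivAt_id (0 : ℝ)).smul_const ν).const_add x
  have h2 : HasFDerivAt ρ (fderiv ℝ ρ x) (x + (0 : ℝ) • ν) := by
    simpa using (hρ.differentiable (by simp) x).hasFDerivAt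
  have h3 := h2.comp_hasDerivAt (0 : ℝ) h1
  have h4 : ρ ∘ (fun t : ℝ => x + t • ν) = fun _ => ρ x := funext fun t => hinv x t
  rw [h4] at h3
  exact h3.unique (hasDerivAt_const _ _)

end Shear

/-! ### Korn's inequality near a boundary point, by perturbation of the tangent half-space. -/

section KornLocal

variable {n : ℕ}

/-- The half-space given by an affine inequality with a nonzero linear part. -/
lemma exists_halfSpace_eq (M : E (n + 1) →L[ℝ] ℝ) (hM : M ≠ 0) (k : ℝ) :
    ∃ (b : OrthonormalBasis (Fin (n + 1)) ℝ (E (n + 1))) (c : ℝ),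
      halfSpace b c = {x | M x < k} := by
  set m := (InnerProductSpace.toDual ℝ (E (n + 1))).symm M
  have hm : m ≠ 0 := by simpa [m] using hM
  have hm' : 0 < ‖m‖ := norm_pos_iff.2 hm
  obtain ⟨b, hb⟩ := exists_basis_zero_eq (ν := ‖m‖⁻¹ • m) (by
    rw [norm_smul, norm_inv, norm_norm, inv_mul_cancel₀ hm'.ne'])
  refine ⟨b, ‖m‖⁻¹ * k, ?_⟩
  ext x
  have : ⟪x, m⟫ = M x := by
    rw [real_inner_comm, InnerProductSpace.toDual_symm_apply]
  simp only [halfSpace, hb, mem_ofPred_eq, inner_smul_right, this]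
  exact mul_lt_mul_iff_of_pos_left (inv_pos.2 hm')

lemma integral_eq_of_eqOn_ball {Ω Ω' : Set (E (n + 1))} (hΩ : MeasurableSet Ω)
    (hΩ' : MeasurableSet Ω') {x₀ : E (n + 1)} {r : ℝ}
    (h : ∀ y ∈ Metric.ball x₀ r, y ∈ Ω ↔ y ∈ Ω') {f : E (n + 1) → ℝ}
    (hf : ∀ y, y ∉ Metric.ball x₀ r → f y = 0) : ∫ x in Ω, f x = ∫ x in Ω', f x := by
  rw [← integral_indicator hΩ, ← integral_indicator hΩ']
  congr 1
  ext y
  by_cases hy : y ∈ Metric.ball x₀ r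
  · by_cases hy' : y ∈ Ω
    · rw [indicator_of_mem hy', indicator_of_mem ((h y hy).1 hy')]
    · rw [indicator_of_notMem hy', indicator_of_notMem (fun h' => hy' ((h y hy).2 h'))]
  · have h0 := hf y hy
    by_cases h1 : y ∈ Ω <;> by_cases h2 : y ∈ Ω' <;> simp [h1, h2, h0]

/-- Korn's inequality for displacements supported near a point where the domain is a
`C¹` subgraph. -/
lemma korn_local {Ω : Set (E (n + 1))} (hΩo : MeasurableSet Ω) {ν x₀ : E (n + 1)} (hν : ‖ν‖ = 1)
    {γ : E (n + 1) → ℝ} (hγ : ContDiff ℝ 1 γ)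
    (hinv : ∀ (y : E (n + 1)) (t : ℝ), γ (y + t • ν) = γ y) {r : ℝ} (hr : 0 < r)
    (hΩ : ∀ y ∈ Metric.ball x₀ r, y ∈ Ω ↔ ⟪y, ν⟫ < γ y) :
    ∃ s > 0, ∃ C : ℝ, 0 ≤ C ∧ ∀ φ : E (n + 1) → E (n + 1), ContDiff ℝ ∞ φ →
      tsupport φ ⊆ Metric.ball x₀ s →
      ∫ x in Ω, ‖fderiv ℝ φ x‖ ^ 2 ≤ C * ∫ x in Ω, ‖symAdd (fderiv ℝ φ x)‖ ^ 2 := by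
  -- The shear by γ minus its first-order Taylor polynomial at x₀ sends the tangent half-space to
  -- the subgraph. Its displacement ρ has zero gradient at x₀, hence a small one nearby, so the
  -- change of variables is close to the identity and Korn's inequality survives it.
  set A := fderiv ℝ γ x₀ with hA
  have hAν : A ν = 0 := fderiv_apply_eq_zero hinv hγ x₀
  set ρ : E (n + 1) → ℝ := fun y => γ y - (γ x₀ + A (y - x₀)) with hρ
  have hρc : ContDiff ℝ 1 ρ := by
    refine hγ.sub (contDiff_const.add (A.contDiff.comp (contDiff_id.sub contDiff_const)))
  have hρinv : ∀ (y : E (n + 1)) (t : ℝ), ρ (y + t • ν) = ρ y := by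
    intro y t
    simp only [hρ, hinv, map_sub, map_add, map_smul, hAν]
    simp
  have hDρ : ∀ y, fderiv ℝ ρ y = fderiv ℝ γ y - A := by
    intro y
    have h1 : HasFDerivAt (fun y => γ x₀ + A (y - x₀)) A y := by
      have := (A.hasFDerivAt (x := y - x₀)).comp y ((hasFDerivAt_id y).sub_const x₀)
      exact (this.const_add (γ x₀))
    exact ((hγ.differentiable (by simp) y).hasFDerivAt.sub h1).fderiv
  set K : ℝ := 50 * (n + 1) ^ 2 with hK
  have hK1 : 1 ≤ K := by
    have : (0 : ℝ) ≤ n := n.cast_nonneg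
    nlinarith
  -- Small enough for the terms in δ²X at the end to add up to at most X/2.
  set δ : ℝ := 1 / (20 * K) with hδ
  have hδ0 : 0 < δ := by positivity
  have hcont : Continuous fun y => ‖fderiv ℝ ρ y‖ :=
    (hρc.continuous_fderiv one_ne_zero).norm
  have hsmall : ∀ᶠ y in 𝓝 x₀, ‖fderiv ℝ ρ y‖ < δ := by
    refine hcont.continuousAt.eventually_lt continuousAt_const ?_
    simpa [hDρ, ← hA] using hδ0
  obtain ⟨s', hs', hball⟩ := Metric.eventually_nhds_iff_ball.1 hsmall
  refine ⟨min s' r, lt_min hs' hr, 8 * K, by positivity, fun φ hφ hsupp => ?_⟩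
  have hφc : HasCompactSupport φ := by
    refine HasCompactSupport.of_support_subset_isCompact (isCompact_closedBall x₀ (min s' r)) ?_
    exact (subset_tsupport _).trans (hsupp.trans Metric.ball_subset_closedBall)
  have hφ1 : ContDiff ℝ 1 φ := hφ.of_le (by simp)
  set Φ := shearHomeo hρinv hρc.continuous with hΦ
  have hΦs : ∀ x, Φ x = x + ρ x • ν := fun x => rfl
  set v : E (n + 1) → E (n + 1) := fun x => φ (Φ x) with hv
  -- The shear is only C¹, hence so is the pulled-back field: this is the reason for the C¹ version
  -- of the half-space inequality.
  have hvd : ContDiff ℝ 1 v := hφ1.comp (contDiff_id.add (hρc.smul contDiff_const))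
  have hvc : HasCompactSupport v := hφc.comp_homeomorph Φ
  -- the half-space
  obtain ⟨b, c, hbc⟩ := exists_halfSpace_eq (innerSL ℝ ν - A) (by
    intro h
    have := congrArg (fun L => L ν) h
    simp [hAν, hν] at this) (γ x₀ - A x₀)
  set Ω' : Set (E (n + 1)) := {y | ⟪y, ν⟫ < γ y} with hΩ'
  have hΩ'm : MeasurableSet Ω' :=
    (isOpen_lt (by fun_prop) hγ.continuous).measurableSet
  have hpre : halfSpace b c = Φ ⁻¹' Ω' := by
    rw [hbc]
    ext x
    simp only [mem_ofPred_eq, mem_preimage, hΩ', hΦs, hinv, inner_add_left, inner_smul_left,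
      sub_apply, innerSL_apply_apply, real_inner_self_eq_norm_sq, hν, hρ, map_sub]
    rw [real_inner_comm]
    simp only [conj_trivial]
    constructor <;> intro h <;> linarith
  have hmp : MeasurePreserving Φ := measurePreserving_shear hν hρc.continuous.measurable hρinv
  have transfer : ∀ g : (E (n + 1) →L[ℝ] E (n + 1)) → ℝ, g 0 = 0 →
      ∫ x in halfSpace b c, g (fderiv ℝ φ (Φ x)) = ∫ x in Ω, g (fderiv ℝ φ x) := by
    intro g h0
    rw [hpre, hmp.setIntegral_preimage_emb Φ.measurableEmbedding (fun x => g (fderiv ℝ φ x))]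
    refine (integral_eq_of_eqOn_ball hΩo hΩ'm hΩ fun y hy => ?_).symm
    have : fderiv ℝ φ y = 0 := by
      by_contra h
      have h1 := hsupp (tsupport_fderiv_subset ℝ (subset_tsupport _ h))
      exact hy (Metric.ball_subset_ball (min_le_right _ _) h1)
    rw [this, h0]
  have hDv : ∀ x, ‖fderiv ℝ v x - fderiv ℝ φ (Φ x)‖ ≤ δ * ‖fderiv ℝ φ (Φ x)‖ := by
    intro x
    have h1 : HasFDerivAt Φ (ContinuousLinearMap.id ℝ _ + (fderiv ℝ ρ x).smulRight ν) x :=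
      (hasFDerivAt_id x).add ((hρc.differentiable (by simp) x).hasFDerivAt.smul_const ν)
    have h2 := ((hφ1.differentiable (by simp) (Φ x)).hasFDerivAt.comp x h1).fderiv
    have h3 : fderiv ℝ v x = fderiv ℝ (φ ∘ Φ) x := rfl
    rw [h3, h2, ContinuousLinearMap.comp_add, ContinuousLinearMap.comp_id, add_sub_cancel_left]
    -- The gradient of ρ is known to be small at Φ x. It is the same at x, because Φ moves points
    -- along ν, a direction in which ρ is invariant.
    by_cases hx : Φ x ∈ Metric.ball x₀ (min s' r)
    · have h4 : ‖fderiv ℝ ρ x‖ < δ := by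
        have := hball _ (Metric.ball_subset_ball (min_le_left _ _) hx)
        rwa [hΦs, fderiv_add_smul hρinv] at this
      refine (ContinuousLinearMap.opNorm_comp_le _ _).trans ?_
      rw [ContinuousLinearMap.norm_smulRight_apply, hν, mul_one, mul_comm]
      gcongr
    · have : fderiv ℝ φ (Φ x) = 0 := by
        by_contra h
        exact hx (hsupp (tsupport_fderiv_subset ℝ (subset_tsupport _ h)))
      simp [this]
  set X := ∫ x in halfSpace b c, ‖fderiv ℝ φ (Φ x)‖ ^ 2 with hX
  set S := ∫ x in halfSpace b c, ‖symAdd (fderiv ℝ φ (Φ x))‖ ^ 2 with hS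
  have iv : ∀ g : (E (n + 1) →L[ℝ] E (n + 1)) → ℝ, Continuous g → g 0 = 0 →
      IntegrableOn (fun x => g (fderiv ℝ v x)) (halfSpace b c) := fun g hg h0 =>
    (integrable_comp_fderiv hvd hvc hg h0).integrableOn
  have iφ : ∀ g : (E (n + 1) →L[ℝ] E (n + 1)) → ℝ, Continuous g → g 0 = 0 →
      IntegrableOn (fun x => g (fderiv ℝ φ (Φ x))) (halfSpace b c) := fun g hg h0 =>
    (hmp.integrable_comp_of_integrable (integrable_comp_fderiv hφ1 hφc hg h0)).integrableOn
  have h1 : X ≤ 2 * (∫ x in halfSpace b c, ‖fderiv ℝ v x‖ ^ 2) + 2 * δ ^ 2 * X := by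
    rw [hX, ← integral_const_mul, ← integral_const_mul, ← integral_add]
    · refine setIntegral_mono (iφ (fun L => ‖L‖ ^ 2) (by fun_prop) (by simp))
        (((iv (fun L => ‖L‖ ^ 2) (by fun_prop) (by simp)).const_mul _).add
          ((iφ (fun L => ‖L‖ ^ 2) (by fun_prop) (by simp)).const_mul _)) fun x => ?_
      have h := hDv x
      have h' : ‖fderiv ℝ φ (Φ x)‖ ≤ ‖fderiv ℝ v x‖ + δ * ‖fderiv ℝ φ (Φ x)‖ := by
        have := norm_sub_norm_le (fderiv ℝ φ (Φ x)) (fderiv ℝ v x)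
        rw [norm_sub_rev] at this
        linarith
      simp only
      nlinarith [sq_nonneg (‖fderiv ℝ v x‖ - δ * ‖fderiv ℝ φ (Φ x)‖), norm_nonneg (fderiv ℝ φ (Φ x))]
    · exact (iv (fun L => ‖L‖ ^ 2) (by fun_prop) (by simp)).const_mul _
    · exact (iφ (fun L => ‖L‖ ^ 2) (by fun_prop) (by simp)).const_mul _
  have h2 : ∫ x in halfSpace b c, ‖symAdd (fderiv ℝ v x)‖ ^ 2 ≤ 2 * S + 8 * δ ^ 2 * X := by
    rw [hX, hS, ← integral_const_mul, ← integral_const_mul, ← integral_add]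
    · refine setIntegral_mono (iv (fun L => ‖symAdd L‖ ^ 2) (by fun_prop) (by simp [symAdd_zero]))
        (((iφ (fun L => ‖symAdd L‖ ^ 2) (by fun_prop) (by simp [symAdd_zero])).const_mul _).add
          ((iφ (fun L => ‖L‖ ^ 2) (by fun_prop) (by simp)).const_mul _)) fun x => ?_
      have h := hDv x
      have h0 := norm_symAdd_le (fderiv ℝ v x - fderiv ℝ φ (Φ x))
      have h' : ‖symAdd (fderiv ℝ v x)‖
          ≤ ‖symAdd (fderiv ℝ φ (Φ x))‖ + 2 * (δ * ‖fderiv ℝ φ (Φ x)‖) := by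
        rw [symAdd_sub] at h0
        have := norm_sub_norm_le (symAdd (fderiv ℝ v x)) (symAdd (fderiv ℝ φ (Φ x)))
        linarith
      simp only
      nlinarith [sq_nonneg (‖symAdd (fderiv ℝ φ (Φ x))‖ - 2 * (δ * ‖fderiv ℝ φ (Φ x)‖)),
        norm_nonneg (symAdd (fderiv ℝ v x))]
    · exact (iφ (fun L => ‖symAdd L‖ ^ 2) (by fun_prop) (by simp [symAdd_zero])).const_mul _
    · exact (iφ (fun L => ‖L‖ ^ 2) (by fun_prop) (by simp)).const_mul _
  have h3 := korn_halfSpace (b := b) (c := c) hvd hvc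
  have hX0 : 0 ≤ X := integral_nonneg fun x => sq_nonneg _
  have h4 : δ ^ 2 * (16 * K + 2) ≤ 1 / 2 := by
    rw [hδ, div_pow, one_pow, div_mul_eq_mul_div, div_le_div_iff₀ (by positivity) (by norm_num)]
    nlinarith
  have hfin : X ≤ 8 * K * S := by
    -- The coefficient of X on the right is δ²(16K + 2) ≤ 1/2, whence X ≤ 4KS + X/2.
    have h5 : X ≤ 2 * (K * (2 * S + 8 * δ ^ 2 * X)) + 2 * δ ^ 2 * X := by
      refine h1.trans ?_
      have := h3.trans (mul_le_mul_of_nonneg_left h2 (by positivity : (0:ℝ) ≤ 50 * (n + 1) ^ 2))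
      rw [← hK] at this
      linarith
    have h6 := mul_le_mul_of_nonneg_right h4 hX0
    nlinarith
  rw [← transfer (fun L => ‖L‖ ^ 2) (by simp), ← transfer (fun L => ‖symAdd L‖ ^ 2)
    (by simp [symAdd_zero])]
  exact hfin

end KornLocal

/-! ### Korn's second inequality, by localization. -/

section KornGlobal

variable {n : ℕ}

lemma enorm_sq_eq_ofReal {F : Type*} [NormedAddCommGroup F] (a : F) :
    ‖a‖ₑ ^ 2 = ENNReal.ofReal (‖a‖ ^ 2) := by
  rw [ENNReal.ofReal_pow (norm_nonneg a), ofReal_norm]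

lemma enorm_sq_le_of_norm_sq_le {F G H : Type*} [NormedAddCommGroup F] [NormedAddCommGroup G]
    [NormedAddCommGroup H] {a : F} {b : G} {d : H} {p q : ℝ≥0}
    (h : ‖a‖ ^ 2 ≤ p * ‖b‖ ^ 2 + q * ‖d‖ ^ 2) : ‖a‖ₑ ^ 2 ≤ p * ‖b‖ₑ ^ 2 + q * ‖d‖ₑ ^ 2 := by
  rw [enorm_sq_eq_ofReal, enorm_sq_eq_ofReal, enorm_sq_eq_ofReal, ← ENNReal.ofReal_coe_nnreal,
    ← ENNReal.ofReal_coe_nnreal, ← ENNReal.ofReal_mul (by positivity),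
    ← ENNReal.ofReal_mul (by positivity), ← ENNReal.ofReal_add (by positivity) (by positivity)]
  exact ENNReal.ofReal_le_ofReal h

lemma lintegral_enorm_sq_le_of_integral_le {F G : Type*} [NormedAddCommGroup F]
    [NormedAddCommGroup G] {α : Type*} [MeasurableSpace α] {μ : Measure α} {f : α → F} {g : α → G}
    (hf : Integrable (fun x => ‖f x‖ ^ 2) μ) (hg : Integrable (fun x => ‖g x‖ ^ 2) μ) {C : ℝ}
    (hC : 0 ≤ C) (h : ∫ x, ‖f x‖ ^ 2 ∂μ ≤ C * ∫ x, ‖g x‖ ^ 2 ∂μ) :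
    ∫⁻ x, ‖f x‖ₑ ^ 2 ∂μ ≤ C.toNNReal * ∫⁻ x, ‖g x‖ₑ ^ 2 ∂μ := by
  simp only [enorm_sq_eq_ofReal]
  rw [← ofReal_integral_eq_lintegral_ofReal hf (Eventually.of_forall fun x => sq_nonneg _),
    ← ofReal_integral_eq_lintegral_ofReal hg (Eventually.of_forall fun x => sq_nonneg _),
    ← ENNReal.ofReal, ← ENNReal.ofReal_mul hC]
  exact ENNReal.ofReal_le_ofReal h

/-- Every point of the closure of a `C^{1,1}` domain has a neighborhood in which the domain is
a subgraph. -/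
lemma IsC11.exists_graph {Ω : Set (E (n + 1))} (hΩ : IsC11 Ω) (hΩo : IsOpen Ω) {x₀ : E (n + 1)}
    (hx : x₀ ∈ closure Ω) : ∃ (ν : E (n + 1)) (γ : E (n + 1) → ℝ) (r : ℝ), ‖ν‖ = 1 ∧
      ContDiff ℝ 1 γ ∧ (∀ (y : E (n + 1)) (t : ℝ), γ (y + t • ν) = γ y) ∧ 0 < r ∧
      ∀ y ∈ Metric.ball x₀ r, y ∈ Ω ↔ ⟪y, ν⟫ < γ y := by
  by_cases h : x₀ ∈ Ω
  · obtain ⟨r, hr, hb⟩ := Metric.isOpen_iff.1 hΩo x₀ h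
    -- At an interior point, a constant graph lying above a ball contained in Ω.
    refine ⟨EuclideanSpace.single 0 1, fun _ => ⟪x₀, EuclideanSpace.single 0 1⟫ + r, r, by simp,
      contDiff_const, fun _ _ => rfl, hr, fun y hy => ⟨fun _ => ?_, fun _ => hb hy⟩⟩
    have h1 : ⟪y - x₀, EuclideanSpace.single (0 : Fin (n + 1)) (1 : ℝ)⟫ ≤ ‖y - x₀‖ * 1 := by
      simpa using real_inner_le_norm (y - x₀) (EuclideanSpace.single (0 : Fin (n + 1)) (1 : ℝ))
    rw [inner_sub_left] at h1
    have h2 : ‖y - x₀‖ < r := by rwa [← dist_eq_norm]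
    linarith
  · obtain ⟨ν, γ, r, h1, h2, -, h3, h4, h5⟩ := hΩ x₀ (by
      rw [hΩo.frontier_eq]; exact ⟨hx, h⟩)
    exact ⟨ν, γ, r, h1, h2, h3, h4, h5⟩

lemma norm_symAdd_cutoff_sq_le (L : E (n + 1) →L[ℝ] E (n + 1)) (D : E (n + 1) →L[ℝ] ℝ)
    (v : E (n + 1)) {a M : ℝ} (ha : 0 ≤ a) (ha' : a ≤ 1) (hD : ‖D‖ ≤ M) :
    ‖a • symAdd L + symAdd (D.smulRight v)‖ ^ 2 ≤ 2 * ‖symAdd L‖ ^ 2 + 8 * M ^ 2 * ‖v‖ ^ 2 := by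
  have e1 : ‖a • symAdd L‖ ≤ ‖symAdd L‖ := by
    rw [norm_smul, Real.norm_of_nonneg ha]
    exact mul_le_of_le_one_left (norm_nonneg _) ha'
  have e2 : ‖symAdd (D.smulRight v)‖ ≤ 2 * (M * ‖v‖) := by
    refine (norm_symAdd_le _).trans ?_
    rw [ContinuousLinearMap.norm_smulRight_apply]
    gcongr
  have e5 : ‖a • symAdd L + symAdd (D.smulRight v)‖ ≤ ‖symAdd L‖ + 2 * (M * ‖v‖) :=
    (norm_add_le _ _).trans (add_le_add e1 e2)
  calc _ ≤ (‖symAdd L‖ + 2 * (M * ‖v‖)) ^ 2 := by gcongr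
    _ ≤ _ := by nlinarith [sq_nonneg (‖symAdd L‖ - 2 * (M * ‖v‖))]

/-- The local inequality is applied to χφ, with a cutoff χ equal to 1 near x₀. The commutator ∇χ ⊗ φ
accounts for the L² norm of φ on the right. -/
lemma korn_near {Ω : Set (E (n + 1))} (hΩo : IsOpen Ω) (hΩ : IsC11 Ω) {x₀ : E (n + 1)}
    (hx : x₀ ∈ closure Ω) : ∃ U ∈ 𝓝 x₀, ∃ C : ℝ≥0, ∀ φ : E (n + 1) → E (n + 1),
      ContDiff ℝ ∞ φ → HasCompactSupport φ → ∫⁻ x in Ω ∩ U, ‖fderiv ℝ φ x‖ₑ ^ 2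
        ≤ C * ((∫⁻ x in Ω, ‖symAdd (fderiv ℝ φ x)‖ₑ ^ 2) + ∫⁻ x in Ω, ‖φ x‖ₑ ^ 2) := by
  obtain ⟨ν, γ, r, hν, hγ, hinv, hr, hgr⟩ := hΩ.exists_graph hΩo hx
  obtain ⟨s, hs, C, hC, hkorn⟩ := korn_local hΩo.measurableSet hν hγ hinv hr hgr
  obtain ⟨χ, hχin, hχout⟩ : ∃ χ : ContDiffBump x₀, χ.rIn = s / 3 ∧ χ.rOut = s / 2 :=
    ⟨⟨s / 3, s / 2, by positivity, by linarith⟩, rfl, rfl⟩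
  have hχ1 : ContDiff ℝ ∞ χ := χ.contDiff
  obtain ⟨M, hM⟩ : ∃ M, ∀ x, ‖fderiv ℝ χ x‖ ≤ M :=
    (χ.hasCompactSupport.fderiv ℝ).exists_bound_of_continuous
      (hχ1.continuous_fderiv (by simp))
  refine ⟨Metric.ball x₀ (s / 3), Metric.ball_mem_nhds _ (by positivity),
    C.toNNReal * (2 + (8 * M ^ 2).toNNReal), fun φ hφ hc => ?_⟩
  set ψ : E (n + 1) → E (n + 1) := fun x => χ x • φ x
  have hψ : ContDiff ℝ ∞ ψ := hχ1.smul hφ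
  have hψ1 : ContDiff ℝ 1 ψ := hψ.of_le (by simp)
  have hψc : HasCompactSupport ψ := hc.mono fun x hx h0 => hx (by
    simp only [ψ, h0, smul_zero])
  have hψs : tsupport ψ ⊆ Metric.ball x₀ s := by
    refine (tsupport_smul_subset_left χ φ).trans ?_
    rw [χ.tsupport_eq]
    exact Metric.closedBall_subset_ball (by linarith)
  have h1 := lintegral_enorm_sq_le_of_integral_le
    (integrable_comp_fderiv hψ1 hψc (g := fun L => ‖L‖ ^ 2) (by fun_prop) (by simp)).integrableOn
    (integrable_comp_fderiv hψ1 hψc (g := fun L => ‖symAdd L‖ ^ 2) (by fun_prop)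
      (by simp [symAdd_zero])).integrableOn hC (hkorn ψ hψ hψs)
  have hD : ∀ x, fderiv ℝ ψ x = χ x • fderiv ℝ φ x + (fderiv ℝ χ x).smulRight (φ x) := fun x =>
    fderiv_fun_smul (hχ1.differentiable (by simp) x) (hφ.differentiable (by simp) x)
  have h2 : ∫⁻ x in Ω ∩ Metric.ball x₀ (s / 3), ‖fderiv ℝ φ x‖ₑ ^ 2
      ≤ ∫⁻ x in Ω, ‖fderiv ℝ ψ x‖ₑ ^ 2 := by
    refine le_trans (setLIntegral_mono' (hΩo.inter Metric.isOpen_ball).measurableSet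
      (g := fun x => ‖fderiv ℝ ψ x‖ₑ ^ 2) fun x hx => ?_) (lintegral_mono_set inter_subset_left)
    have : ψ =ᶠ[𝓝 x] φ := by
      filter_upwards [Metric.isOpen_ball.mem_nhds hx.2] with y hy
      simp only [ψ]
      rw [χ.one_of_mem_closedBall (hχin ▸ Metric.ball_subset_closedBall hy), one_smul]
    rw [this.fderiv_eq]
  have h3 : ∀ x, ‖symAdd (fderiv ℝ ψ x)‖ₑ ^ 2
      ≤ (2 : ℝ≥0) * ‖symAdd (fderiv ℝ φ x)‖ₑ ^ 2 + (8 * M ^ 2).toNNReal * ‖φ x‖ₑ ^ 2 := by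
    intro x
    refine enorm_sq_le_of_norm_sq_le ?_
    rw [Real.coe_toNNReal _ (by positivity), hD, symAdd_add, symAdd_smul]
    push_cast
    exact norm_symAdd_cutoff_sq_le _ _ _ χ.nonneg χ.le_one (hM x)
  have h4 : ∫⁻ x in Ω, ‖symAdd (fderiv ℝ ψ x)‖ₑ ^ 2
      ≤ (2 : ℝ≥0) * (∫⁻ x in Ω, ‖symAdd (fderiv ℝ φ x)‖ₑ ^ 2)
        + (8 * M ^ 2).toNNReal * ∫⁻ x in Ω, ‖φ x‖ₑ ^ 2 := by
    refine (lintegral_mono h3).trans ?_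
    have m1 : Measurable fun x => ‖symAdd (fderiv ℝ φ x)‖ₑ ^ 2 :=
      (continuous_symAdd.comp (hφ.continuous_fderiv (by simp))).enorm.measurable.pow_const 2
    have m2 : Measurable fun x => ‖φ x‖ₑ ^ 2 := hφ.continuous.enorm.measurable.pow_const 2
    rw [lintegral_add_left (m1.const_mul _), lintegral_const_mul _ m1, lintegral_const_mul _ m2]
  refine h2.trans (h1.trans ?_)
  rw [ENNReal.coe_mul, mul_assoc]
  gcongr
  refine h4.trans ?_
  push_cast
  rw [mul_add]
  exact add_le_add (mul_le_mul_left le_self_add _) (mul_le_mul_left le_add_self _)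

/-- Korn's second inequality, for the restrictions of smooth functions. -/
lemma korn_second {Ω : Set (E (n + 1))} (hΩo : IsOpen Ω) (hΩb : Bornology.IsBounded Ω)
    (hΩ : IsC11 Ω) : ∃ C : ℝ≥0, ∀ φ : E (n + 1) → E (n + 1),
      ContDiff ℝ ∞ φ → HasCompactSupport φ → ∫⁻ x in Ω, ‖fderiv ℝ φ x‖ₑ ^ 2
        ≤ C * ((∫⁻ x in Ω, ‖symAdd (fderiv ℝ φ x)‖ₑ ^ 2) + ∫⁻ x in Ω, ‖φ x‖ₑ ^ 2) := by
  have key : ∃ C : ℝ≥0, ∀ φ : E (n + 1) → E (n + 1),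
      ContDiff ℝ ∞ φ → HasCompactSupport φ → ∫⁻ x in Ω ∩ closure Ω, ‖fderiv ℝ φ x‖ₑ ^ 2
        ≤ C * ((∫⁻ x in Ω, ‖symAdd (fderiv ℝ φ x)‖ₑ ^ 2) + ∫⁻ x in Ω, ‖φ x‖ₑ ^ 2) := by
    refine hΩb.isCompact_closure.induction_on (p := fun s => ∃ C : ℝ≥0,
      ∀ φ : E (n + 1) → E (n + 1), ContDiff ℝ ∞ φ → HasCompactSupport φ →
        ∫⁻ x in Ω ∩ s, ‖fderiv ℝ φ x‖ₑ ^ 2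
        ≤ C * ((∫⁻ x in Ω, ‖symAdd (fderiv ℝ φ x)‖ₑ ^ 2) + ∫⁻ x in Ω, ‖φ x‖ₑ ^ 2)) ?_ ?_ ?_ ?_
    · exact ⟨0, by simp⟩
    · rintro s t hst ⟨C, hC⟩
      exact ⟨C, fun φ h1 h2 => (lintegral_mono_set (inter_subset_inter_right _ hst)).trans
        (hC φ h1 h2)⟩
    · rintro s t ⟨C, hC⟩ ⟨D, hD⟩
      refine ⟨C + D, fun φ h1 h2 => ?_⟩
      rw [inter_union_distrib_left, ENNReal.coe_add, add_mul]
      exact (lintegral_union_le _ _ _).trans (add_le_add (hC φ h1 h2) (hD φ h1 h2))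
    · intro x hx
      obtain ⟨U, hU, C, hC⟩ := korn_near hΩo hΩ hx
      exact ⟨U, mem_nhdsWithin_of_mem_nhds hU, C, hC⟩
  rwa [inter_eq_left.2 subset_closure] at key

end KornGlobal

/-! ### Boundary charts, and estimates on surfaces parallel to the boundary. -/

section Boundary

variable {n : ℕ}

/-- The coordinates of `x` along the last vectors of an orthonormal basis. -/
noncomputable def cylSnd (b : OrthonormalBasis (Fin (n + 1)) ℝ (E (n + 1))) (x : E (n + 1)) : E n :=
  WithLp.toLp 2 fun i => ⟪b i.succ, x⟫

@[fun_prop]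
lemma continuous_cylSnd (b : OrthonormalBasis (Fin (n + 1)) ℝ (E (n + 1))) :
    Continuous (cylSnd b) := by
  unfold cylSnd
  fun_prop

lemma cyl_cylSnd (b : OrthonormalBasis (Fin (n + 1)) ℝ (E (n + 1))) (x : E (n + 1)) :
    cyl b (⟪x, b 0⟫, cylSnd b x) = x := by
  conv_rhs => rw [← b.sum_repr x, Fin.sum_univ_succ]
  rw [cyl_apply]
  simp [cylSnd, b.repr_apply_apply, real_inner_comm]

lemma cylSnd_cyl (b : OrthonormalBasis (Fin (n + 1)) ℝ (E (n + 1))) (p : ℝ × E n) :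
    cylSnd b (cyl b p) = p.2 := by
  have h := cyl_injective b (cyl_cylSnd b (cyl b p))
  exact congrArg Prod.snd h

lemma norm_cylSnd_sub_le (b : OrthonormalBasis (Fin (n + 1)) ℝ (E (n + 1))) (x : E (n + 1))
    (p : ℝ × E n) : ‖cylSnd b x - p.2‖ ≤ ‖x - cyl b p‖ := by
  have := norm_snd_le_norm_cyl b ((⟪x, b 0⟫, cylSnd b x) - p)
  rwa [cyl_sub, cyl_cylSnd] at this

/-- A chart of a domain at the boundary: in the cylinder over `D` of height `h` around the graph
of `g`, the domain lies below the graph. -/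
structure BoundaryChart (Ω : Set (E (n + 1))) where
  /-- the basis, with first vector pointing outwards -/
  b : OrthonormalBasis (Fin (n + 1)) ℝ (E (n + 1))
  /-- the function of which the boundary is the graph -/
  g : E n → ℝ
  /-- the base of the cylinder -/
  D : Set (E n)
  /-- the half-height of the cylinder -/
  h : ℝ
  /-- the Lipschitz constant -/
  L : ℝ≥0
  h_pos : 0 < h
  isOpen_D : IsOpen D
  isBounded_D : Bornology.IsBounded D
  continuous_g : Continuous g
  lipschitz_g : LipschitzOnWith L g D
  mem_iff : ∀ y ∈ D, ∀ s : ℝ, |s| ≤ h → (cyl b (g y - s, y) ∈ Ω ↔ 0 < s)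
  eq_zero_of_mem_frontier : ∀ y ∈ D, ∀ s : ℝ, |s| ≤ h → cyl b (g y - s, y) ∈ frontier Ω → s = 0

/-- The part of half-height `δ` of the cylinder of a chart. -/
def BoundaryChart.nbhd {Ω : Set (E (n + 1))} (c : BoundaryChart Ω) (δ : ℝ) : Set (E (n + 1)) :=
  {x | cylSnd c.b x ∈ c.D ∧ |c.g (cylSnd c.b x) - ⟪x, c.b 0⟫| < δ}

/-- The cylinder is chosen, by continuity, inside the ball where Ω is a subgraph. In that ball the
points strictly above the graph form an open set that misses Ω, and those strictly below are in Ω,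
so boundary points lie on the graph. -/
lemma exists_boundaryChart {Ω : Set (E (n + 1))} (hΩo : IsOpen Ω) (hΩ : IsC11 Ω) {x₀ : E (n + 1)}
    (hx : x₀ ∈ frontier Ω) :
    ∃ c : BoundaryChart Ω, ∀ δ > 0, x₀ ∈ c.nbhd δ := by
  obtain ⟨ν, γ, r, hν, hγ, -, hinv, hr, hgr⟩ := hΩ x₀ hx
  obtain ⟨b, rfl⟩ := exists_basis_zero_eq hν
  set g : E n → ℝ := fun y => γ (cyl b (0, y)) with hg
  have hγc : ∀ s y, γ (cyl b (s, y)) = g y := by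
    intro s y
    rw [← zero_add s, cyl_add_smul, hinv]
  have hg1 : ContDiff ℝ 1 g := hγ.comp ((contDiff_cyl b).comp (contDiff_const.prodMk contDiff_id))
  set y₀ := cylSnd b x₀
  have hmem : ∀ s y, cyl b (s, y) ∈ Metric.ball x₀ r → (cyl b (s, y) ∈ Ω ↔ s < g y) := by
    intro s y h
    rw [hgr _ h, inner_cyl, hγc]
  have hfr : ∀ s y, cyl b (s, y) ∈ Metric.ball x₀ r → cyl b (s, y) ∈ frontier Ω → s = g y := by
    intro s y h hf
    rw [hΩo.frontier_eq] at hf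
    have h1 : ¬ s < g y := fun h' => hf.2 ((hmem s y h).2 h')
    refine le_antisymm ?_ (not_lt.1 h1)
    by_contra! h2
    have ho : IsOpen {x : E (n + 1) | γ x < ⟪x, b 0⟫ ∧ x ∈ Metric.ball x₀ r} :=
      (isOpen_lt hγ.continuous (by fun_prop)).inter Metric.isOpen_ball
    obtain ⟨z, hz, hz'⟩ := mem_closure_iff.1 hf.1 _ ho ⟨by rwa [inner_cyl, hγc], h⟩
    exact lt_asymm hz.1 ((hgr z hz.2).1 hz')
  have hx₀ : cyl b (g y₀, y₀) = x₀ := by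
    have h1 := cyl_cylSnd b x₀
    have h2 := hfr ⟪x₀, b 0⟫ y₀ (by rw [h1]; exact Metric.mem_ball_self hr) (by rw [h1]; exact hx)
    rw [← h2]
    exact h1
  obtain ⟨L, t, ht, hL⟩ := (hg1.contDiffAt (x := y₀)).exists_lipschitzOnWith
  have hcont : Continuous fun p : E n × ℝ => cyl b (g p.1 - p.2, p.1) := by
    have := hg1.continuous
    fun_prop
  have hnear : ∀ᶠ p in 𝓝 ((y₀, 0) : E n × ℝ), cyl b (g p.1 - p.2, p.1) ∈ Metric.ball x₀ r := by
    refine hcont.continuousAt.eventually_mem ?_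
    simp only [sub_zero, hx₀]
    exact Metric.ball_mem_nhds _ hr
  rw [nhds_prod_eq, eventually_prod_iff] at hnear
  obtain ⟨p, hp, q, hq, hpq⟩ := hnear
  obtain ⟨ρ, hρ, hρb⟩ := Metric.mem_nhds_iff.1 (Filter.inter_mem ht hp)
  obtain ⟨h, hh, hhb⟩ := Metric.mem_nhds_iff.1 hq
  have hball : ∀ y ∈ Metric.ball y₀ ρ, ∀ s : ℝ, |s| ≤ h / 2 →
      cyl b (g y - s, y) ∈ Metric.ball x₀ r := fun y hy s hs =>
    hpq (hρb hy).2 (hhb (by rw [mem_ball_zero_iff, Real.norm_eq_abs]; linarith))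
  refine ⟨⟨b, g, Metric.ball y₀ ρ, h / 2, L, by positivity, Metric.isOpen_ball, Metric.isBounded_ball,
    hg1.continuous, hL.mono fun y hy => (hρb hy).1, fun y hy s hs => ?_, fun y hy s hs hf => ?_⟩,
    fun δ hδ => ⟨Metric.mem_ball_self hρ, ?_⟩⟩
  · rw [hmem _ _ (hball y hy s hs)]
    constructor <;> intro h' <;> linarith
  · have := hfr _ _ (hball y hy s hs) hf
    linarith
  · have h1 : ⟪x₀, b 0⟫ = g y₀ := by
      have h2 := inner_cyl b (g y₀, y₀)
      rwa [hx₀] at h2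
    change |g y₀ - ⟪x₀, b 0⟫| < δ
    rw [h1]
    simpa using hδ

namespace BoundaryChart

variable {Ω : Set (E (n + 1))} (c : BoundaryChart Ω)

lemma isOpen_nbhd (δ : ℝ) : IsOpen (c.nbhd δ) := by
  have := c.continuous_g
  have h : Continuous fun x => |c.g (cylSnd c.b x) - ⟪x, c.b 0⟫| := by fun_prop
  exact (c.isOpen_D.preimage (continuous_cylSnd c.b)).inter (isOpen_lt h continuous_const)

/-- The parametrization of the boundary. -/
noncomputable def graph (y : E n) : E (n + 1) := cyl c.b (c.g y, y)

lemma continuous_graph : Continuous c.graph := by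
  have := c.continuous_g
  unfold graph
  fun_prop

lemma lipschitz_graph : LipschitzOnWith (c.L + 1) c.graph c.D := by
  refine LipschitzOnWith.of_dist_le_mul fun y hy z hz => ?_
  rw [dist_eq_norm, graph, graph, ← cyl_sub]
  refine (norm_cyl_le _ _).trans ?_
  have := c.lipschitz_g.dist_le_mul y hy z hz
  rw [Real.dist_eq, dist_eq_norm] at this
  rw [dist_eq_norm, NNReal.coe_add, add_mul]
  simpa using this

/-- This piece of boundary lies in the image of D under a map of Lipschitz constant L + 1, which
multiplies n-dimensional measures by at most (L + 1)ⁿ. -/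
lemma lintegral_frontier_le : ∃ K : ℝ≥0, ∀ F : E (n + 1) → ℝ≥0∞, Measurable F →
    ∫⁻ x in frontier Ω ∩ c.nbhd c.h, F x ∂(μHE[n] : Measure (E (n + 1)))
      ≤ K * ∫⁻ y in c.D, F (c.graph y) := by
  refine ⟨(c.L + 1) ^ n, fun F hF => ?_⟩
  have hfm : MeasurableSet (frontier Ω ∩ c.nbhd c.h) :=
    isClosed_frontier.measurableSet.inter (c.isOpen_nbhd _).measurableSet
  have hle : (μHE[n] : Measure (E (n + 1))).restrict (frontier Ω ∩ c.nbhd c.h)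
      ≤ (((c.L + 1) ^ n : ℝ≥0) : ℝ≥0∞) • (volume.restrict c.D).map c.graph := by
    refine Measure.le_iff.2 fun s hs => ?_
    rw [Measure.restrict_apply hs, Measure.smul_apply,
      Measure.map_apply c.continuous_graph.measurable hs,
      Measure.restrict_apply (c.continuous_graph.measurable hs), smul_eq_mul]
    have hsub : s ∩ (frontier Ω ∩ c.nbhd c.h) ⊆ c.graph '' (c.graph ⁻¹' s ∩ c.D) := by
      rintro x ⟨hx, hxf, hxD, hxh⟩
      have h1 : cyl c.b (c.g (cylSnd c.b x) - (c.g (cylSnd c.b x) - ⟪x, c.b 0⟫), cylSnd c.b x) = x := by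
        rw [sub_sub_cancel, cyl_cylSnd]
      have h2 := c.eq_zero_of_mem_frontier _ hxD _ hxh.le (by rwa [h1])
      rw [h2, sub_zero] at h1
      exact ⟨cylSnd c.b x, ⟨by rw [mem_preimage, graph, h1]; exact hx, hxD⟩, h1⟩
    refine (measure_mono hsub).trans ?_
    -- Lebesgue measure on `E n` is also `μHE[n]`: both sides carry the same normalizing factor in
    -- front of the Hausdorff measure.
    rw [← EuclideanSpace.euclideanHausdorffMeasure_eq_volume]
    simp only [Measure.euclideanHausdorffMeasure_def, Measure.smul_apply]
    have h3 := (c.lipschitz_graph.mono inter_subset_right).hausdorffMeasure_image_le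
      (s := c.graph ⁻¹' s ∩ c.D) (d := n) (by positivity)
    rw [ENNReal.smul_def, ENNReal.smul_def, smul_eq_mul, smul_eq_mul, mul_left_comm]
    gcongr
    refine h3.trans_eq ?_
    rw [ENNReal.rpow_natCast]
    push_cast
    rfl
  refine (lintegral_mono' hle le_rfl).trans_eq ?_
  rw [lintegral_smul_measure, lintegral_map hF c.continuous_graph.measurable]
  rfl

/-- Fubini, with t the depth below the graph; the change from height to depth has Jacobian 1. -/
lemma lintegral_cylinder_le {F : E (n + 1) → ℝ≥0∞} (hF : Measurable F) (hΩ : MeasurableSet Ω) :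
    ∫⁻ y in c.D, ∫⁻ t in Ioc 0 c.h, F (cyl c.b (c.g y - t, y)) ≤ ∫⁻ x in Ω, F x := by
  rw [← lintegral_indicator hΩ, lintegral_cyl c.b (hF.indicator hΩ)]
  refine (setLIntegral_mono' c.isOpen_D.measurableSet
    (g := fun y => ∫⁻ s : ℝ, Ω.indicator F (cyl c.b (s, y))) fun y hy => ?_).trans
    (setLIntegral_le_lintegral _ _)
  rw [← lintegral_sub_left_eq_self (fun s => Ω.indicator F (cyl c.b (s, y))) (c.g y)]
  refine (setLIntegral_mono' measurableSet_Ioc fun t ht => ?_).trans (setLIntegral_le_lintegral _ _)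
  rw [indicator_of_mem]
  refine (c.mem_iff y hy t ?_).2 ht.1
  rw [abs_of_pos ht.1]
  exact ht.2

end BoundaryChart

/-- A one-dimensional Sobolev inequality. -/
lemma enorm_sq_le_lintegral {F : Type*} [NormedAddCommGroup F] [NormedSpace ℝ F] [CompleteSpace F]
    {w : ℝ → F} (hw : ContDiff ℝ 1 w) {h s : ℝ} (hh : 0 < h) (hs : s ∈ Icc 0 h) :
    ‖w s‖ₑ ^ 2 ≤ ENNReal.ofReal (2 / h) * (∫⁻ t in Ioc 0 h, ‖w t‖ₑ ^ 2)
      + ENNReal.ofReal (2 * h) * ∫⁻ t in Ioc 0 h, ‖deriv w t‖ₑ ^ 2 := by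
  have hd : Continuous (deriv w) := hw.continuous_deriv le_rfl
  have hI : ∀ {f : ℝ → ℝ}, Continuous f → ∀ a b, IntervalIntegrable f volume a b :=
    fun hf a b => hf.intervalIntegrable a b
  set J := ∫ t in (0 : ℝ)..h, ‖deriv w t‖ with hJ
  set J2 := ∫ t in (0 : ℝ)..h, ‖deriv w t‖ ^ 2 with hJ2
  -- Cauchy–Schwarz, read off from the nonnegative variance of the norm of w'.
  have hCS : J ^ 2 ≤ h * J2 := by
    have h0 : 0 ≤ ∫ t in (0 : ℝ)..h, (‖deriv w t‖ - J / h) ^ 2 :=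
      intervalIntegral.integral_nonneg hh.le fun t _ => sq_nonneg _
    have h1 : ∫ t in (0 : ℝ)..h, (‖deriv w t‖ - J / h) ^ 2
        = J2 - 2 * (J / h) * J + h * (J / h) ^ 2 := by
      have : ∀ t, (‖deriv w t‖ - J / h) ^ 2
          = ‖deriv w t‖ ^ 2 - 2 * (J / h) * ‖deriv w t‖ + (J / h) ^ 2 := fun t => by ring
      simp only [this]
      rw [intervalIntegral.integral_add (hI (by fun_prop) _ _) (hI (by fun_prop) _ _),
        intervalIntegral.integral_sub (hI (by fun_prop) _ _) (hI (by fun_prop) _ _),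
        intervalIntegral.integral_const_mul]
      simp [hJ, hJ2]
    rw [h1] at h0
    have h2 : h * (J2 - 2 * (J / h) * J + h * (J / h) ^ 2) = h * J2 - J ^ 2 := by
      field_simp
      ring
    nlinarith [mul_nonneg hh.le h0]
  have hpt : ∀ t ∈ Icc 0 h, ‖w s‖ ^ 2 ≤ 2 * ‖w t‖ ^ 2 + 2 * (h * J2) := by
    intro t ht
    have h1 : ∫ τ in t..s, deriv w τ = w s - w t :=
      intervalIntegral.integral_deriv_eq_sub (fun x _ => hw.differentiable (by simp) x)
        (hd.intervalIntegrable _ _)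
    have h2 : ‖∫ τ in t..s, deriv w τ‖ ≤ J := by
      rw [hJ, intervalIntegral.integral_of_le hh.le]
      refine (intervalIntegral.norm_integral_le_integral_norm_uIoc).trans ?_
      refine setIntegral_mono_set ((hI hd.norm 0 h).1) (Eventually.of_forall fun x => norm_nonneg _)
        (LE.le.eventuallyLE ?_)
      exact Ioc_subset_Ioc (le_min ht.1 hs.1) (max_le ht.2 hs.2)
    rw [h1] at h2
    have h3 : ‖w s‖ ≤ ‖w t‖ + J := by
      have := norm_sub_norm_le (w s) (w t)
      linarith
    have h4 : ‖w s‖ ^ 2 ≤ (‖w t‖ + J) ^ 2 := by gcongr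
    nlinarith [sq_nonneg (‖w t‖ - J)]
  -- The pointwise bound is integrated over the free point t.
  have hint : h * ‖w s‖ ^ 2 ≤ 2 * (∫ t in (0 : ℝ)..h, ‖w t‖ ^ 2) + h * (2 * (h * J2)) := by
    have hwc := hw.continuous
    have := intervalIntegral.integral_mono_on hh.le (hI (continuous_const (y := ‖w s‖ ^ 2)) 0 h)
      (hI (by fun_prop) 0 h) hpt
    rw [intervalIntegral.integral_add (hI (by fun_prop) _ _) (hI (by fun_prop) _ _),
      intervalIntegral.integral_const_mul] at this
    simp only [intervalIntegral.integral_const, sub_zero, smul_eq_mul] at this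
    linarith
  have hfin : ‖w s‖ ^ 2 ≤ 2 / h * (∫ t in (0 : ℝ)..h, ‖w t‖ ^ 2) + 2 * h * J2 := by
    have e : 2 / h * (∫ t in (0 : ℝ)..h, ‖w t‖ ^ 2) + 2 * h * J2
        = (2 * (∫ t in (0 : ℝ)..h, ‖w t‖ ^ 2) + h * (2 * (h * J2))) / h := by
      field_simp
    rw [e, le_div_iff₀ hh]
    linarith
  have hwc := hw.continuous
  simp only [enorm_sq_eq_ofReal]
  rw [← ofReal_integral_eq_lintegral_ofReal (hI (by fun_prop) 0 h).1
      (Eventually.of_forall fun x => sq_nonneg _),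
    ← ofReal_integral_eq_lintegral_ofReal (hI (by fun_prop) 0 h).1
      (Eventually.of_forall fun x => sq_nonneg _),
    ← ENNReal.ofReal_mul (by positivity), ← ENNReal.ofReal_mul (by positivity),
    ← ENNReal.ofReal_add (mul_nonneg (by positivity) (integral_nonneg fun x => sq_nonneg _))
      (mul_nonneg (by positivity) (integral_nonneg fun x => sq_nonneg _))]
  refine ENNReal.ofReal_le_ofReal ?_
  rw [hJ2, intervalIntegral.integral_of_le hh.le, intervalIntegral.integral_of_le hh.le] at hfin
  exact hfin

/-- The square of the `H¹(Ω)` norm of a smooth function. -/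
noncomputable def sqH1 (Ω : Set (E (n + 1))) (φ : E (n + 1) → E (n + 1)) : ℝ≥0∞ :=
  (∫⁻ x in Ω, ‖φ x‖ₑ ^ 2) + ∫⁻ x in Ω, ‖fderiv ℝ φ x‖ₑ ^ 2

/-- The one-dimensional Sobolev inequality on each segment below the graph. The constant is the same
at all depths s: s = 0 yields the trace inequality, and integration in s the smallness of the L²
norm in thin strips. -/
lemma BoundaryChart.lintegral_slice_le {Ω : Set (E (n + 1))} (c : BoundaryChart Ω)
    (hΩ : MeasurableSet Ω) : ∃ C : ℝ≥0, ∀ φ : E (n + 1) → E (n + 1), ContDiff ℝ ∞ φ →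
      ∀ s ∈ Icc 0 c.h, ∫⁻ y in c.D, ‖φ (cyl c.b (c.g y - s, y))‖ₑ ^ 2 ≤ C * sqH1 Ω φ := by
  refine ⟨(2 / c.h).toNNReal + (2 * c.h).toNNReal, fun φ hφ s hs => ?_⟩
  have hgc := c.continuous_g
  have hφc := hφ.continuous
  have hDc := hφ.continuous_fderiv (by simp)
  have m1 : Measurable fun x => ‖φ x‖ₑ ^ 2 := hφc.enorm.measurable.pow_const 2
  have m2 : Measurable fun x => ‖fderiv ℝ φ x‖ₑ ^ 2 := hDc.enorm.measurable.pow_const 2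
  have hpt : ∀ y, ‖φ (cyl c.b (c.g y - s, y))‖ₑ ^ 2
      ≤ ENNReal.ofReal (2 / c.h) * (∫⁻ t in Ioc 0 c.h, ‖φ (cyl c.b (c.g y - t, y))‖ₑ ^ 2)
        + ENNReal.ofReal (2 * c.h) *
          ∫⁻ t in Ioc 0 c.h, ‖fderiv ℝ φ (cyl c.b (c.g y - t, y))‖ₑ ^ 2 := by
    intro y
    have hw : ContDiff ℝ 1 fun t => φ (cyl c.b (c.g y - t, y)) :=
      (hφ.of_le (by simp)).comp ((contDiff_cyl c.b).comp
        ((contDiff_const.sub contDiff_id).prodMk contDiff_const))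
    refine (enorm_sq_le_lintegral hw c.h_pos hs).trans ?_
    gcongr with t
    have h3 : HasDerivAt (fun t => cyl c.b (c.g y - t, y)) (-c.b 0) t := by
      simp only [cyl_apply]
      simpa using (((hasDerivAt_id t).const_sub (c.g y)).smul_const (c.b 0)).add_const
        (∑ i : Fin n, y i • c.b i.succ)
    have h4 := ((hφ.differentiable (by simp) _).hasFDerivAt.comp_hasDerivAt t h3).deriv
    rw [show (fun t => φ (cyl c.b (c.g y - t, y))) = φ ∘ fun t => cyl c.b (c.g y - t, y) from rfl,
      h4, ← ofReal_norm, ← ofReal_norm]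
    refine ENNReal.ofReal_le_ofReal ((ContinuousLinearMap.le_opNorm _ _).trans ?_)
    rw [norm_neg, c.b.norm_eq_one, mul_one]
  have m3 : ∀ {F : E (n + 1) → ℝ≥0∞}, Measurable F →
      Measurable fun y => ∫⁻ t in Ioc 0 c.h, F (cyl c.b (c.g y - t, y)) := fun hF =>
    Measurable.lintegral_prod_right' (f := fun p : E n × ℝ => _)
      (hF.comp (by fun_prop : Continuous fun p : E n × ℝ =>
        cyl c.b (c.g p.1 - p.2, p.1)).measurable)
  refine (lintegral_mono hpt).trans ?_
  rw [lintegral_add_left ((m3 m1).const_mul _), lintegral_const_mul _ (m3 m1),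
    lintegral_const_mul _ (m3 m2)]
  refine (add_le_add (mul_le_mul_right (c.lintegral_cylinder_le m1 hΩ) _)
    (mul_le_mul_right (c.lintegral_cylinder_le m2 hΩ) _)).trans ?_
  rw [sqH1, ENNReal.coe_add, add_mul]
  exact add_le_add (mul_le_mul_right le_self_add _) (mul_le_mul_right le_add_self _)

lemma BoundaryChart.lintegral_strip_le {Ω : Set (E (n + 1))} (c : BoundaryChart Ω)
    (hΩ : MeasurableSet Ω) : ∃ C : ℝ≥0, ∀ φ : E (n + 1) → E (n + 1), ContDiff ℝ ∞ φ →
      ∀ δ ≤ c.h, ∫⁻ x in Ω ∩ c.nbhd δ, ‖φ x‖ₑ ^ 2 ≤ ENNReal.ofReal δ * (C * sqH1 Ω φ) := by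
  obtain ⟨C, hC⟩ := c.lintegral_slice_le hΩ
  refine ⟨C, fun φ hφ δ hδ => ?_⟩
  have hgc := c.continuous_g
  have hφc := hφ.continuous
  have m1 : Measurable fun x => ‖φ x‖ₑ ^ 2 := hφc.enorm.measurable.pow_const 2
  have hm : MeasurableSet (Ω ∩ c.nbhd δ) := hΩ.inter (c.isOpen_nbhd δ).measurableSet
  have hmc : Measurable fun p : E n × ℝ => ‖φ (cyl c.b (c.g p.1 - p.2, p.1))‖ₑ ^ 2 :=
    m1.comp (by fun_prop : Continuous fun p : E n × ℝ => cyl c.b (c.g p.1 - p.2, p.1)).measurable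
  rw [← lintegral_indicator hm, lintegral_cyl c.b (m1.indicator hm)]
  calc ∫⁻ y : E n, ∫⁻ s : ℝ, (Ω ∩ c.nbhd δ).indicator (fun x => ‖φ x‖ₑ ^ 2) (cyl c.b (s, y))
      ≤ ∫⁻ y in c.D, ∫⁻ t in Ioc 0 δ, ‖φ (cyl c.b (c.g y - t, y))‖ₑ ^ 2 := by
        rw [← lintegral_indicator c.isOpen_D.measurableSet]
        refine lintegral_mono fun y => ?_
        rw [← lintegral_sub_left_eq_self (fun s => (Ω ∩ c.nbhd δ).indicator
          (fun x => ‖φ x‖ₑ ^ 2) (cyl c.b (s, y))) (c.g y)]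
        by_cases hy : y ∈ c.D
        · rw [indicator_of_mem hy, ← lintegral_indicator measurableSet_Ioc]
          refine lintegral_mono fun t => ?_
          by_cases hx : cyl c.b (c.g y - t, y) ∈ Ω ∩ c.nbhd δ
          swap
          · rw [indicator_of_notMem hx]
            exact zero_le
          have h1 : |t| < δ := by
            have := hx.2.2
            rwa [cylSnd_cyl, inner_cyl, sub_sub_cancel] at this
          have h2 : 0 < t := (c.mem_iff y hy t (h1.le.trans hδ)).1 hx.1
          rw [indicator_of_mem hx, indicator_of_mem]
          exact ⟨h2, (le_abs_self t).trans h1.le⟩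
        · rw [indicator_of_notMem hy]
          refine le_of_eq ?_
          rw [lintegral_eq_zero_iff' (by
            exact ((m1.indicator hm).comp (by fun_prop : Continuous fun t : ℝ =>
              cyl c.b (c.g y - t, y)).measurable).aemeasurable)]
          refine Eventually.of_forall fun t => ?_
          refine indicator_of_notMem (fun hx => hy ?_) _
          have := hx.2.1
          rwa [cylSnd_cyl] at this
    _ = ∫⁻ t in Ioc 0 δ, ∫⁻ y in c.D, ‖φ (cyl c.b (c.g y - t, y))‖ₑ ^ 2 :=
        lintegral_lintegral_swap hmc.aemeasurable
    _ ≤ ∫⁻ t in Ioc 0 δ, C * sqH1 Ω φ :=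
        setLIntegral_mono' measurableSet_Ioc fun t ht => hC φ hφ t ⟨ht.1.le, ht.2.trans hδ⟩
    _ = _ := by
        rw [setLIntegral_const, Real.volume_Ioc, sub_zero, mul_comm]

end Boundary

/-! ### Trace inequality, thin neighborhoods of the boundary, and potentials on the boundary. -/

section BoundaryGlobal

variable {n : ℕ} {Ω : Set (E (n + 1))}

/-- The trace inequality for smooth functions. -/
lemma lintegral_frontier_sq_le (hΩo : IsOpen Ω) (hΩb : Bornology.IsBounded Ω) (hΩ : IsC11 Ω) :
    ∃ C : ℝ≥0, ∀ φ : E (n + 1) → E (n + 1), ContDiff ℝ ∞ φ →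
      ∫⁻ x in frontier Ω, ‖φ x‖ₑ ^ 2 ∂(μHE[n] : Measure (E (n + 1))) ≤ C * sqH1 Ω φ := by
  have key : ∃ C : ℝ≥0, ∀ φ : E (n + 1) → E (n + 1), ContDiff ℝ ∞ φ →
      ∫⁻ x in frontier Ω ∩ frontier Ω, ‖φ x‖ₑ ^ 2 ∂(μHE[n] : Measure (E (n + 1)))
        ≤ C * sqH1 Ω φ := by
    have hc : IsCompact (frontier Ω) :=
      hΩb.isCompact_closure.of_isClosed_subset isClosed_frontier frontier_subset_closure
    refine hc.induction_on (p := fun s => ∃ C : ℝ≥0, ∀ φ : E (n + 1) → E (n + 1), ContDiff ℝ ∞ φ →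
      ∫⁻ x in frontier Ω ∩ s, ‖φ x‖ₑ ^ 2 ∂(μHE[n] : Measure (E (n + 1)))
        ≤ C * sqH1 Ω φ) ?_ ?_ ?_ ?_
    · exact ⟨0, by simp⟩
    · rintro s t hst ⟨C, hC⟩
      exact ⟨C, fun φ h1 => (lintegral_mono_set (inter_subset_inter_right _ hst)).trans (hC φ h1)⟩
    · rintro s t ⟨C, hC⟩ ⟨D, hD⟩
      refine ⟨C + D, fun φ h1 => ?_⟩
      rw [inter_union_distrib_left, ENNReal.coe_add, add_mul]
      exact (lintegral_union_le _ _ _).trans (add_le_add (hC φ h1) (hD φ h1))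
    · intro x hx
      obtain ⟨c, hc⟩ := exists_boundaryChart hΩo hΩ hx
      obtain ⟨K, hK⟩ := c.lintegral_frontier_le
      obtain ⟨C, hC⟩ := c.lintegral_slice_le hΩo.measurableSet
      refine ⟨c.nbhd c.h, mem_nhdsWithin_of_mem_nhds
        ((c.isOpen_nbhd _).mem_nhds (hc _ c.h_pos)), K * C, fun φ hφ => ?_⟩
      refine (hK _ (hφ.continuous.enorm.measurable.pow_const 2)).trans ?_
      rw [ENNReal.coe_mul, mul_assoc]
      gcongr
      simpa [BoundaryChart.graph] using hC φ hφ 0 ⟨le_rfl, c.h_pos.le⟩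
  rwa [inter_self] at key

lemma BoundaryChart.frontier_inter_nbhd_subset (c : BoundaryChart Ω) {δ : ℝ} (hδ : 0 < δ) :
    frontier Ω ∩ c.nbhd c.h ⊆ c.nbhd δ := by
  rintro x ⟨hx, hxD, hxh⟩
  have h1 : cyl c.b (c.g (cylSnd c.b x) - (c.g (cylSnd c.b x) - ⟪x, c.b 0⟫), cylSnd c.b x) = x := by
    rw [sub_sub_cancel, cyl_cylSnd]
  refine ⟨hxD, ?_⟩
  rw [c.eq_zero_of_mem_frontier _ hxD _ hxh.le (by rwa [h1])]
  simpa using hδ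

/-- Smooth functions have a small `L²` norm in thin neighborhoods of the boundary. -/
lemma exists_isOpen_lintegral_le (hΩo : IsOpen Ω) (hΩb : Bornology.IsBounded Ω) (hΩ : IsC11 Ω)
    {η : ℝ≥0} (hη : 0 < η) :
    ∃ O : Set (E (n + 1)), IsOpen O ∧ frontier Ω ⊆ O ∧ ∀ φ : E (n + 1) → E (n + 1),
      ContDiff ℝ ∞ φ → ∫⁻ x in Ω ∩ O, ‖φ x‖ₑ ^ 2 ≤ η * sqH1 Ω φ := by
  have hc : IsCompact (frontier Ω) :=
    hΩb.isCompact_closure.of_isClosed_subset isClosed_frontier frontier_subset_closure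
  refine (hc.induction_on (p := fun s => ∀ η : ℝ≥0, 0 < η → ∃ O : Set (E (n + 1)), IsOpen O ∧
    s ⊆ O ∧ ∀ φ : E (n + 1) → E (n + 1),
      ContDiff ℝ ∞ φ → ∫⁻ x in Ω ∩ O, ‖φ x‖ₑ ^ 2 ≤ η * sqH1 Ω φ) ?_ ?_ ?_ ?_) η hη
  · exact fun η hη => ⟨∅, isOpen_empty, subset_rfl, by simp⟩
  · intro s t hst h η hη
    obtain ⟨O, h1, h2, h3⟩ := h η hη
    exact ⟨O, h1, hst.trans h2, h3⟩
  · intro s t hs ht η hη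
    obtain ⟨O, h1, h2, h3⟩ := hs (η / 2) (half_pos hη)
    obtain ⟨O', h1', h2', h3'⟩ := ht (η / 2) (half_pos hη)
    refine ⟨O ∪ O', h1.union h1', union_subset_union h2 h2', fun φ hφ => ?_⟩
    rw [inter_union_distrib_left]
    refine (lintegral_union_le _ _ _).trans ((add_le_add (h3 φ hφ) (h3' φ hφ)).trans_eq ?_)
    rw [← add_mul, ← ENNReal.coe_add, add_halves]
  · intro x hx
    obtain ⟨c, hc⟩ := exists_boundaryChart hΩo hΩ hx
    obtain ⟨C, hC⟩ := c.lintegral_strip_le hΩo.measurableSet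
    -- The neighborhood is taken within ∂Ω: its points lie on the graph, so the strip of half-height
    -- δ covers it, however small δ is. Taking δ ≤ η/(C + 1) then suffices.
    refine ⟨frontier Ω ∩ c.nbhd c.h, inter_mem_nhdsWithin _
      ((c.isOpen_nbhd _).mem_nhds (hc _ c.h_pos)), fun η hη => ?_⟩
    set δ := min c.h (η / (C + 1))
    have hδ : 0 < δ := lt_min c.h_pos (by positivity)
    refine ⟨c.nbhd δ, c.isOpen_nbhd _, c.frontier_inter_nbhd_subset hδ, fun φ hφ => ?_⟩
    refine (hC φ hφ δ (min_le_left _ _)).trans ?_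
    rw [← mul_assoc]
    gcongr
    rw [← ENNReal.ofReal_coe_nnreal, ← ENNReal.ofReal_coe_nnreal,
      ← ENNReal.ofReal_mul hδ.le]
    refine ENNReal.ofReal_le_ofReal ?_
    have h1 : δ ≤ η / (C + 1) := min_le_right _ _
    rw [le_div_iff₀ (by positivity)] at h1
    nlinarith [C.coe_nonneg]

lemma measure_frontier_lt_top (hΩo : IsOpen Ω) (hΩb : Bornology.IsBounded Ω) (hΩ : IsC11 Ω) :
    (μHE[n] : Measure (E (n + 1))) (frontier Ω) < (⊤ : ℝ≥0∞) := by
  have hc : IsCompact (frontier Ω) :=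
    hΩb.isCompact_closure.of_isClosed_subset isClosed_frontier frontier_subset_closure
  have key : (μHE[n] : Measure (E (n + 1))) (frontier Ω ∩ frontier Ω) < (⊤ : ℝ≥0∞) := by
    refine hc.induction_on (p := fun s => (μHE[n] : Measure (E (n + 1))) (frontier Ω ∩ s) < (⊤ : ℝ≥0∞))
      (by simp) (fun s t hst ht => (measure_mono (inter_subset_inter_right _ hst)).trans_lt ht)
      (fun s t hs ht => ?_) (fun x hx => ?_)
    · rw [inter_union_distrib_left]
      exact measure_union_lt_top hs ht
    · obtain ⟨c, hc⟩ := exists_boundaryChart hΩo hΩ hx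
      obtain ⟨K, hK⟩ := c.lintegral_frontier_le
      refine ⟨c.nbhd c.h, mem_nhdsWithin_of_mem_nhds
        ((c.isOpen_nbhd _).mem_nhds (hc _ c.h_pos)), ?_⟩
      have := hK 1 measurable_one
      simp only [Pi.one_apply, lintegral_one, Measure.restrict_apply_univ] at this
      exact this.trans_lt (ENNReal.mul_lt_top ENNReal.coe_lt_top c.isBounded_D.measure_lt_top)
  rwa [inter_self] at key

/-- The kernel is |p - y|⁻ᵐ in dimension m + 1. In polar coordinates the weight rᵐ cancels it near
p, and it is at most 1 at distance at least 1, so the bound is uniform in p. -/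
lemma lintegral_potential_flat_le {m : ℕ} {D : Set (E (m + 1))} (hD : Bornology.IsBounded D) :
    ∃ C : ℝ≥0, ∀ p : E (m + 1),
      ∫⁻ y in D, ENNReal.ofReal (‖p - y‖ ^ 2 * (1 / ‖p - y‖ ^ (m + 2))) ≤ C := by
  set w : ℝ → ℝ := fun t => t ^ 2 * (1 / t ^ (m + 2)) with hw
  have hwm : Measurable fun y : E (m + 1) => ENNReal.ofReal (w ‖y‖) := by
    have : Measurable w := by fun_prop
    fun_prop
  have h1 : IntegrableOn (fun y : E (m + 1) => w ‖y‖) (Metric.ball 0 1) := by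
    rw [integrableOn_fun_norm_addHaar]
    have : IntegrableOn (fun _ : ℝ => (1 : ℝ)) (Ioo 0 1) := by simp
    refine this.congr_fun (fun y hy => ?_) measurableSet_Ioo
    have : y ≠ 0 := hy.1.ne'
    simp only [finrank_euclideanSpace, Fintype.card_fin, add_tsub_cancel_right, smul_eq_mul, hw]
    field_simp
    ring
  have h2 : ∫⁻ y in Metric.ball (0 : E (m + 1)) 1, ENNReal.ofReal (w ‖y‖) < (⊤ : ℝ≥0∞) :=
    h1.lintegral_lt_top
  have h3 : volume D < (⊤ : ℝ≥0∞) := hD.measure_lt_top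
  refine ⟨(∫⁻ y in Metric.ball (0 : E (m + 1)) 1, ENNReal.ofReal (w ‖y‖)).toNNReal
    + (volume D).toNNReal, fun p => ?_⟩
  rw [ENNReal.coe_add, ENNReal.coe_toNNReal h2.ne, ENNReal.coe_toNNReal h3.ne]
  have hpt : ∀ y, ENNReal.ofReal (w ‖p - y‖)
      ≤ (Metric.ball (0 : E (m + 1)) 1).indicator (fun y => ENNReal.ofReal (w ‖y‖)) (p - y) + 1 := by
    intro y
    by_cases hy : p - y ∈ Metric.ball (0 : E (m + 1)) 1
    · rw [indicator_of_mem hy]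
      exact le_self_add
    · rw [indicator_of_notMem hy, zero_add, ENNReal.ofReal_le_one]
      have h4 : 1 ≤ ‖p - y‖ := by simpa using hy
      simp only [hw]
      rw [mul_one_div, div_le_one (by positivity)]
      exact pow_le_pow_right₀ h4 (by omega)
  refine (lintegral_mono hpt).trans ?_
  rw [lintegral_add_right _ measurable_const]
  refine add_le_add ?_ (by simp)
  refine (setLIntegral_le_lintegral _ _).trans_eq ?_
  rw [lintegral_sub_left_eq_self
    (fun y => (Metric.ball (0 : E (m + 1)) 1).indicator (fun y => ENNReal.ofReal (w ‖y‖)) y) p,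
    lintegral_indicator Metric.isOpen_ball.measurableSet]

/-- In a chart, projection onto the base shortens distances, hence increases the kernel |x - y|⁻ᵐ,
and the flat estimate applies. -/
lemma lintegral_potential_le {m : ℕ} {Ω : Set (E (m + 2))} (hΩo : IsOpen Ω)
    (hΩb : Bornology.IsBounded Ω) (hΩ : IsC11 Ω) : ∃ C : ℝ≥0, ∀ x : E (m + 2),
      ∫⁻ y in frontier Ω, ENNReal.ofReal (‖x - y‖ ^ 2 * (1 / ‖x - y‖ ^ (m + 2)))
        ∂(μHE[m + 1] : Measure (E (m + 2))) ≤ C := by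
  have hc : IsCompact (frontier Ω) :=
    hΩb.isCompact_closure.of_isClosed_subset isClosed_frontier frontier_subset_closure
  have key : ∃ C : ℝ≥0, ∀ x : E (m + 2), ∫⁻ y in frontier Ω ∩ frontier Ω,
      ENNReal.ofReal (‖x - y‖ ^ 2 * (1 / ‖x - y‖ ^ (m + 2)))
        ∂(μHE[m + 1] : Measure (E (m + 2))) ≤ C := by
    refine hc.induction_on (p := fun s => ∃ C : ℝ≥0, ∀ x : E (m + 2), ∫⁻ y in frontier Ω ∩ s,
      ENNReal.ofReal (‖x - y‖ ^ 2 * (1 / ‖x - y‖ ^ (m + 2)))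
        ∂(μHE[m + 1] : Measure (E (m + 2))) ≤ C) ?_ ?_ ?_ ?_
    · exact ⟨0, by simp⟩
    · rintro s t hst ⟨C, hC⟩
      exact ⟨C, fun φ => (lintegral_mono_set (inter_subset_inter_right _ hst)).trans (hC φ)⟩
    · rintro s t ⟨C, hC⟩ ⟨D, hD⟩
      refine ⟨C + D, fun φ => ?_⟩
      rw [inter_union_distrib_left, ENNReal.coe_add]
      exact (lintegral_union_le _ _ _).trans (add_le_add (hC φ) (hD φ))
    · intro x hx
      obtain ⟨c, hc⟩ := exists_boundaryChart hΩo hΩ hx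
      obtain ⟨K, hK⟩ := c.lintegral_frontier_le
      obtain ⟨C, hC⟩ := lintegral_potential_flat_le c.isBounded_D
      refine ⟨c.nbhd c.h, mem_nhdsWithin_of_mem_nhds
        ((c.isOpen_nbhd _).mem_nhds (hc _ c.h_pos)), K * C, fun z => ?_⟩
      refine (hK _ (by fun_prop)).trans ?_
      rw [ENNReal.coe_mul]
      gcongr
      refine le_trans (lintegral_mono_ae ?_) (hC (cylSnd c.b z))
      -- At that point the flat kernel takes the value 0, by the convention 1/0 = 0, and the
      -- comparison could fail.
      have h0 : ∀ᵐ y : E (m + 1), y ≠ cylSnd c.b z := by simp [ae_iff]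
      filter_upwards [ae_restrict_of_ae h0] with y hy
      refine ENNReal.ofReal_le_ofReal ?_
      have h1 : 0 < ‖cylSnd c.b z - y‖ := norm_pos_iff.2 (sub_ne_zero.2 (Ne.symm hy))
      have h2 : ‖cylSnd c.b z - y‖ ≤ ‖z - c.graph y‖ := norm_cylSnd_sub_le c.b z (c.g y, y)
      have h3 : ∀ t : ℝ, 0 < t → t ^ 2 * (1 / t ^ (m + 2)) = 1 / t ^ m := by
        intro t ht
        field_simp
        ring
      rw [h3 _ h1, h3 _ (h1.trans_le h2)]
      exact one_div_le_one_div_of_le (by positivity) (pow_le_pow_left₀ h1.le h2 m)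
  rwa [inter_self] at key

end BoundaryGlobal

/-! ### Poincaré's inequality in convex sets. -/

section Poincare

lemma sq_lintegral_le {α : Type*} [MeasurableSpace α] (μ : Measure α) {f : α → ℝ≥0∞}
    (hf : AEMeasurable f μ) : (∫⁻ x, f x ∂μ) ^ 2 ≤ μ univ * ∫⁻ x, f x ^ 2 ∂μ := by
  have h := ENNReal.lintegral_mul_le_Lp_mul_Lq μ Real.HolderConjugate.two_two hf
    (aemeasurable_const (b := (1 : ℝ≥0∞)))
  have h2 : ∀ a : ℝ≥0∞, (a ^ (1 / 2 : ℝ)) ^ 2 = a := fun a => by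
    rw [← ENNReal.rpow_natCast, ← ENNReal.rpow_mul]
    norm_num
  calc (∫⁻ x, f x ∂μ) ^ 2 = (∫⁻ x, (f * fun _ => (1 : ℝ≥0∞) : α → ℝ≥0∞) x ∂μ) ^ 2 := by simp
    _ ≤ ((∫⁻ a, f a ^ (2 : ℝ) ∂μ) ^ (1 / 2 : ℝ) * (∫⁻ _, 1 ^ (2 : ℝ) ∂μ) ^ (1 / 2 : ℝ)) ^ 2 := by
        gcongr
    _ = _ := by
        rw [mul_pow, h2, h2]
        simp [mul_comm]

lemma ennreal_add_sq_le (a b : ℝ≥0∞) : (a + b) ^ 2 ≤ 2 * (a ^ 2 + b ^ 2) := by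
  wlog h : a ≤ b generalizing a b
  · rw [add_comm a, add_comm (a ^ 2)]
    exact this b a (le_of_not_ge h)
  obtain ⟨c, rfl⟩ := exists_add_of_le h
  have : 2 * (a ^ 2 + (a + c) ^ 2) = (a + (a + c)) ^ 2 + c ^ 2 := by ring
  rw [this]
  exact le_self_add

variable {n : ℕ} {B : Set (E (n + 1))}

/-- A homothety centered in the convex set B maps B into itself, and its inverse multiplies volumes
by at most 2ⁿ⁺¹ when the ratio is at least 1/2. -/
lemma lintegral_comp_add_smul_le (hB : Convex ℝ B) (hm : MeasurableSet B)
    {F : E (n + 1) → ℝ≥0∞} (hF : Measurable F) {c : E (n + 1)} (hc : c ∈ B) {t : ℝ}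
    (ht : 1 / 2 ≤ t) (ht' : t ≤ 1) :
    ∫⁻ x in B, F (c + t • (x - c)) ≤ 2 ^ (n + 1) * ∫⁻ x in B, F x := by
  have ht0 : 0 < t := by linarith
  have hFB := hF.indicator hm
  calc ∫⁻ x in B, F (c + t • (x - c)) ≤ ∫⁻ x in B, B.indicator F (c + t • (x - c)) := by
        refine setLIntegral_mono' hm fun x hx => ?_
        rw [indicator_of_mem]
        exact hB.add_smul_sub_mem hc hx ⟨ht0.le, ht'⟩
    _ ≤ ∫⁻ x, B.indicator F (c + t • (x - c)) := setLIntegral_le_lintegral _ _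
    _ = ∫⁻ x, B.indicator F (c + t • x) :=
        lintegral_sub_right_eq_self (fun x => B.indicator F (c + t • x)) c
    _ = ∫⁻ x, B.indicator F (c + x) ∂(Measure.map (t • ·) volume) :=
        (lintegral_map (hFB.comp (measurable_const_add c)) (measurable_const_smul t)).symm
    _ = ENNReal.ofReal |(t ^ (n + 1))⁻¹| * ∫⁻ x, B.indicator F (c + x) := by
        rw [Measure.map_addHaar_smul _ ht0.ne', lintegral_smul_measure]
        simp
    _ ≤ 2 ^ (n + 1) * ∫⁻ x, B.indicator F (c + x) := by
        gcongr
        rw [abs_of_pos (by positivity), ← inv_pow, ENNReal.ofReal_pow (by positivity)]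
        gcongr
        rw [← ENNReal.ofReal_ofNat]
        refine ENNReal.ofReal_le_ofReal ?_
        rw [inv_le_comm₀ ht0 (by norm_num)]
        linarith
    _ = _ := by
        rw [lintegral_add_left_eq_self (fun x => B.indicator F x) c, lintegral_indicator hm]

/-- The point of parameter t is the image of y by a homothety of ratio 1 - t and center x, and the
image of x by one of ratio t and center y. The variable whose ratio is at least 1/2 is integrated
first, which avoids the degenerate Jacobians at t = 0 and t = 1. -/
lemma lintegral_segment_le (hB : Convex ℝ B) (hm : MeasurableSet B)
    {F : E (n + 1) → ℝ≥0∞} (hF : Measurable F) {t : ℝ} (ht : t ∈ Icc (0 : ℝ) 1) :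
    ∫⁻ x in B, ∫⁻ y in B, F (y + t • (x - y)) ≤ volume B * (2 ^ (n + 1) * ∫⁻ x in B, F x) := by
  rcases le_total t (1 / 2) with h | h
  · refine (setLIntegral_mono' (g := fun _ => 2 ^ (n + 1) * ∫⁻ x in B, F x) hm
      fun x hx => ?_).trans_eq (by rw [setLIntegral_const, mul_comm])
    have e : ∀ y, y + t • (x - y) = x + (1 - t) • (y - x) := fun y => by module
    simp only [e]
    exact lintegral_comp_add_smul_le hB hm hF hx (by linarith) (by linarith [ht.1])
  · rw [lintegral_lintegral_swap]
    · refine (setLIntegral_mono' (g := fun _ => 2 ^ (n + 1) * ∫⁻ x in B, F x) hm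
        fun y hy => ?_).trans_eq (by rw [setLIntegral_const, mul_comm])
      exact lintegral_comp_add_smul_le hB hm hF hy h ht.2
    · exact (hF.comp (by fun_prop : Continuous fun p : E (n + 1) × E (n + 1) =>
        p.2 + t • (p.1 - p.2)).measurable).aemeasurable

lemma lintegral_lintegral_segment_le (hB : Convex ℝ B) (hm : MeasurableSet B)
    {F : E (n + 1) → ℝ≥0∞} (hF : Measurable F) :
    ∫⁻ x in B, ∫⁻ y in B, ∫⁻ t in Ioc (0 : ℝ) 1, F (y + t • (x - y))
      ≤ volume B * (2 ^ (n + 1) * ∫⁻ x in B, F x) := by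
  have hmeas : Measurable fun p : (E (n + 1) × E (n + 1)) × ℝ =>
      F (p.1.2 + p.2 • (p.1.1 - p.1.2)) :=
    hF.comp (by fun_prop : Continuous fun p : (E (n + 1) × E (n + 1)) × ℝ =>
      p.1.2 + p.2 • (p.1.1 - p.1.2)).measurable
  have e1 : ∀ x, ∫⁻ y in B, ∫⁻ t in Ioc (0 : ℝ) 1, F (y + t • (x - y))
      = ∫⁻ t in Ioc (0 : ℝ) 1, ∫⁻ y in B, F (y + t • (x - y)) := by
    intro x
    refine lintegral_lintegral_swap ?_
    exact (hmeas.comp (f := fun p : E (n + 1) × ℝ => ((x, p.1), p.2)) (by fun_prop)).aemeasurable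
  simp only [e1]
  rw [lintegral_lintegral_swap]
  · refine (setLIntegral_mono' (g := fun _ => volume B * (2 ^ (n + 1) * ∫⁻ x in B, F x))
      measurableSet_Ioc fun t ht => lintegral_segment_le hB hm hF ⟨ht.1.le, ht.2⟩).trans_eq ?_
    rw [setLIntegral_const]
    simp
  · have : Measurable fun q : (E (n + 1) × ℝ) × E (n + 1) =>
        F (q.2 + q.1.2 • (q.1.1 - q.2)) :=
      hF.comp (by fun_prop : Continuous fun q : (E (n + 1) × ℝ) × E (n + 1) =>
        q.2 + q.1.2 • (q.1.1 - q.2)).measurable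
    exact (Measurable.lintegral_prod_right' (ν := volume.restrict B) this).aemeasurable

lemma enorm_sq_sub_le_lintegral {F : Type*} [NormedAddCommGroup F] [NormedSpace ℝ F]
    [CompleteSpace F] {w : ℝ → F} (hw : ContDiff ℝ 1 w) :
    ‖w 1 - w 0‖ₑ ^ 2 ≤ ∫⁻ t in Ioc (0 : ℝ) 1, ‖deriv w t‖ₑ ^ 2 := by
  have hd : Continuous (deriv w) := hw.continuous_deriv le_rfl
  have h1 : ∫ τ in (0 : ℝ)..1, deriv w τ = w 1 - w 0 :=
    intervalIntegral.integral_deriv_eq_sub (fun x _ => hw.differentiable (by simp) x)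
      (hd.intervalIntegrable _ _)
  rw [← h1, intervalIntegral.integral_of_le zero_le_one]
  have h2 := enorm_integral_le_lintegral_enorm (μ := volume.restrict (Ioc (0 : ℝ) 1)) (deriv w)
  refine (pow_le_pow_left₀ zero_le h2 2).trans
    ((sq_lintegral_le _ hd.enorm.measurable.aemeasurable).trans_eq ?_)
  simp

/-- Poincaré's inequality in a convex set, with a double integral of differences. -/
lemma lintegral_sub_sq_le (hB : Convex ℝ B) (hm : MeasurableSet B) {d : ℝ≥0}
    (hd : ∀ x ∈ B, ∀ y ∈ B, ‖x - y‖ ≤ d) {φ : E (n + 1) → E (n + 1)} (hφ : ContDiff ℝ ∞ φ) :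
    ∫⁻ x in B, ∫⁻ y in B, ‖φ x - φ y‖ₑ ^ 2
      ≤ d ^ 2 * (volume B * (2 ^ (n + 1) * ∫⁻ x in B, ‖fderiv ℝ φ x‖ₑ ^ 2)) := by
  have m2 : Measurable fun x => ‖fderiv ℝ φ x‖ₑ ^ 2 :=
    (hφ.continuous_fderiv (by simp)).enorm.measurable.pow_const 2
  have hmeas : Measurable fun p : (E (n + 1) × E (n + 1)) × ℝ =>
      ‖fderiv ℝ φ (p.1.2 + p.2 • (p.1.1 - p.1.2))‖ₑ ^ 2 :=
    m2.comp (by fun_prop : Continuous fun p : (E (n + 1) × E (n + 1)) × ℝ =>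
      p.1.2 + p.2 • (p.1.1 - p.1.2)).measurable
  have hpt : ∀ x ∈ B, ∀ y ∈ B, ‖φ x - φ y‖ₑ ^ 2
      ≤ d ^ 2 * ∫⁻ t in Ioc (0 : ℝ) 1, ‖fderiv ℝ φ (y + t • (x - y))‖ₑ ^ 2 := by
    intro x hx y hy
    have hw : ContDiff ℝ 1 fun t : ℝ => φ (y + t • (x - y)) :=
      (hφ.of_le (by simp)).comp (contDiff_const.add (contDiff_id.smul contDiff_const))
    have h1 := enorm_sq_sub_le_lintegral hw
    simp only [one_smul, zero_smul, add_zero, add_sub_cancel] at h1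
    refine h1.trans ?_
    rw [← lintegral_const_mul]
    · refine lintegral_mono fun t => ?_
      have h3 : HasDerivAt (fun t : ℝ => y + t • (x - y)) (x - y) t := by
        simpa using ((hasDerivAt_id t).smul_const (x - y)).const_add y
      have h4 := ((hφ.differentiable (by simp) _).hasFDerivAt.comp_hasDerivAt t h3).deriv
      rw [show (fun t : ℝ => φ (y + t • (x - y))) = φ ∘ fun t : ℝ => y + t • (x - y) from rfl, h4,
        ← mul_pow]
      gcongr
      rw [← ofReal_norm, ← ofReal_norm, ← ENNReal.ofReal_coe_nnreal, ← ENNReal.ofReal_mul (NNReal.coe_nonneg d)]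
      refine ENNReal.ofReal_le_ofReal ((ContinuousLinearMap.le_opNorm _ _).trans ?_)
      rw [mul_comm]
      gcongr
      exact hd x hx y hy
    · exact hmeas.comp (f := fun t : ℝ => ((x, y), t)) (by fun_prop)
  calc ∫⁻ x in B, ∫⁻ y in B, ‖φ x - φ y‖ₑ ^ 2
      ≤ ∫⁻ x in B, ∫⁻ y in B, d ^ 2 * ∫⁻ t in Ioc (0 : ℝ) 1, ‖fderiv ℝ φ (y + t • (x - y))‖ₑ ^ 2 :=
        setLIntegral_mono' hm fun x hx => setLIntegral_mono' hm fun y hy => hpt x hx y hy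
    _ = d ^ 2 * ∫⁻ x in B, ∫⁻ y in B, ∫⁻ t in Ioc (0 : ℝ) 1,
          ‖fderiv ℝ φ (y + t • (x - y))‖ₑ ^ 2 := by
        have hm1 : Measurable fun p : E (n + 1) × E (n + 1) => ∫⁻ t in Ioc (0 : ℝ) 1,
            ‖fderiv ℝ φ (p.2 + t • (p.1 - p.2))‖ₑ ^ 2 :=
          Measurable.lintegral_prod_right' (ν := volume.restrict (Ioc (0 : ℝ) 1)) hmeas
        rw [← lintegral_const_mul' _ _ (by finiteness)]
        refine lintegral_congr fun x => ?_
        rw [lintegral_const_mul' _ _ (by finiteness)]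
    _ ≤ _ := by
        gcongr
        exact lintegral_lintegral_segment_le hB hm m2

/-- The value φ(x) is the mean of φ over B plus the mean over y of φ(x) - φ(y). The coefficient of
the gradient term involves only the diameter and the dimension, so it is small on small cells. -/
lemma lintegral_sq_le_of_convex (hB : Convex ℝ B) (hm : MeasurableSet B) {d : ℝ≥0}
    (hd : ∀ x ∈ B, ∀ y ∈ B, ‖x - y‖ ≤ d) (hv : volume B ≠ ⊤) (hv0 : volume B ≠ 0)
    {φ : E (n + 1) → E (n + 1)} (hφ : ContDiff ℝ ∞ φ) (hc : HasCompactSupport φ) :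
    ∫⁻ x in B, ‖φ x‖ₑ ^ 2 ≤ 2 * (volume B)⁻¹ * ‖∫ x in B, φ x‖ₑ ^ 2
      + 2 * d ^ 2 * 2 ^ (n + 1) * ∫⁻ x in B, ‖fderiv ℝ φ x‖ₑ ^ 2 := by
  set V := volume B
  have hφi : IntegrableOn φ B := (hφ.continuous.integrable_of_hasCompactSupport hc).integrableOn
  have hcm : ∀ x, Measurable fun y => ‖φ x - φ y‖ₑ := fun x =>
    (by have := hφ.continuous; fun_prop : Continuous fun y => φ x - φ y).enorm.measurable
  have hpt : ∀ x, V ^ 2 * ‖φ x‖ₑ ^ 2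
      ≤ 2 * ‖∫ y in B, φ y‖ₑ ^ 2 + 2 * V * ∫⁻ y in B, ‖φ x - φ y‖ₑ ^ 2 := by
    intro x
    have hconst : IntegrableOn (fun _ : E (n + 1) => φ x) B := integrableOn_const hv (by simp)
    have e1 : volume.real B • φ x = (∫ y in B, φ y) + ∫ y in B, (φ x - φ y) := by
      rw [integral_sub hconst hφi, setIntegral_const]
      abel
    have e2 : V * ‖φ x‖ₑ ≤ ‖∫ y in B, φ y‖ₑ + ∫⁻ y in B, ‖φ x - φ y‖ₑ := by
      have : V * ‖φ x‖ₑ = ‖volume.real B • φ x‖ₑ := by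
        rw [enorm_smul, Measure.real, Real.enorm_eq_ofReal ENNReal.toReal_nonneg,
          ENNReal.ofReal_toReal hv]
      rw [this, e1]
      exact (enorm_add_le _ _).trans (add_le_add le_rfl (enorm_integral_le_lintegral_enorm _))
    have e3 : (∫⁻ y in B, ‖φ x - φ y‖ₑ) ^ 2 ≤ V * ∫⁻ y in B, ‖φ x - φ y‖ₑ ^ 2 := by
      simpa using sq_lintegral_le (volume.restrict B) (hcm x).aemeasurable
    rw [← mul_pow]
    refine (pow_le_pow_left₀ zero_le e2 2).trans ((ennreal_add_sq_le _ _).trans ?_)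
    rw [mul_add, mul_assoc 2 V]
    gcongr
  have hint : V ^ 2 * ∫⁻ x in B, ‖φ x‖ₑ ^ 2 ≤ V * (2 * ‖∫ y in B, φ y‖ₑ ^ 2)
      + 2 * V * (d ^ 2 * (V * (2 ^ (n + 1) * ∫⁻ x in B, ‖fderiv ℝ φ x‖ₑ ^ 2))) := by
    rw [← lintegral_const_mul' _ _ (by finiteness)]
    refine (lintegral_mono hpt).trans ?_
    rw [lintegral_add_left measurable_const, setLIntegral_const, mul_comm (2 * _) V,
      lintegral_const_mul' _ _ (by finiteness)]
    gcongr
    exact lintegral_sub_sq_le hB hm hd hφ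
  have hV : V⁻¹ * V = 1 := ENNReal.inv_mul_cancel hv0 hv
  calc ∫⁻ x in B, ‖φ x‖ₑ ^ 2 = (V⁻¹ * V) ^ 2 * ∫⁻ x in B, ‖φ x‖ₑ ^ 2 := by
        rw [hV, one_pow, one_mul]
    _ = V⁻¹ ^ 2 * (V ^ 2 * ∫⁻ x in B, ‖φ x‖ₑ ^ 2) := by ring
    _ ≤ V⁻¹ ^ 2 * (V * (2 * ‖∫ y in B, φ y‖ₑ ^ 2)
      + 2 * V * (d ^ 2 * (V * (2 ^ (n + 1) * ∫⁻ x in B, ‖fderiv ℝ φ x‖ₑ ^ 2)))) := by gcongr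
    _ = (V⁻¹ * V) * (2 * V⁻¹ * ‖∫ y in B, φ y‖ₑ ^ 2)
      + (V⁻¹ * V) ^ 2 * (2 * d ^ 2 * 2 ^ (n + 1) * ∫⁻ x in B, ‖fderiv ℝ φ x‖ₑ ^ 2) := by ring
    _ = _ := by rw [hV, one_pow, one_mul, one_mul]

end Poincare

/-! ### Rellich compactness in quantitative form. -/

section Compactness

variable {n : ℕ}

/-- The cells of the cubic grid of side `h`. -/
def cell (h : ℝ) (k : Fin (n + 1) → ℤ) : Set (E (n + 1)) := {x | ∀ i, ⌊x i / h⌋ = k i}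

lemma measurableSet_cell (h : ℝ) (k : Fin (n + 1) → ℤ) : MeasurableSet (cell h k) := by
  have : cell h k = ⋂ i, (fun x : E (n + 1) => ⌊x i / h⌋) ⁻¹' {k i} := by
    ext x
    simp [cell]
  rw [this]
  exact MeasurableSet.iInter fun i =>
    (by fun_prop : Measurable fun x : E (n + 1) => ⌊x i / h⌋) (measurableSet_singleton _)

lemma convex_cell (h : ℝ) (k : Fin (n + 1) → ℤ) : Convex ℝ (cell h k) := by
  have : cell h k = ⋂ i, (fun x : E (n + 1) => h⁻¹ * x i) ⁻¹' (Ico (k i : ℝ) (k i + 1)) := by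
    ext x
    simp only [cell, mem_ofPred_eq, Int.floor_eq_iff, mem_iInter, mem_preimage, mem_Ico]
    simp only [div_eq_inv_mul]
  rw [this]
  refine convex_iInter fun i => (convex_Ico _ _).is_linear_preimage ?_
  exact (h⁻¹ • (EuclideanSpace.proj i : E (n + 1) →L[ℝ] ℝ)).isBoundedLinearMap.toIsLinearMap

lemma norm_sub_le_of_mem_cell {h : ℝ} (hh : 0 < h) {k : Fin (n + 1) → ℤ} {x y : E (n + 1)}
    (hx : x ∈ cell h k) (hy : y ∈ cell h k) : ‖x - y‖ ≤ (n + 1) * h := by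
  have h1 : ∀ i, (x i - y i) ^ 2 ≤ h ^ 2 := by
    intro i
    have e1 := Int.floor_eq_iff.1 (hx i)
    have e2 := Int.floor_eq_iff.1 (hy i)
    have a1 := (le_div_iff₀ hh).1 e1.1
    have a2 := (div_lt_iff₀ hh).1 e1.2
    have a3 := (le_div_iff₀ hh).1 e2.1
    have a4 := (div_lt_iff₀ hh).1 e2.2
    exact sq_le_sq' (by linarith) (by linarith)
  have h2 : ‖x - y‖ ^ 2 ≤ ((n + 1) * h) ^ 2 := by
    rw [EuclideanSpace.norm_sq_eq]
    calc ∑ i, ‖(x - y) i‖ ^ 2 ≤ ∑ i : Fin (n + 1), h ^ 2 := Finset.sum_le_sum fun i _ => by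
          simpa using h1 i
      _ = (n + 1) * h ^ 2 := by simp
      _ ≤ _ := by
        have : (0 : ℝ) ≤ n := n.cast_nonneg
        nlinarith [sq_nonneg h, mul_nonneg this (sq_nonneg h), mul_nonneg (mul_nonneg this this) (sq_nonneg h)]
  exact (abs_le_of_sq_le_sq' h2 (by positivity)).2

lemma disjoint_cell (h : ℝ) {k l : Fin (n + 1) → ℤ} (hkl : k ≠ l) :
    Disjoint (cell h k) (cell h l) := by
  refine Set.disjoint_left.2 fun x hx hx' => hkl ?_
  ext i
  rw [← hx i, ← hx' i]

/-- Up to a small multiple of the `H¹` norm, the `L²` norm of smooth functions is controlled by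
finitely many averages. -/
lemma lintegral_sq_le_averages {Ω : Set (E (n + 1))} (hΩo : IsOpen Ω)
    (hΩb : Bornology.IsBounded Ω) (hΩ : IsC11 Ω) {η : ℝ≥0} (hη : 0 < η) :
    ∃ (T : Finset (Fin (n + 1) → ℤ)) (Q : (Fin (n + 1) → ℤ) → Set (E (n + 1))) (C : ℝ≥0),
      (∀ k ∈ T, Q k ⊆ Ω) ∧ ∀ φ : E (n + 1) → E (n + 1), ContDiff ℝ ∞ φ → HasCompactSupport φ →
      ∫⁻ x in Ω, ‖φ x‖ₑ ^ 2 ≤ η * sqH1 Ω φ + C * ∑ k ∈ T, ‖∫ x in Q k, φ x‖ₑ ^ 2 := by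
  classical
  obtain ⟨O, hO, hfO, hstrip⟩ := exists_isOpen_lintegral_le hΩo hΩb hΩ (half_pos hη)
  set K := closure Ω \ O with hK
  have hKc : IsCompact K := hΩb.isCompact_closure.diff hO
  have hKΩ : K ⊆ Ω := by
    rintro x ⟨hx, hxO⟩
    by_contra h
    exact hxO (hfO (by rw [hΩo.frontier_eq]; exact ⟨hx, h⟩))
  obtain ⟨δ, hδ, hthick⟩ := hKc.exists_thickening_subset_open hΩo hKΩ
  set d : ℝ≥0 := min (δ / 2).toNNReal (min 1 (η / 2 ^ (n + 3))) with hd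
  have hd0 : 0 < d := lt_min (by simpa using hδ) (lt_min one_pos (by positivity))
  have hdδ : (d : ℝ) ≤ δ / 2 := by
    have : d ≤ (δ / 2).toNNReal := min_le_left _ _
    rw [← Real.coe_toNNReal (δ / 2) (by positivity)]
    exact_mod_cast this
  have hdη : 2 * d ^ 2 * 2 ^ (n + 1) ≤ η / 2 := by
    have h1 : d ≤ 1 := (min_le_right _ _).trans (min_le_left _ _)
    have h2 : d ≤ η / 2 ^ (n + 3) := (min_le_right _ _).trans (min_le_right _ _)
    have h3 : d ^ 2 ≤ d := by
      rw [sq]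
      exact mul_le_of_le_one_left zero_le h1
    calc 2 * d ^ 2 * 2 ^ (n + 1) ≤ 2 * (η / 2 ^ (n + 3)) * 2 ^ (n + 1) := by
          gcongr
          exact h3.trans h2
      _ = η / 2 := by
          field_simp
          ring
  set h : ℝ := d / (n + 1) with hh
  have hh0 : 0 < h := by positivity
  have hdiam : ∀ k : Fin (n + 1) → ℤ, ∀ x ∈ cell h k, ∀ y ∈ cell h k, ‖x - y‖ ≤ d := by
    intro k x hx y hy
    refine (norm_sub_le_of_mem_cell hh0 hx hy).trans_eq ?_
    rw [hh]
    field_simp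
  obtain ⟨R, hR⟩ := hKc.isBounded.exists_norm_le
  set T : Finset (Fin (n + 1) → ℤ) :=
    (Finset.Icc (fun _ => ⌊-R / h⌋) (fun _ => ⌊R / h⌋)).filter fun k => ∃ x ∈ K, x ∈ cell h k
  have hTΩ : ∀ k ∈ T, cell h k ⊆ Ω := by
    intro k hk y hy
    obtain ⟨x, hxK, hx⟩ := (Finset.mem_filter.1 hk).2
    refine hthick (Metric.mem_thickening_iff.2 ⟨x, hxK, ?_⟩)
    rw [dist_eq_norm]
    linarith [hdiam k y hy x hx]
  have hKT : K ⊆ ⋃ k ∈ T, cell h k := by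
    intro x hx
    have hx' : x ∈ cell h (fun i => ⌊x i / h⌋) := fun i => rfl
    refine mem_iUnion₂.2 ⟨_, Finset.mem_filter.2 ⟨Finset.mem_Icc.2 ⟨fun i => ?_, fun i => ?_⟩,
      x, hx, hx'⟩, hx'⟩
    all_goals
      have h1 : |x i| ≤ R := by
        simpa using (PiLp.norm_apply_le x i).trans (hR x hx)
      have h2 := abs_le.1 h1
      dsimp only
      gcongr
      linarith
  have hvol : ∀ k ∈ T, volume (cell h k) ≠ ⊤ := fun k hk =>
    ((measure_mono (hTΩ k hk)).trans_lt hΩb.measure_lt_top).ne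
  refine ⟨T, cell h, ∑ k ∈ T, (2 * (volume (cell h k))⁻¹).toNNReal, hTΩ, fun φ hφ hc => ?_⟩
  have hcell : ∀ k ∈ T, ∫⁻ x in cell h k, ‖φ x‖ₑ ^ 2
      ≤ ((2 * (volume (cell h k))⁻¹).toNNReal : ℝ≥0∞) * ‖∫ x in cell h k, φ x‖ₑ ^ 2
        + (η / 2 : ℝ≥0) * ∫⁻ x in cell h k, ‖fderiv ℝ φ x‖ₑ ^ 2 := by
    intro k hk
    by_cases h0 : volume (cell h k) = 0
    · rw [Measure.restrict_eq_zero.2 h0]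
      simp
    · rw [ENNReal.coe_toNNReal (ENNReal.mul_ne_top (by simp) (ENNReal.inv_ne_top.2 h0))]
      refine (lintegral_sq_le_of_convex (convex_cell h k) (measurableSet_cell h k) (hdiam k)
        (hvol k hk) h0 hφ hc).trans ?_
      gcongr
      exact_mod_cast hdη
  have hsplit : ∫⁻ x in Ω, ‖φ x‖ₑ ^ 2
      ≤ (∫⁻ x in Ω ∩ O, ‖φ x‖ₑ ^ 2) + ∑ k ∈ T, ∫⁻ x in cell h k, ‖φ x‖ₑ ^ 2 := by
    have hsub : Ω ⊆ (Ω ∩ O) ∪ ⋃ k ∈ T, cell h k := by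
      intro x hx
      by_cases hxO : x ∈ O
      · exact Or.inl ⟨hx, hxO⟩
      · exact Or.inr (hKT ⟨subset_closure hx, hxO⟩)
    refine (lintegral_mono_set hsub).trans ((lintegral_union_le _ _ _).trans ?_)
    rw [lintegral_biUnion_finset (fun i _ j _ hij => disjoint_cell h hij)
      (fun k _ => measurableSet_cell h k)]
  have hgrad : ∑ k ∈ T, ∫⁻ x in cell h k, ‖fderiv ℝ φ x‖ₑ ^ 2
      ≤ ∫⁻ x in Ω, ‖fderiv ℝ φ x‖ₑ ^ 2 := by
    rw [← lintegral_biUnion_finset (fun i _ j _ hij => disjoint_cell h hij)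
      (fun k _ => measurableSet_cell h k)]
    exact lintegral_mono_set (iUnion₂_subset hTΩ)
  refine hsplit.trans ((add_le_add (hstrip φ hφ) (Finset.sum_le_sum hcell)).trans ?_)
  rw [Finset.sum_add_distrib, ← Finset.mul_sum]
  have h3 : ∑ k ∈ T, ((2 * (volume (cell h k))⁻¹).toNNReal : ℝ≥0∞) * ‖∫ x in cell h k, φ x‖ₑ ^ 2
      ≤ ((∑ k ∈ T, (2 * (volume (cell h k))⁻¹).toNNReal : ℝ≥0) : ℝ≥0∞)
        * ∑ k ∈ T, ‖∫ x in cell h k, φ x‖ₑ ^ 2 := by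
    rw [Finset.mul_sum]
    refine Finset.sum_le_sum fun k hk => ?_
    gcongr
    exact Finset.single_le_sum (f := fun k => (2 * (volume (cell h k))⁻¹).toNNReal)
      (fun _ _ => zero_le) hk
  calc _ ≤ ((η / 2 : ℝ≥0) : ℝ≥0∞) * sqH1 Ω φ
        + (((∑ k ∈ T, (2 * (volume (cell h k))⁻¹).toNNReal : ℝ≥0) : ℝ≥0∞)
          * ∑ k ∈ T, ‖∫ x in cell h k, φ x‖ₑ ^ 2 + ((η / 2 : ℝ≥0) : ℝ≥0∞) * sqH1 Ω φ) := by
        gcongr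
        exact hgrad.trans le_add_self
    _ = (((η / 2 : ℝ≥0) : ℝ≥0∞) + ((η / 2 : ℝ≥0) : ℝ≥0∞)) * sqH1 Ω φ
        + ((∑ k ∈ T, (2 * (volume (cell h k))⁻¹).toNNReal : ℝ≥0) : ℝ≥0∞)
          * ∑ k ∈ T, ‖∫ x in cell h k, φ x‖ₑ ^ 2 := by ring
    _ = _ := by rw [← ENNReal.coe_add, add_halves]

end Compactness

/-! ### Rigid displacements. -/

section Rigid

variable {n : ℕ}

lemma inner_apply_self_of_symAdd_eq_zero {L : E (n + 1) →L[ℝ] E (n + 1)} (hL : symAdd L = 0)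
    (x y : E (n + 1)) : ⟪L x, y⟫ = -⟪L y, x⟫ := by
  have := inner_symAdd L x y
  rw [hL] at this
  simp at this
  linarith

lemma symAdd_eq_zero_of_inner {L : E (n + 1) →L[ℝ] E (n + 1)} (hL : ∀ z, ⟪L z, z⟫ = 0) :
    symAdd L = 0 := by
  ext1 x
  refine ext_inner_right ℝ fun y => ?_
  rw [inner_symAdd]
  have := hL (x + y)
  simp only [map_add, inner_add_left, inner_add_right, hL] at this
  simp
  linarith

/-- A field `u` with `⟪u x - u y, x - y⟫ = 0` is an infinitesimal rigid displacement. -/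
lemma exists_rigid_of_inner_eq_zero {B : Set (E (n + 1))} (hB : IsOpen B) (hne : B.Nonempty)
    {u : E (n + 1) → E (n + 1)}
    (hu : ∀ᵐ y ∂(volume.restrict B), ∀ᵐ x ∂(volume.restrict B), ⟪u x - u y, x - y⟫ = 0) :
    ∃ (L : E (n + 1) →L[ℝ] E (n + 1)) (b : E (n + 1)), symAdd L = 0 ∧
      ∀ᵐ x ∂(volume.restrict B), u x = L x + b := by
  have hvol : volume B ≠ 0 := (hB.measure_pos volume hne).ne'
  have : NeBot (ae (volume.restrict B)) := by
    rw [ae_neBot, Ne, Measure.restrict_eq_zero]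
    exact hvol
  set G : Set (E (n + 1)) := {y | ∀ᵐ x ∂(volume.restrict B), ⟪u x - u y, x - y⟫ = 0}
  have hG : ∀ᵐ y ∂(volume.restrict B), y ∈ G := hu
  obtain ⟨y₀, hy₀⟩ := hG.exists
  -- G has full measure in B; if these differences spanned a proper subspace, G would lie in a
  -- translate of it, which is null.
  have hspan : ⊤ ≤ Submodule.span ℝ ((fun y => y - y₀) '' G) := by
    by_contra h
    set W := Submodule.span ℝ ((fun y => y - y₀) '' G)
    have hW : W ≠ ⊤ := fun h' => h h'.ge
    have h0 : volume (W : Set (E (n + 1))) = 0 := Measure.addHaar_submodule volume W hW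
    have h1 : volume ((fun y => y - y₀) ⁻¹' (W : Set (E (n + 1)))) = 0 := by
      have := measure_preimage_add_right (volume : Measure (E (n + 1))) (-y₀) (W : Set (E (n + 1)))
      simp only [← sub_eq_add_neg] at this
      rw [this, h0]
    have h2 : ∀ᵐ y ∂(volume.restrict B), y ∉ (fun y => y - y₀) ⁻¹' (W : Set (E (n + 1))) :=
      ae_restrict_of_ae (measure_eq_zero_iff_ae_notMem.1 h1)
    obtain ⟨y, hy, hy'⟩ := (hG.and h2).exists
    exact hy' (Submodule.subset_span ⟨y, hy, rfl⟩)
  set v := Module.Basis.ofSpan hspan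
  have hv : ∀ i, ∃ y ∈ G, y - y₀ = v i := fun i => Module.Basis.ofSpan_subset hspan ⟨i, rfl⟩
  choose y hyG hyv using hv
  have : Fintype _ := FiniteDimensional.fintypeBasisIndex v
  let A : E (n + 1) →ₗ[ℝ] (_ → ℝ) := LinearMap.pi fun i => (innerSL ℝ (v i)).toLinearMap
  have hA : LinearMap.ker A = ⊥ := by
    rw [LinearMap.ker_eq_bot']
    intro w hw
    have : ∀ z, ⟪z, w⟫ = 0 := fun z => by
      have hz : z ∈ Submodule.span ℝ (range v) := by
        rw [v.span_eq]
        exact Submodule.mem_top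
      induction hz using Submodule.span_induction with
      | mem z hz =>
        obtain ⟨i, rfl⟩ := hz
        exact congrFun hw i
      | zero => simp
      | add a b _ _ ha hb => rw [inner_add_left, ha, hb, add_zero]
      | smul c a _ ha => rw [real_inner_smul_left, ha, mul_zero]
    exact inner_self_eq_zero.1 (this w)
  obtain ⟨S, hS⟩ := A.exists_leftInverse_of_injective hA
  let M : E (n + 1) →ₗ[ℝ] (_ → ℝ) :=
    LinearMap.pi fun i => (innerSL ℝ (u y₀ - u (y i))).toLinearMap
  let k : _ → ℝ := fun i => ⟪u (y i), y i⟫ - ⟪u y₀, y₀⟫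
  have haff : ∀ᵐ x ∂(volume.restrict B),
      u x = (S ∘ₗ M).toContinuousLinearMap x + S k := by
    have hall : ∀ᵐ x ∂(volume.restrict B), ∀ i, ⟪u x - u (y i), x - y i⟫ = 0 :=
      ae_all_iff.2 fun i => hyG i
    filter_upwards [hall, hy₀] with x hx hx0
    -- Subtracting the relation at y₀ from the one at yᵢ cancels the quadratic term ⟪u x, x⟫. What
    -- is left is a linear system for u x, injective because the yᵢ - y₀ form a basis, with right
    -- side affine in x.
    have h1 : A (u x) = M x + k := by
      ext i
      have e := hx i
      simp only [A, M, k, LinearMap.pi_apply, ContinuousLinearMap.coe_coe, innerSL_apply_apply,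
        Pi.add_apply, ← hyv]
      simp only [inner_sub_left, inner_sub_right] at e hx0 ⊢
      rw [real_inner_comm (u x) (y i), real_inner_comm (u x) y₀]
      linarith
    have h2 := congrArg S h1
    rw [← LinearMap.comp_apply, hS, LinearMap.id_apply, map_add] at h2
    exact h2
  set L := (S ∘ₗ M).toContinuousLinearMap
  refine ⟨L, S k, ?_, haff⟩
  obtain ⟨z₀, ⟨hz₀, hz₀'⟩, hz₀B⟩ :=
    ((hG.and haff).and (ae_restrict_mem hB.measurableSet)).exists
  -- The original relation at z₀ now says that the quadratic form of L vanishes, almost everywhere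
  -- and hence by continuity everywhere on B; homogeneity extends this to all directions.
  have h1 : EqOn (fun x => ⟪L (x - z₀), x - z₀⟫) (fun _ => 0) B := by
    refine Measure.eqOn_open_of_ae_eq (μ := volume) ?_ hB (by fun_prop) (by fun_prop)
    filter_upwards [hz₀, haff] with x hx hx'
    rw [hx', hz₀', add_sub_add_right_eq_sub, ← map_sub] at hx
    exact hx
  refine symAdd_eq_zero_of_inner fun z => ?_
  have h2 : ∀ᶠ t : ℝ in 𝓝[>] 0, z₀ + t • z ∈ B := by
    have : Tendsto (fun t : ℝ => z₀ + t • z) (𝓝[>] 0) (𝓝 z₀) := by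
      have hc : Continuous fun t : ℝ => z₀ + t • z := by fun_prop
      have := hc.tendsto 0
      simp only [zero_smul, add_zero] at this
      exact this.mono_left nhdsWithin_le_nhds
    exact this (hB.mem_nhds hz₀B)
  obtain ⟨t, ht, ht0⟩ := (h2.and self_mem_nhdsWithin).exists
  have h3 := h1 ht
  simp only [add_sub_cancel_left, map_smul, real_inner_smul_left, real_inner_smul_right] at h3
  have ht0 : t ≠ 0 := (mem_Ioi.1 ht0).ne'
  simpa [ht0] using h3

end Rigid

/-! ### Limits of fields with vanishing strain, and zero sets of rigid displacements. -/

section KornFirst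

variable {n : ℕ}

lemma enorm_inner_le (x y : E (n + 1)) : ‖⟪x, y⟫‖ₑ ≤ ‖x‖ₑ * ‖y‖ₑ := by
  rw [← ofReal_norm, ← ofReal_norm, ← ofReal_norm, ← ENNReal.ofReal_mul (norm_nonneg _)]
  exact ENNReal.ofReal_le_ofReal (norm_inner_le_norm x y)

/-- Along the segment, the derivative of ⟪φ, x - y⟫ is a quadratic form in x - y, so it sees only
the symmetric part of the gradient. The kernel of the strain is thereby characterized without second
derivatives. -/
lemma enorm_inner_sub_sq_le {φ : E (n + 1) → E (n + 1)} (hφ : ContDiff ℝ ∞ φ) (x y : E (n + 1)) :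
    ‖⟪φ x - φ y, x - y⟫‖ₑ ^ 2 ≤ ‖x - y‖ₑ ^ 4 *
      ∫⁻ t in Ioc (0 : ℝ) 1, ‖symAdd (fderiv ℝ φ (y + t • (x - y)))‖ₑ ^ 2 := by
  set w : ℝ → ℝ := fun t => ⟪φ (y + t • (x - y)), x - y⟫ with hw
  have hw1 : ContDiff ℝ 1 w := by
    have : ContDiff ℝ 1 φ := hφ.of_le (by simp)
    exact (this.comp (by fun_prop)).inner ℝ contDiff_const
  have hd : ∀ t, deriv w t = ⟪fderiv ℝ φ (y + t • (x - y)) (x - y), x - y⟫ := by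
    intro t
    have h1 : HasDerivAt (fun t : ℝ => y + t • (x - y)) (x - y) t := by
      simpa using ((hasDerivAt_id t).smul_const (x - y)).const_add y
    have h2 := ((hφ.differentiable (by simp)) (y + t • (x - y))).hasFDerivAt.comp_hasDerivAt t h1
    have h3 := h2.inner ℝ (hasDerivAt_const t (x - y))
    simpa using h3.deriv
  have h := enorm_sq_sub_le_lintegral hw1
  simp only [hw, one_smul, zero_smul, add_zero, add_sub_cancel, ← inner_sub_left] at h
  refine h.trans ?_
  have hm : Measurable fun t : ℝ => ‖symAdd (fderiv ℝ φ (y + t • (x - y)))‖ₑ ^ 2 :=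
    ((continuous_symAdd.comp ((hφ.continuous_fderiv (by simp)).comp
      (by fun_prop : Continuous fun t : ℝ => y + t • (x - y)))).enorm.measurable).pow_const 2
  rw [← lintegral_const_mul _ hm]
  refine lintegral_mono fun t => ?_
  change ‖deriv w t‖ₑ ^ 2 ≤ _
  rw [hd]
  set L := fderiv ℝ φ (y + t • (x - y))
  have e : ‖(⟪L (x - y), x - y⟫ : ℝ)‖ ≤ ‖x - y‖ ^ 2 * ‖symAdd L‖ := by
    have h1 := inner_symAdd L (x - y) (x - y)
    have h2 := (norm_inner_le_norm (𝕜 := ℝ) (symAdd L (x - y)) (x - y)).trans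
      (mul_le_mul_of_nonneg_right ((symAdd L).le_opNorm _) (norm_nonneg _))
    rw [h1, ← two_mul, norm_mul, Real.norm_ofNat] at h2
    nlinarith [norm_nonneg (⟪L (x - y), x - y⟫ : ℝ)]
  have e2 : ‖(⟪L (x - y), x - y⟫ : ℝ)‖ₑ ≤ ‖x - y‖ₑ ^ 2 * ‖symAdd L‖ₑ := by
    rw [← ofReal_norm, ← ofReal_norm, ← ofReal_norm, ← ENNReal.ofReal_pow (norm_nonneg _),
      ← ENNReal.ofReal_mul (by positivity)]
    exact ENNReal.ofReal_le_ofReal e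
  calc _ ≤ (‖x - y‖ₑ ^ 2 * ‖symAdd L‖ₑ) ^ 2 := by gcongr
    _ = _ := by ring

lemma lintegral_lintegral_combination {α : Type*} [MeasurableSpace α] (μ : Measure α)
    [IsFiniteMeasure μ] {J : α → α → ℝ≥0∞} {e : α → ℝ≥0∞} {a c : ℝ≥0∞}
    (hJ : Measurable (Function.uncurry J)) (he : Measurable e) :
    ∫⁻ y, ∫⁻ x, 2 * (a * J y x + c * (2 * (e x + e y))) ∂μ ∂μ
      = 2 * (a * (∫⁻ y, ∫⁻ x, J y x ∂μ ∂μ)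
        + c * (2 * ((∫⁻ x, e x ∂μ) * μ univ + (∫⁻ y, e y ∂μ) * μ univ))) := by
  have h1 : ∀ y, ∫⁻ x, 2 * (a * J y x + c * (2 * (e x + e y))) ∂μ
      = 2 * (a * (∫⁻ x, J y x ∂μ) + c * (2 * ((∫⁻ x, e x ∂μ) + e y * μ univ))) := by
    intro y
    have hJy : Measurable (J y) := hJ.comp measurable_prodMk_left
    rw [lintegral_const_mul _ (by fun_prop), lintegral_add_left (by fun_prop),
      lintegral_const_mul _ hJy, lintegral_const_mul _ (by fun_prop),
      lintegral_const_mul _ (by fun_prop), lintegral_add_left he, lintegral_const]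
  have hJ2 : Measurable fun y => ∫⁻ x, J y x ∂μ := hJ.lintegral_prod_right'
  simp only [h1]
  rw [lintegral_const_mul _ (by fun_prop), lintegral_add_left (by fun_prop),
    lintegral_const_mul _ hJ2, lintegral_const_mul _ (by fun_prop),
    lintegral_const_mul _ (by fun_prop), lintegral_add_left (by fun_prop),
    lintegral_const, lintegral_mul_const _ he]

/-- An `L²` limit of smooth fields with strains tending to zero is an infinitesimal rigid
displacement on each ball. -/
lemma inner_sub_eq_zero_of_tendsto {ι : Type*} {l : Filter ι} [NeBot l] {B : Set (E (n + 1))}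
    (hB : Convex ℝ B) (hm : MeasurableSet B) {d : ℝ≥0} (hd : ∀ x ∈ B, ∀ y ∈ B, ‖x - y‖ ≤ d)
    (hv : volume B ≠ ⊤) {φ : ι → E (n + 1) → E (n + 1)} (hφ : ∀ k, ContDiff ℝ ∞ (φ k))
    {u : E (n + 1) → E (n + 1)} (hu : Measurable u)
    (h1 : Tendsto (fun k => ∫⁻ x in B, ‖φ k x - u x‖ₑ ^ 2) l (𝓝 0))
    (h2 : Tendsto (fun k => ∫⁻ x in B, ‖symAdd (fderiv ℝ (φ k) x)‖ₑ ^ 2) l (𝓝 0)) :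
    ∀ᵐ y ∂(volume.restrict B), ∀ᵐ x ∂(volume.restrict B), ⟪u x - u y, x - y⟫ = 0 := by
  have hde : ∀ x ∈ B, ∀ y ∈ B, ‖x - y‖ₑ ≤ d := fun x hx y hy => by
    rw [enorm_le_coe]
    exact hd x hx y hy
  have hfin : IsFiniteMeasure (volume.restrict B) := ⟨by simpa using hv.lt_top⟩
  have hmu : Measurable fun p : E (n + 1) × E (n + 1) =>
      ‖⟪u p.2 - u p.1, p.2 - p.1⟫‖ₑ ^ 2 := by fun_prop
  have hbound : ∀ k, ∫⁻ y in B, ∫⁻ x in B, ‖⟪u x - u y, x - y⟫‖ₑ ^ 2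
      ≤ 2 * (d ^ 4 * (volume B * (2 ^ (n + 1) *
            ∫⁻ x in B, ‖symAdd (fderiv ℝ (φ k) x)‖ₑ ^ 2))
        + d ^ 2 * (2 * (2 * (volume B * ∫⁻ x in B, ‖φ k x - u x‖ₑ ^ 2)))) := by
    intro k
    have hφc := (hφ k).continuous
    set e : E (n + 1) → ℝ≥0∞ := fun x => ‖φ k x - u x‖ₑ ^ 2 with he
    have hem : Measurable e := (hφc.measurable.sub hu).enorm.pow_const 2
    set F : E (n + 1) → ℝ≥0∞ := fun x => ‖symAdd (fderiv ℝ (φ k) x)‖ₑ ^ 2 with hF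
    have hFm : Measurable F :=
      (continuous_symAdd.comp ((hφ k).continuous_fderiv (by simp))).enorm.measurable.pow_const 2
    have hFm2 : Measurable fun p : (E (n + 1) × E (n + 1)) × ℝ =>
        F (p.1.1 + p.2 • (p.1.2 - p.1.1)) :=
      hFm.comp (by fun_prop : Continuous fun p : (E (n + 1) × E (n + 1)) × ℝ =>
        p.1.1 + p.2 • (p.1.2 - p.1.1)).measurable
    set J : E (n + 1) → E (n + 1) → ℝ≥0∞ :=
      fun y x => ∫⁻ t in Ioc (0 : ℝ) 1, F (y + t • (x - y)) with hJ
    have hJm : Measurable (Function.uncurry J) := hFm2.lintegral_prod_right'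
    have hpt : ∀ y ∈ B, ∀ x ∈ B, ‖⟪u x - u y, x - y⟫‖ₑ ^ 2
        ≤ 2 * (d ^ 4 * J y x + d ^ 2 * (2 * (e x + e y))) := by
      intro y hy x hx
      -- The first term is controlled by the strain of φ k, the second by its L² distance to u.
      have e0 : ⟪u x - u y, x - y⟫ = ⟪φ k x - φ k y, x - y⟫
          + ⟪(φ k y - u y) - (φ k x - u x), x - y⟫ := by
        rw [← inner_add_left]
        congr 1
        abel
      have hb : ‖⟪(φ k y - u y) - (φ k x - u x), x - y⟫‖ₑ ^ 2 ≤ d ^ 2 * (2 * (e x + e y)) := by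
        calc _ ≤ (((‖φ k y - u y‖ₑ + ‖φ k x - u x‖ₑ)) * d) ^ 2 := by
              gcongr
              refine (enorm_inner_le _ _).trans ?_
              gcongr
              · exact enorm_sub_le
              · exact hde x hx y hy
          _ = d ^ 2 * (‖φ k y - u y‖ₑ + ‖φ k x - u x‖ₑ) ^ 2 := by ring
          _ ≤ d ^ 2 * (2 * (e y + e x)) := by
              gcongr
              exact ennreal_add_sq_le _ _
          _ = _ := by rw [add_comm (e y)]
      have ha : ‖⟪φ k x - φ k y, x - y⟫‖ₑ ^ 2 ≤ d ^ 4 * J y x := by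
        refine (enorm_inner_sub_sq_le (hφ k) x y).trans ?_
        gcongr
        exact hde x hx y hy
      rw [e0]
      calc _ ≤ (‖⟪φ k x - φ k y, x - y⟫‖ₑ + ‖⟪(φ k y - u y) - (φ k x - u x), x - y⟫‖ₑ) ^ 2 := by
            gcongr
            exact enorm_add_le _ _
        _ ≤ _ := (ennreal_add_sq_le _ _).trans (by gcongr)
    calc _ ≤ ∫⁻ y in B, ∫⁻ x in B, 2 * (d ^ 4 * J y x + d ^ 2 * (2 * (e x + e y))) :=
          setLIntegral_mono' hm fun y hy => setLIntegral_mono' hm fun x hx => hpt y hy x hx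
      _ = 2 * (d ^ 4 * (∫⁻ y in B, ∫⁻ x in B, J y x)
            + d ^ 2 * (2 * ((∫⁻ x in B, e x) * volume B + (∫⁻ y in B, e y) * volume B))) := by
          rw [lintegral_lintegral_combination _ hJm hem, Measure.restrict_apply_univ]
      _ ≤ _ := by
          have hsw : ∫⁻ y in B, ∫⁻ x in B, J y x ≤ volume B * (2 ^ (n + 1) * ∫⁻ x in B, F x) := by
            rw [lintegral_lintegral_swap hJm.aemeasurable]
            exact lintegral_lintegral_segment_le hB hm hFm
          have e3 : (∫⁻ x in B, e x) * volume B + (∫⁻ y in B, e y) * volume B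
              = 2 * (volume B * ∫⁻ x in B, e x) := by ring
          rw [e3]
          gcongr
  have hzero : ∫⁻ y in B, ∫⁻ x in B, ‖⟪u x - u y, x - y⟫‖ₑ ^ 2 = 0 := by
    have hlim : Tendsto (fun k => 2 * ((d : ℝ≥0∞) ^ 4 * (volume B * (2 ^ (n + 1) *
            ∫⁻ x in B, ‖symAdd (fderiv ℝ (φ k) x)‖ₑ ^ 2))
        + d ^ 2 * (2 * (2 * (volume B * ∫⁻ x in B, ‖φ k x - u x‖ₑ ^ 2))))) l (𝓝 0) := by
      have c : ∀ {f : ι → ℝ≥0∞} {a : ℝ≥0∞}, a ≠ ⊤ → Tendsto f l (𝓝 0) →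
          Tendsto (fun k => a * f k) l (𝓝 0) := fun ha hf => by
        simpa using ENNReal.Tendsto.const_mul hf (Or.inr ha)
      refine c (by simp) ?_
      rw [← add_zero (0 : ℝ≥0∞)]
      exact (c (by simp) (c hv (c (by simp) h2))).add (c (by simp) (c (by simp) (c (by simp) (c hv h1))))
    exact le_antisymm (ge_of_tendsto' hlim hbound) zero_le
  have hm2 : Measurable fun y => ∫⁻ x in B, ‖⟪u x - u y, x - y⟫‖ₑ ^ 2 := hmu.lintegral_prod_right'
  rw [lintegral_eq_zero_iff hm2] at hzero
  filter_upwards [hzero] with y hy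
  have hy' := (lintegral_eq_zero_iff (hmu.comp measurable_prodMk_left)).1 hy
  filter_upwards [hy'] with x hx
  simpa using hx

lemma affine_eq_of_eqOn_open {B : Set (E (n + 1))} (hB : IsOpen B) (hne : B.Nonempty)
    {L M : E (n + 1) →L[ℝ] E (n + 1)} {b c : E (n + 1)}
    (h : ∀ x ∈ B, L x + b = M x + c) : L = M ∧ b = c := by
  obtain ⟨z, hz⟩ := hne
  have hLM : L = M := by
    ext1 v
    have hc : Continuous fun t : ℝ => z + t • v := by fun_prop
    have h2 : ∀ᶠ t : ℝ in 𝓝[>] 0, z + t • v ∈ B := by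
      have := hc.tendsto 0
      simp only [zero_smul, add_zero] at this
      exact (this.mono_left nhdsWithin_le_nhds) (hB.mem_nhds hz)
    obtain ⟨t, ht, ht0⟩ := (h2.and self_mem_nhdsWithin).exists
    have h3 := h _ ht
    have h4 := h _ hz
    simp only [map_add, map_smul] at h3
    have h5 : t • L v = t • M v := by
      have : t • L v = (L z + t • L v + b) - (L z + b) := by abel
      rw [this, h3, h4]
      abel
    exact smul_right_injective _ (mem_Ioi.1 ht0).ne' h5
  exact ⟨hLM, add_left_cancel (hLM ▸ h z hz)⟩

/-- A field that is locally affine almost everywhere is globally so on a connected open set. -/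
lemma exists_affine_of_locally {Ω : Set (E (n + 1))} (hΩ : IsOpen Ω) (hc : IsConnected Ω)
    {u : E (n + 1) → E (n + 1)}
    (h : ∀ x ∈ Ω, ∃ r > 0, ∃ (L : E (n + 1) →L[ℝ] E (n + 1)) (b : E (n + 1)), symAdd L = 0 ∧
      ∀ᵐ y ∂(volume.restrict (Metric.ball x r)), u y = L y + b) :
    ∃ (L : E (n + 1) →L[ℝ] E (n + 1)) (b : E (n + 1)), symAdd L = 0 ∧
      ∀ᵐ x ∂(volume.restrict Ω), u x = L x + b := by
  obtain ⟨x₀, hx₀⟩ := hc.nonempty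
  obtain ⟨r₀, hr₀, L, b, hL, hLb⟩ := h x₀ hx₀
  refine ⟨L, b, hL, ?_⟩
  set V : Set (E (n + 1)) :=
    {x | ∃ r > 0, ∀ᵐ y ∂(volume.restrict (Metric.ball x r)), u y = L y + b} with hV
  have hVo : IsOpen V := by
    refine Metric.isOpen_iff.2 ?_
    rintro x ⟨r, hr, hx⟩
    refine ⟨r, hr, fun z hz => ⟨r - dist z x, sub_pos.2 hz, ?_⟩⟩
    exact ae_restrict_of_ae_restrict_of_subset
      (Metric.ball_subset_ball' (by linarith)) hx
  have hsub : Ω ⊆ V := by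
    -- V is relatively closed in Ω: two affine maps that agree almost everywhere on a nonempty open
    -- overlap of balls are equal.
    refine hc.isPreconnected.subset_of_closure_inter_subset hVo ⟨x₀, hx₀, r₀, hr₀, hLb⟩ ?_
    rintro x ⟨hxV, hxΩ⟩
    obtain ⟨r, hr, M, c, -, hM⟩ := h x hxΩ
    obtain ⟨z, hzV, hz⟩ := Metric.mem_closure_iff.1 hxV r hr
    obtain ⟨ρ, hρ, hzρ⟩ := hzV
    set W := Metric.ball x r ∩ Metric.ball z ρ
    have hWo : IsOpen W := Metric.isOpen_ball.inter Metric.isOpen_ball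
    have hWne : W.Nonempty := ⟨z, by rwa [Metric.mem_ball'], Metric.mem_ball_self hρ⟩
    have hW : EqOn (fun y => M y + c) (fun y => L y + b) W := by
      refine Measure.eqOn_open_of_ae_eq (μ := volume) ?_ hWo (by fun_prop) (by fun_prop)
      filter_upwards [ae_restrict_of_ae_restrict_of_subset inter_subset_left hM,
        ae_restrict_of_ae_restrict_of_subset inter_subset_right hzρ] with y h1 h2
      rw [← h1, ← h2]
    obtain ⟨rfl, rfl⟩ := affine_eq_of_eqOn_open hWo hWne hW
    exact ⟨r, hr, hM⟩
  rw [ae_restrict_iff' hΩ.measurableSet, ae_iff]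
  refine measure_null_of_locally_null _ fun x hx => ?_
  simp only [Set.mem_ofPred_eq, Classical.not_imp] at hx
  obtain ⟨r, hr, hxr⟩ := hsub hx.1
  refine ⟨_, inter_mem_nhdsWithin _ (Metric.ball_mem_nhds x hr), ?_⟩
  rw [ae_restrict_iff' measurableSet_ball, ae_iff] at hxr
  refine measure_mono_null ?_ hxr
  rintro y ⟨hy, hyr⟩
  simp only [Set.mem_ofPred_eq, Classical.not_imp] at hy ⊢
  exact ⟨hyr, hy.2⟩

/-- A nonzero skew map has rank at least 2. If L z and L(L z) were collinear, then, since skewness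
makes them orthogonal, L(L z) = 0 as soon as L z ≠ 0; but |L z|² = -⟪L(L z), z⟫, so L z = 0 anyway.
-/
lemma finrank_ker_lt {L : E (n + 1) →L[ℝ] E (n + 1)} (hL : symAdd L = 0) (h0 : L ≠ 0) :
    Module.finrank ℝ (LinearMap.ker L.toLinearMap) < n := by
  have h1 := LinearMap.finrank_range_add_finrank_ker L.toLinearMap
  rw [finrank_euclideanSpace, Fintype.card_fin] at h1
  by_contra hlt
  have h2 : Module.finrank ℝ (LinearMap.range L.toLinearMap) ≤ 1 := by omega
  obtain ⟨v, hv⟩ := finrank_le_one_iff.1 h2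
  refine h0 ?_
  ext1 z
  by_contra hz
  obtain ⟨c, hc⟩ := hv ⟨L z, z, rfl⟩
  obtain ⟨c', hc'⟩ := hv ⟨L (L z), L z, rfl⟩
  have hc := congrArg Subtype.val hc
  have hc' := congrArg Subtype.val hc'
  simp only [Submodule.coe_smul] at hc hc'
  have e1 := inner_apply_self_of_symAdd_eq_zero hL (L z) (L z)
  have e2 := inner_apply_self_of_symAdd_eq_zero hL (L z) z
  have e3 : ⟪L (L z), L z⟫ = 0 := by linarith
  rw [← hc', ← hc, inner_smul_left, inner_smul_right] at e3
  simp only [conj_trivial, mul_eq_zero, inner_self_eq_zero] at e3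
  have hz' : L z ≠ 0 := hz
  have hLLz : L (L z) = 0 := by
    rcases e3 with h | h | h
    · rw [← hc', h, zero_smul]
    · rw [h, zero_smul] at hc
      exact (hz' hc.symm).elim
    · rw [h, smul_zero] at hc
      exact (hz' hc.symm).elim
  rw [hLLz, inner_zero_left] at e2
  have : ⟪L z, L z⟫ = 0 := by linarith
  exact hz' (inner_self_eq_zero.1 this)

/-- If L ≠ 0, the zero set of the displacement is contained in an affine subspace of dimension less
than n, negligible for the n-dimensional measure. -/
lemma rigid_eq_zero {Γ : Set (E (n + 1))} (hΓ : (μHE[n] : Measure (E (n + 1))) Γ ≠ 0)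
    {L : E (n + 1) →L[ℝ] E (n + 1)} {b : E (n + 1)} (hL : symAdd L = 0)
    (h : ∀ᵐ x ∂(μHE[n] : Measure (E (n + 1))).restrict Γ, L x + b = 0) : L = 0 ∧ b = 0 := by
  have hΓ' : (ae ((μHE[n] : Measure (E (n + 1))).restrict Γ)).NeBot := by
    rwa [ae_neBot, Ne, Measure.restrict_eq_zero]
  have hL0 : L = 0 := by
    by_contra hne
    obtain ⟨x₀, hx₀⟩ := h.exists
    have hlt := finrank_ker_lt hL hne
    set Z : Set (E (n + 1)) := {x | L x + b = 0} with hZ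
    have hZr : Z ⊆ range fun k : LinearMap.ker L.toLinearMap => (k : E (n + 1)) + x₀ := by
      intro x hx
      refine ⟨⟨x - x₀, ?_⟩, by simp⟩
      have h1 : L x + b = 0 := hx
      simp only [LinearMap.mem_ker, ContinuousLinearMap.coe_coe, map_sub]
      rw [eq_neg_of_add_eq_zero_left h1, eq_neg_of_add_eq_zero_left hx₀, sub_self]
    have hdim : dimH Z < (n : ℝ≥0) := by
      have hlip : LipschitzWith 1 fun k : LinearMap.ker L.toLinearMap => (k : E (n + 1)) + x₀ :=
        LipschitzWith.of_dist_le_mul fun a b => by simp [Subtype.dist_eq]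
      refine ((dimH_mono hZr).trans hlip.dimH_range_le).trans_lt ?_
      rw [Real.dimH_univ_eq_finrank]
      exact_mod_cast hlt
    have h0 : (μHE[n] : Measure (E (n + 1))) Z = 0 := by
      have := hausdorffMeasure_of_dimH_lt hdim
      rw [Measure.euclideanHausdorffMeasure_def, Measure.smul_apply]
      simp only [NNReal.coe_natCast] at this
      rw [this, smul_zero]
    obtain ⟨x, hx, hx'⟩ := (h.and (ae_restrict_of_ae (measure_eq_zero_iff_ae_notMem.1 h0))).exists
    exact hx' hx
  refine ⟨hL0, ?_⟩
  obtain ⟨x, hx⟩ := h.exists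
  simpa [hL0] using hx

end KornFirst

/-! ### Rellich's theorem along an ultrafilter, and Korn's first inequality. -/

section KornFirst

variable {n : ℕ} {Ω : Set (E (n + 1))}

lemma eLpNorm_two_sq {α F : Type*} [MeasurableSpace α] [NormedAddCommGroup F] (μ : Measure α)
    (f : α → F) : eLpNorm f 2 μ ^ 2 = ∫⁻ x, ‖f x‖ₑ ^ 2 ∂μ := by
  have h := eLpNorm_nnreal_pow_eq_lintegral (μ := μ) (f := f) (p := 2) two_ne_zero
  simpa using h

lemma lintegral_add_sq_le {α F : Type*} [MeasurableSpace α] [NormedAddCommGroup F] (μ : Measure α)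
    {f : α → F} (hf : AEStronglyMeasurable f μ) (g : α → F) :
    ∫⁻ x, ‖f x + g x‖ₑ ^ 2 ∂μ ≤ 2 * ((∫⁻ x, ‖f x‖ₑ ^ 2 ∂μ) + ∫⁻ x, ‖g x‖ₑ ^ 2 ∂μ) := by
  have hm : AEMeasurable (fun x => ‖f x‖ₑ ^ 2) μ := hf.enorm.pow_const 2
  rw [← lintegral_add_left' hm, ← lintegral_const_mul' _ _ (by simp)]
  refine lintegral_mono fun x => (pow_le_pow_left₀ zero_le (enorm_add_le _ _) 2).trans
    (ennreal_add_sq_le _ _)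

lemma lintegral_sub_sq_le' {α F : Type*} [MeasurableSpace α] [NormedAddCommGroup F] (μ : Measure α)
    {f : α → F} (hf : AEStronglyMeasurable f μ) (g : α → F) :
    ∫⁻ x, ‖f x - g x‖ₑ ^ 2 ∂μ ≤ 2 * ((∫⁻ x, ‖f x‖ₑ ^ 2 ∂μ) + ∫⁻ x, ‖g x‖ₑ ^ 2 ∂μ) := by
  simpa [sub_eq_add_neg] using lintegral_add_sq_le μ hf (fun x => -g x)

lemma sqH1_sub_le {φ ψ : E (n + 1) → E (n + 1)} (hφ : ContDiff ℝ ∞ φ) (hψ : ContDiff ℝ ∞ ψ) :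
    sqH1 Ω (fun x => φ x - ψ x) ≤ 2 * (sqH1 Ω φ + sqH1 Ω ψ) := by
  have e : ∀ x, fderiv ℝ (fun x => φ x - ψ x) x = fderiv ℝ φ x - fderiv ℝ ψ x := fun x =>
    fderiv_fun_sub (hφ.differentiable (by simp) x) (hψ.differentiable (by simp) x)
  have h1 := lintegral_sub_sq_le' (volume.restrict Ω) hφ.continuous.aestronglyMeasurable ψ
  have h2 := lintegral_sub_sq_le' (volume.restrict Ω)
    (hφ.continuous_fderiv (by simp)).aestronglyMeasurable (fderiv ℝ ψ)
  unfold sqH1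
  simp only [e]
  refine (add_le_add h1 h2).trans_eq ?_
  ring

/-- A sequence of smooth fields that is bounded in `H¹` has a limit in `L²` along any ultrafilter. -/
lemma exists_tendsto_of_sqH1_le (hΩo : IsOpen Ω) (hΩb : Bornology.IsBounded Ω) (hΩ : IsC11 Ω)
    {ι : Type*} (l : Ultrafilter ι) {φ : ι → E (n + 1) → E (n + 1)}
    (hφ : ∀ k, ContDiff ℝ ∞ (φ k)) (hc : ∀ k, HasCompactSupport (φ k))
    (h1 : ∀ k, sqH1 Ω (φ k) ≤ 1) :
    ∃ u : E (n + 1) → E (n + 1), Measurable u ∧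
      Tendsto (fun k => ∫⁻ x in Ω, ‖φ k x - u x‖ₑ ^ 2) l (𝓝 0) := by
  have hvol : volume Ω ≠ ⊤ := hΩb.measure_lt_top.ne
  have hint : ∀ k (Q : Set (E (n + 1))), IntegrableOn (φ k) Q := fun k Q =>
    ((hφ k).continuous.integrable_of_hasCompactSupport (hc k)).integrableOn
  -- The averages stay in a compact ball. The ultrafilter makes all of them converge at once, in
  -- place of a diagonal extraction.
  have havg : ∀ Q ⊆ Ω, ∃ m, Tendsto (fun k => ∫ x in Q, φ k x) l (𝓝 m) := by
    intro Q hQ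
    have hb : ∀ k, (∫ x in Q, φ k x) ∈ Metric.closedBall (0 : E (n + 1))
        (Real.sqrt (volume Ω).toReal) := by
      intro k
      have e1 : ‖∫ x in Q, φ k x‖ₑ ^ 2 ≤ volume Ω := by
        calc ‖∫ x in Q, φ k x‖ₑ ^ 2 ≤ (∫⁻ x in Ω, ‖φ k x‖ₑ) ^ 2 := by
              gcongr
              exact (enorm_integral_le_lintegral_enorm _).trans (lintegral_mono_set hQ)
          _ ≤ volume Ω * ∫⁻ x in Ω, ‖φ k x‖ₑ ^ 2 := by
              have := sq_lintegral_le (volume.restrict Ω)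
                ((hφ k).continuous.enorm.measurable.aemeasurable)
              simpa using this
          _ ≤ volume Ω * 1 := by
              gcongr
              exact le_self_add.trans (h1 k)
          _ = _ := mul_one _
      rw [enorm_sq_eq_ofReal] at e1
      rw [mem_closedBall_zero_iff]
      refine Real.le_sqrt_of_sq_le ?_
      exact (ENNReal.ofReal_le_iff_le_toReal hvol).1 e1
    obtain ⟨m, -, hm⟩ := (isCompact_closedBall (0 : E (n + 1)) _).ultrafilter_le_nhds'
      (l.map fun k => ∫ x in Q, φ k x) (Filter.mem_map.2 (univ_mem' hb))
    exact ⟨m, hm⟩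
  have hcauchy : Tendsto (fun p : ι × ι => ∫⁻ x in Ω, ‖φ p.1 x - φ p.2 x‖ₑ ^ 2)
      ((l : Filter ι) ×ˢ l) (𝓝 0) := by
    refine ENNReal.tendsto_nhds_zero.2 fun ε hε => ?_
    -- The number 4 bounds the squared H¹ norm of a difference of two members of the family.
    obtain ⟨η, hη, hηε⟩ : ∃ η : ℝ≥0, 0 < η ∧ (η : ℝ≥0∞) * 4 ≤ ε / 2 := by
      obtain ⟨η, hη, hη'⟩ := ENNReal.lt_iff_exists_nnreal_btwn.1
        (show (0 : ℝ≥0∞) < ε / 2 / 4 from ENNReal.div_pos (ENNReal.half_pos hε.ne').ne' (by simp))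
      refine ⟨η, by exact_mod_cast hη, ?_⟩
      exact (ENNReal.le_div_iff_mul_le (by simp) (by simp)).1 hη'.le
    obtain ⟨T, Q, C, hQ, hT⟩ := lintegral_sq_le_averages hΩo hΩb hΩ hη
    have hlim : Tendsto (fun p : ι × ι => (C : ℝ≥0∞) *
        ∑ k ∈ T, ‖(∫ x in Q k, φ p.1 x) - ∫ x in Q k, φ p.2 x‖ₑ ^ 2)
        ((l : Filter ι) ×ˢ l) (𝓝 0) := by
      have : Tendsto (fun p : ι × ι =>
          ∑ k ∈ T, ‖(∫ x in Q k, φ p.1 x) - ∫ x in Q k, φ p.2 x‖ₑ ^ 2)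
          ((l : Filter ι) ×ˢ l) (𝓝 (∑ k ∈ T, 0)) := by
        refine tendsto_finsetSum _ fun k hk => ?_
        obtain ⟨m, hm⟩ := havg (Q k) (hQ k hk)
        have h2 := ENNReal.Tendsto.pow (n := 2)
          ((hm.comp tendsto_fst).sub (hm.comp (tendsto_snd (f := (l : Filter ι))))).enorm
        simpa using h2
      have := ENNReal.Tendsto.const_mul this (Or.inr (ENNReal.coe_ne_top (r := C)))
      simpa using this
    filter_upwards [ENNReal.tendsto_nhds_zero.1 hlim (ε / 2) (ENNReal.half_pos hε.ne')] with p hp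
    have h3 := hT (fun x => φ p.1 x - φ p.2 x) ((hφ _).sub (hφ _)) ((hc _).sub (hc _))
    have h4 : sqH1 Ω (fun x => φ p.1 x - φ p.2 x) ≤ 4 := by
      refine (sqH1_sub_le (hφ _) (hφ _)).trans ?_
      calc 2 * (sqH1 Ω (φ p.1) + sqH1 Ω (φ p.2)) ≤ 2 * (1 + 1) := by
            gcongr <;> exact h1 _
        _ = 4 := by norm_num
    have h5 : ∀ k, ∫ x in Q k, (φ p.1 x - φ p.2 x)
        = (∫ x in Q k, φ p.1 x) - ∫ x in Q k, φ p.2 x := fun k =>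
      integral_sub (hint _ _) (hint _ _)
    simp only [h5] at h3
    calc _ ≤ _ := h3
      _ ≤ ε / 2 + ε / 2 := by
          refine add_le_add (le_trans ?_ hηε) hp
          gcongr
      _ = ε := ENNReal.add_halves ε
  have hmem : ∀ k, MemLp (φ k) 2 (volume.restrict Ω) := fun k =>
    ((hφ k).continuous.memLp_of_hasCompactSupport (μ := volume) (hc k)).restrict Ω
  set f : ι → Lp (E (n + 1)) 2 (volume.restrict Ω) := fun k => (hmem k).toLp (φ k) with hf
  have hed : ∀ i j, edist (f i) (f j) ^ 2 = ∫⁻ x in Ω, ‖φ i x - φ j x‖ₑ ^ 2 := fun i j => by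
    rw [hf, Lp.edist_toLp_toLp, eLpNorm_two_sq]
    rfl
  have hC : Cauchy (Filter.map f l) := by
    rw [cauchy_map_iff]
    refine ⟨inferInstance, uniformity_basis_edist.tendsto_right_iff.2 fun ε hε => ?_⟩
    have h6 := (tendsto_order.1 hcauchy).2 (ε ^ 2) (pos_iff_ne_zero.2 (pow_ne_zero 2 hε.ne'))
    filter_upwards [h6] with p hp
    rw [← hed] at hp
    exact lt_of_not_ge fun h => hp.not_ge (pow_le_pow_left₀ zero_le h 2)
  obtain ⟨u, hu⟩ := CompleteSpace.complete hC
  refine ⟨u, (Lp.stronglyMeasurable u).measurable, ?_⟩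
  have h7 := ENNReal.Tendsto.pow (n := 2)
    ((tendsto_iff_edist_tendsto_0.1 (show Tendsto f l (𝓝 u) from hu)))
  have h8 : ∀ k, edist (f k) u ^ 2 = ∫⁻ x in Ω, ‖φ k x - u x‖ₑ ^ 2 := fun k => by
    conv_lhs => rw [← Lp.toLp_coeFn u (Lp.memLp u)]
    rw [hf, Lp.edist_toLp_toLp, eLpNorm_two_sq]
    rfl
  simpa [h8] using h7

lemma exists_cutoff (hΩb : Bornology.IsBounded Ω) : ∃ (χ : E (n + 1) → ℝ) (R : ℝ),
    ContDiff ℝ ∞ χ ∧ HasCompactSupport χ ∧ closure Ω ⊆ Metric.ball 0 R ∧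
      ∀ x ∈ Metric.ball (0 : E (n + 1)) R, χ x = 1 := by
  obtain ⟨R, hR⟩ := hΩb.closure.subset_ball (0 : E (n + 1))
  have hpos : 0 < max R 1 := by positivity
  let χ : ContDiffBump (0 : E (n + 1)) := ⟨max R 1, max R 1 + 1, hpos, by linarith⟩
  exact ⟨χ, max R 1, χ.contDiff, χ.hasCompactSupport,
    hR.trans (Metric.ball_subset_ball (le_max_left _ _)),
    fun x hx => χ.one_of_mem_closedBall (Metric.ball_subset_closedBall hx)⟩

/-- The inequalities above are stated for compactly supported fields; a cutoff equal to 1 around Ω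
lets them apply after subtraction of a rigid displacement. -/
lemma exists_smooth_eq_affine (hΩb : Bornology.IsBounded Ω) (L : E (n + 1) →L[ℝ] E (n + 1))
    (b : E (n + 1)) : ∃ ψ : E (n + 1) → E (n + 1), ContDiff ℝ ∞ ψ ∧ HasCompactSupport ψ ∧
      ∀ x ∈ closure Ω, ψ x = L x + b ∧ fderiv ℝ ψ x = L := by
  obtain ⟨χ, R, hχ, hχc, hR, h1⟩ := exists_cutoff hΩb
  refine ⟨fun x => χ x • (L x + b), hχ.smul (by fun_prop), hχc.smul_right, fun x hx => ?_⟩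
  refine ⟨by simp [h1 x (hR hx)], ?_⟩
  have : (fun x => χ x • (L x + b)) =ᶠ[𝓝 x] fun x => L x + b := by
    filter_upwards [Metric.isOpen_ball.mem_nhds (hR hx)] with y hy
    rw [h1 y hy, one_smul]
  rw [this.fderiv_eq, fderiv_add_const]
  exact L.fderiv

lemma sqH1_lt_top {φ : E (n + 1) → E (n + 1)} (hφ : ContDiff ℝ ∞ φ) (hc : HasCompactSupport φ) :
    sqH1 Ω φ < ⊤ := by
  have key : ∀ {F : Type _} [NormedAddCommGroup F] {f : E (n + 1) → F}, Continuous f →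
      HasCompactSupport f → ∫⁻ x in Ω, ‖f x‖ₑ ^ 2 < ⊤ := by
    intro F _ f hf hfc
    have := (hf.memLp_of_hasCompactSupport (p := 2) (μ := volume) hfc).restrict Ω
    rw [← eLpNorm_two_sq]
    exact ENNReal.pow_lt_top this.2
  exact ENNReal.add_lt_top.2 ⟨key hφ.continuous hc, key (hφ.continuous_fderiv (by simp))
    (hc.fderiv ℝ)⟩

lemma lintegral_enorm_smul_sq {α F : Type*} [MeasurableSpace α] [SeminormedAddCommGroup F]
    [NormedSpace ℝ F] (μ : Measure α) (c : ℝ) (f : α → F) :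
    ∫⁻ x, ‖c • f x‖ₑ ^ 2 ∂μ = ‖c‖ₑ ^ 2 * ∫⁻ x, ‖f x‖ₑ ^ 2 ∂μ := by
  rw [← lintegral_const_mul' _ _ (by simp)]
  simp only [enorm_smul, mul_pow]

lemma sqH1_smul {φ : E (n + 1) → E (n + 1)} (hφ : ContDiff ℝ ∞ φ) (c : ℝ) :
    sqH1 Ω (fun x => c • φ x) = ‖c‖ₑ ^ 2 * sqH1 Ω φ := by
  have e1 : ∀ x, fderiv ℝ (fun x => c • φ x) x = c • fderiv ℝ φ x := fun x =>
    fderiv_const_smul (hφ.differentiable (by simp) x) c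
  simp only [sqH1, e1]
  rw [lintegral_enorm_smul_sq, mul_add]
  congr 1
  exact lintegral_enorm_smul_sq (F := E (n + 1) →L[ℝ] E (n + 1)) _ c _

lemma lintegral_symAdd_smul {φ : E (n + 1) → E (n + 1)} (hφ : ContDiff ℝ ∞ φ) (c : ℝ) :
    ∫⁻ x in Ω, ‖symAdd (fderiv ℝ (fun x => c • φ x) x)‖ₑ ^ 2
      = ‖c‖ₑ ^ 2 * ∫⁻ x in Ω, ‖symAdd (fderiv ℝ φ x)‖ₑ ^ 2 := by
  have e1 : ∀ x, fderiv ℝ (fun x => c • φ x) x = c • fderiv ℝ φ x := fun x =>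
    fderiv_const_smul (hφ.differentiable (by simp) x) c
  simp only [e1, symAdd_smul]
  exact lintegral_enorm_smul_sq (F := E (n + 1) →L[ℝ] E (n + 1)) _ c _

/-- Korn's first inequality for smooth fields that are small on a part of the boundary of positive
measure. -/
lemma korn_first (hΩo : IsOpen Ω) (hΩb : Bornology.IsBounded Ω) (hΩ : IsC11 Ω)
    (hΩc : IsConnected Ω) {Γ : Set (E (n + 1))} (hΓ : Γ ⊆ frontier Ω)
    (hΓ0 : (μHE[n] : Measure (E (n + 1))) Γ ≠ 0) :
    ∃ C : ℝ≥0, ∀ φ : E (n + 1) → E (n + 1), ContDiff ℝ ∞ φ → HasCompactSupport φ →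
      sqH1 Ω φ ≤ C * ((∫⁻ x in Ω, ‖symAdd (fderiv ℝ φ x)‖ₑ ^ 2)
        + ∫⁻ x in Γ, ‖φ x‖ₑ ^ 2 ∂(μHE[n] : Measure (E (n + 1)))) := by
  by_contra! hcon
  -- A counterexample to the constant k, rescaled to unit H¹ norm.
  have hseq : ∀ k : ℕ, ∃ φ : E (n + 1) → E (n + 1), ContDiff ℝ ∞ φ ∧ HasCompactSupport φ ∧
      sqH1 Ω φ = 1 ∧ (k : ℝ≥0∞) * ((∫⁻ x in Ω, ‖symAdd (fderiv ℝ φ x)‖ₑ ^ 2)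
        + ∫⁻ x in Γ, ‖φ x‖ₑ ^ 2 ∂(μHE[n] : Measure (E (n + 1)))) ≤ 1 := by
    intro k
    obtain ⟨φ, hφ, hc, hlt⟩ := hcon k
    have hfin := sqH1_lt_top (Ω := Ω) hφ hc
    have hpos : sqH1 Ω φ ≠ 0 := (pos_of_gt hlt).ne'
    obtain ⟨c, hcsq⟩ : ∃ c : ℝ, ‖c‖ₑ ^ 2 = (sqH1 Ω φ)⁻¹ := by
      refine ⟨(Real.sqrt (sqH1 Ω φ).toReal)⁻¹, ?_⟩
      rw [enorm_sq_eq_ofReal, norm_inv, inv_pow, Real.norm_eq_abs, sq_abs,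
        Real.sq_sqrt ENNReal.toReal_nonneg,
        ENNReal.ofReal_inv_of_pos (ENNReal.toReal_pos hpos hfin.ne), ENNReal.ofReal_toReal hfin.ne]
    refine ⟨fun x => c • φ x, hφ.const_smul c, hc.mono fun x hx => ?_, ?_, ?_⟩
    · exact fun h => hx (by simp [h])
    · rw [sqH1_smul hφ, hcsq]
      exact ENNReal.inv_mul_cancel hpos hfin.ne
    · rw [lintegral_symAdd_smul hφ, lintegral_enorm_smul_sq, hcsq, ← mul_add, mul_left_comm]
      calc _ ≤ (sqH1 Ω φ)⁻¹ * sqH1 Ω φ := by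
            gcongr
            exact_mod_cast hlt.le
        _ = 1 := ENNReal.inv_mul_cancel hpos hfin.ne
  choose φ hφ hφc hφ1 hφk using hseq
  set l : Ultrafilter ℕ := hyperfilter ℕ with hl
  have hlat : (l : Filter ℕ) ≤ atTop := by
    rw [hl, ← Nat.cofinite_eq_atTop]
    exact hyperfilter_le_cofinite
  have hR : Tendsto (fun k => (∫⁻ x in Ω, ‖symAdd (fderiv ℝ (φ k) x)‖ₑ ^ 2)
        + ∫⁻ x in Γ, ‖φ k x‖ₑ ^ 2 ∂(μHE[n] : Measure (E (n + 1)))) l (𝓝 0) := by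
    refine tendsto_of_tendsto_of_tendsto_of_le_of_le tendsto_const_nhds
      (ENNReal.tendsto_inv_nat_nhds_zero.mono_left hlat) (fun _ => zero_le) fun k => ?_
    rw [← one_div]
    rcases Nat.eq_zero_or_pos k with rfl | hk
    · simp
    · exact (ENNReal.le_div_iff_mul_le (Or.inl (by positivity)) (Or.inl (by simp))).2
        (by rw [mul_comm]; exact hφk k)
  have hR1 : Tendsto (fun k => ∫⁻ x in Ω, ‖symAdd (fderiv ℝ (φ k) x)‖ₑ ^ 2) l (𝓝 0) :=
    tendsto_of_tendsto_of_tendsto_of_le_of_le tendsto_const_nhds hR (fun _ => zero_le)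
      fun k => le_self_add
  have hR2 : Tendsto (fun k => ∫⁻ x in Γ, ‖φ k x‖ₑ ^ 2 ∂(μHE[n] : Measure (E (n + 1)))) l (𝓝 0) :=
    tendsto_of_tendsto_of_tendsto_of_le_of_le tendsto_const_nhds hR (fun _ => zero_le)
      fun k => le_add_self
  obtain ⟨u, hum, hu⟩ := exists_tendsto_of_sqH1_le hΩo hΩb hΩ l hφ hφc fun k => (hφ1 k).le
  obtain ⟨L, b, hL, huL⟩ : ∃ (L : E (n + 1) →L[ℝ] E (n + 1)) (b : E (n + 1)), symAdd L = 0 ∧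
      ∀ᵐ x ∂(volume.restrict Ω), u x = L x + b := by
    refine exists_affine_of_locally hΩo hΩc fun x hx => ?_
    obtain ⟨r, hr, hrΩ⟩ := Metric.isOpen_iff.1 hΩo x hx
    refine ⟨r, hr, exists_rigid_of_inner_eq_zero Metric.isOpen_ball (Metric.nonempty_ball.2 hr) ?_⟩
    refine inner_sub_eq_zero_of_tendsto (l := (l : Filter ℕ)) (convex_ball x r) measurableSet_ball
      (d := (2 * r).toNNReal) (fun y hy z hz => ?_) measure_ball_lt_top.ne hφ hum ?_ ?_
    · rw [Real.coe_toNNReal _ (by positivity), ← dist_eq_norm]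
      have := dist_triangle_right y z x
      linarith [Metric.mem_ball.1 hy, Metric.mem_ball.1 hz]
    · exact tendsto_of_tendsto_of_tendsto_of_le_of_le tendsto_const_nhds hu (fun _ => zero_le)
        fun k => lintegral_mono_set hrΩ
    · exact tendsto_of_tendsto_of_tendsto_of_le_of_le tendsto_const_nhds hR1 (fun _ => zero_le)
        fun k => lintegral_mono_set hrΩ
  obtain ⟨ψ, hψ, hψc, hψL⟩ := exists_smooth_eq_affine hΩb L b
  set w : ℕ → E (n + 1) → E (n + 1) := fun k x => φ k x - ψ x with hw
  have hws : ∀ k, ContDiff ℝ ∞ (w k) := fun k => (hφ k).sub hψ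
  have hwc : ∀ k, HasCompactSupport (w k) := fun k => (hφc k).sub hψc
  have hw1 : Tendsto (fun k => ∫⁻ x in Ω, ‖w k x‖ₑ ^ 2) l (𝓝 0) := by
    refine hu.congr fun k => lintegral_congr_ae ?_
    filter_upwards [huL, ae_restrict_mem hΩo.measurableSet] with x hx hxΩ
    simp only [hw, hx, (hψL x (subset_closure hxΩ)).1]
  have hw2 : ∀ k, ∫⁻ x in Ω, ‖symAdd (fderiv ℝ (w k) x)‖ₑ ^ 2
      = ∫⁻ x in Ω, ‖symAdd (fderiv ℝ (φ k) x)‖ₑ ^ 2 := by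
    intro k
    refine setLIntegral_congr_fun hΩo.measurableSet fun x hx => ?_
    change ‖symAdd (fderiv ℝ (fun x => φ k x - ψ x) x)‖ₑ ^ 2 = _
    rw [fderiv_fun_sub ((hφ k).differentiable (by simp) x) (hψ.differentiable (by simp) x),
      (hψL x (subset_closure hx)).2, symAdd_sub, hL, sub_zero]
  obtain ⟨C, hC⟩ := korn_second hΩo hΩb hΩ
  -- Subtracting the rigid limit does not change the strain, so Korn's second inequality upgrades
  -- the L² convergence to H¹ convergence.
  have hwH : Tendsto (fun k => sqH1 Ω (w k)) l (𝓝 0) := by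
    have hlim : Tendsto (fun k => (∫⁻ x in Ω, ‖w k x‖ₑ ^ 2)
        + C * ((∫⁻ x in Ω, ‖symAdd (fderiv ℝ (φ k) x)‖ₑ ^ 2)
          + ∫⁻ x in Ω, ‖w k x‖ₑ ^ 2)) l (𝓝 0) := by
      have := hw1.add (ENNReal.Tendsto.const_mul (hR1.add hw1)
        (Or.inr (ENNReal.coe_ne_top (r := C))))
      simpa using this
    refine tendsto_of_tendsto_of_tendsto_of_le_of_le tendsto_const_nhds hlim (fun _ => zero_le)
      fun k => ?_
    have := hC (w k) (hws k) (hwc k)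
    rw [hw2] at this
    exact add_le_add le_rfl this
  obtain ⟨C', hC'⟩ := lintegral_frontier_sq_le hΩo hΩb hΩ
  -- On Γ, ψ is φ k - w k: the first tends to zero by construction, the second by the trace
  -- inequality.
  have hψΓ : ∫⁻ x in Γ, ‖ψ x‖ₑ ^ 2 ∂(μHE[n] : Measure (E (n + 1))) = 0 := by
    have hlim : Tendsto (fun k => 2 * ((∫⁻ x in Γ, ‖φ k x‖ₑ ^ 2 ∂(μHE[n] : Measure (E (n + 1))))
        + C' * sqH1 Ω (w k))) l (𝓝 0) := by
      have := ENNReal.Tendsto.const_mul (a := 2) (hR2.add (ENNReal.Tendsto.const_mul hwH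
        (Or.inr (ENNReal.coe_ne_top (r := C'))))) (Or.inr (by simp))
      simpa using this
    refine le_antisymm (ge_of_tendsto' hlim fun k => ?_) zero_le
    have h1 := lintegral_sub_sq_le' ((μHE[n] : Measure (E (n + 1))).restrict Γ)
      (hφ k).continuous.aestronglyMeasurable (w k)
    simp only [hw, sub_sub_cancel] at h1
    refine h1.trans ?_
    gcongr
    exact (lintegral_mono_set hΓ).trans (hC' (w k) (hws k))
  have hzero : L = 0 ∧ b = 0 := by
    refine rigid_eq_zero hΓ0 hL ?_
    have h2 := (lintegral_eq_zero_iff (hψ.continuous.enorm.measurable.pow_const 2)).1 hψΓ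
    have h3 : ∀ᵐ x ∂(μHE[n] : Measure (E (n + 1))).restrict Γ, x ∈ frontier Ω :=
      (ae_mono (Measure.restrict_mono hΓ le_rfl)) (ae_restrict_mem isClosed_frontier.measurableSet)
    filter_upwards [h2, h3] with x hx hxf
    have : ψ x = 0 := by simpa using hx
    rwa [(hψL x (frontier_subset_closure hxf)).1] at this
  -- The rigid limit being zero, w k coincides with φ k on Ω and keeps unit norm, against its
  -- convergence to zero.
  have hsame : ∀ k, sqH1 Ω (w k) = 1 := by
    intro k
    rw [← hφ1 k, sqH1, sqH1]
    congr 1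
    · refine setLIntegral_congr_fun hΩo.measurableSet fun x hx => ?_
      simp [hw, (hψL x (subset_closure hx)).1, hzero]
    · refine setLIntegral_congr_fun hΩo.measurableSet fun x hx => ?_
      change ‖fderiv ℝ (fun x => φ k x - ψ x) x‖ₑ ^ 2 = _
      rw [fderiv_fun_sub ((hφ k).differentiable (by simp) x) (hψ.differentiable (by simp) x),
        (hψL x (subset_closure hx)).2, hzero.1, sub_zero]
  simp only [hsame] at hwH
  exact one_ne_zero (tendsto_nhds_unique hwH tendsto_const_nhds).symm

end KornFirst

/-! ### Algebra of strains and gradient matrices. -/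

section Strain

variable {N : ℕ}

lemma symPart_apply (G : Mat N) (i j : Fin N) :
    (symPart G : Mat N) (i, j) = (G (i, j) + G (j, i)) / 2 := rfl

lemma symPart_add (G H : Mat N) : symPart (G + H) = symPart G + symPart H := by
  ext ⟨i, j⟩
  simp only [Submodule.coe_add, PiLp.add_apply, symPart_apply]
  ring

lemma symPart_neg (G : Mat N) : symPart (-G) = -symPart G := by
  ext ⟨i, j⟩
  simp only [Submodule.coe_neg, PiLp.neg_apply, symPart_apply]
  ring

lemma symPart_sub (G H : Mat N) : symPart (G - H) = symPart G - symPart H := by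
  rw [sub_eq_add_neg, symPart_add, symPart_neg, sub_eq_add_neg]

lemma norm_mat_sq (G : Mat N) : ‖G‖ ^ 2 = ∑ i, ∑ j, G (i, j) ^ 2 := by
  rw [EuclideanSpace.norm_sq_eq, Fintype.sum_prod_type]
  simp

lemma norm_symPart_le (G : Mat N) : ‖symPart G‖ ≤ ‖G‖ := by
  refine le_of_sq_le_sq ?_ (norm_nonneg _)
  rw [Submodule.coe_norm, norm_mat_sq, norm_mat_sq]
  have h1 : ∑ i, ∑ j, (symPart G : Mat N) (i, j) ^ 2
      ≤ ∑ i, ∑ j, (G (i, j) ^ 2 / 2 + G (j, i) ^ 2 / 2) := by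
    gcongr with i _ j _
    rw [symPart_apply]
    nlinarith [sq_nonneg (G (i, j) - G (j, i))]
  refine h1.trans_eq ?_
  simp only [Finset.sum_add_distrib]
  rw [Finset.sum_comm (f := fun i j => G (j, i) ^ 2 / 2), ← Finset.sum_add_distrib]
  refine Finset.sum_congr rfl fun i _ => ?_
  rw [← Finset.sum_add_distrib]
  exact Finset.sum_congr rfl fun j _ => by ring

lemma continuous_symPart : Continuous (symPart (N := N)) := by
  refine Continuous.subtype_mk ?_ _
  refine (PiLp.continuous_toLp 2 _).comp (continuous_pi fun p => ?_)
  fun_prop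

lemma gradMat_apply (φ : E N → E N) (x : E N) (i j : Fin N) :
    gradMat φ x (i, j) = fderiv ℝ φ x (EuclideanSpace.single j 1) i := rfl

lemma gradMat_add {φ ψ : E N → E N} (hφ : ContDiff ℝ ∞ φ) (hψ : ContDiff ℝ ∞ ψ) (x : E N) :
    gradMat (fun x => φ x + ψ x) x = gradMat φ x + gradMat ψ x := by
  ext ⟨i, j⟩
  rw [PiLp.add_apply, gradMat_apply, gradMat_apply, gradMat_apply,
    fderiv_fun_add (hφ.differentiable (by simp) x) (hψ.differentiable (by simp) x)]
  simp

lemma gradMat_neg (φ : E N → E N) (x : E N) : gradMat (fun x => -φ x) x = -gradMat φ x := by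
  ext ⟨i, j⟩
  rw [PiLp.neg_apply, gradMat_apply, gradMat_apply, fderiv_fun_neg]
  simp

lemma continuous_gradMat {φ : E N → E N} (hφ : ContDiff ℝ ∞ φ) : Continuous (gradMat φ) := by
  have h := hφ.continuous_fderiv (by simp)
  refine (PiLp.continuous_toLp 2 _).comp (continuous_pi fun p => ?_)
  have h2 : Continuous fun x => fderiv ℝ φ x (EuclideanSpace.single p.2 1) :=
    h.clm_apply continuous_const
  fun_prop

end Strain

/-! ### Comparison of operator norms with Frobenius norms. -/

section Constants

variable {n : ℕ}

lemma inner_single_basis (L : E (n + 1) →L[ℝ] E (n + 1)) (i j : Fin (n + 1)) :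
    ⟪L (EuclideanSpace.basisFun (Fin (n + 1)) ℝ j), EuclideanSpace.basisFun (Fin (n + 1)) ℝ i⟫
      = L (EuclideanSpace.single j 1) i := by
  simp [EuclideanSpace.inner_single_right]

lemma norm_fderiv_le_gradMat (φ : E (n + 1) → E (n + 1)) (x : E (n + 1)) :
    ‖fderiv ℝ φ x‖ ≤ ‖gradMat φ x‖ := by
  refine le_of_sq_le_sq ?_ (norm_nonneg _)
  refine (norm_sq_le_sum_inner_sq (EuclideanSpace.basisFun _ ℝ) _).trans_eq ?_
  rw [norm_mat_sq]
  simp only [inner_single_basis, gradMat_apply]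

lemma norm_gradMat_sq_le (φ : E (n + 1) → E (n + 1)) (x : E (n + 1)) :
    ‖gradMat φ x‖ ^ 2 ≤ (n + 1) * ‖fderiv ℝ φ x‖ ^ 2 := by
  rw [norm_mat_sq, Finset.sum_comm]
  have h : ∀ j, ∑ i, gradMat φ x (i, j) ^ 2 ≤ ‖fderiv ℝ φ x‖ ^ 2 := fun j => by
    have h1 := (fderiv ℝ φ x).le_opNorm (EuclideanSpace.single j 1)
    have h2 : ‖fderiv ℝ φ x (EuclideanSpace.single j 1)‖ ^ 2 ≤ ‖fderiv ℝ φ x‖ ^ 2 := by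
      gcongr
      simpa using h1
    rw [EuclideanSpace.norm_sq_eq] at h2
    simpa [gradMat_apply] using h2
  refine (Finset.sum_le_sum fun j _ => h j).trans_eq ?_
  simp

/-- The operator norm is at most the Frobenius norm, and `symAdd` is twice the symmetric part. -/
lemma norm_symAdd_fderiv_le (φ : E (n + 1) → E (n + 1)) (x : E (n + 1)) :
    ‖symAdd (fderiv ℝ φ x)‖ ≤ 2 * ‖symPart (gradMat φ x)‖ := by
  refine le_of_sq_le_sq ?_ (by positivity)
  refine (norm_sq_le_sum_inner_sq (EuclideanSpace.basisFun _ ℝ) _).trans_eq ?_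
  rw [mul_pow, Submodule.coe_norm, norm_mat_sq, Finset.mul_sum]
  refine Finset.sum_congr rfl fun i _ => ?_
  rw [Finset.mul_sum]
  refine Finset.sum_congr rfl fun j _ => ?_
  rw [inner_symAdd, inner_single_basis, inner_single_basis, symPart_apply, gradMat_apply,
    gradMat_apply]
  ring

end Constants

/-! ### Linearity of H^{1/2} and of traces. -/

section Trace

variable {N : ℕ} {Γ : Set (E N)} {F : Type*} [NormedAddCommGroup F]

lemma MemHHalf.add {φ ψ : E N → F} (hφ : MemHHalf Γ φ) (hψ : MemHHalf Γ ψ) :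
    MemHHalf Γ fun x => φ x + ψ x := by
  refine ⟨hφ.1.add hψ.1, ?_⟩
  convert hφ.2.add hψ.2 using 2 with z
  simp only [Pi.add_apply]
  abel

lemma MemHHalf.neg {φ : E N → F} (hφ : MemHHalf Γ φ) : MemHHalf Γ fun x => -φ x := by
  refine ⟨hφ.1.neg, ?_⟩
  convert hφ.2.neg using 2 with z
  simp only [Pi.neg_apply]
  abel

lemma MemHHalf.sub {φ ψ : E N → F} (hφ : MemHHalf Γ φ) (hψ : MemHHalf Γ ψ) :
    MemHHalf Γ fun x => φ x - ψ x := by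
  simpa [sub_eq_add_neg] using hφ.add hψ.neg

lemma MemHHalf.congr {φ ψ : E N → F} (hφ : MemHHalf Γ φ) (h : φ =ᵐ[surf Γ] ψ) :
    MemHHalf Γ ψ := by
  refine ⟨hφ.1.ae_eq h, hφ.2.ae_eq ?_⟩
  filter_upwards [ae_surfPair h] with z hz
  rw [hz.1, hz.2]

variable {Ω : Set (E N)}

lemma disp_add (u v : H1 Ω) : disp (u + v) = disp u + disp v := rfl

lemma disp_neg (u : H1 Ω) : disp (-u) = -disp u := rfl

lemma wgrad_add (u v : H1 Ω) : wgrad (u + v) = wgrad u + wgrad v := rfl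

lemma wgrad_neg (u : H1 Ω) : wgrad (-u) = -wgrad u := rfl

lemma tendsto_eLpNorm_add {α G : Type*} [MeasurableSpace α] [NormedAddCommGroup G] {μ : Measure α}
    {f g h : ℕ → α → G} (hf : ∀ k, AEStronglyMeasurable (f k) μ)
    (hg : ∀ k, AEStronglyMeasurable (g k) μ) (hh : ∀ k, h k =ᵐ[μ] fun x => f k x + g k x)
    (h1 : Tendsto (fun k => eLpNorm (f k) 2 μ) atTop (𝓝 0))
    (h2 : Tendsto (fun k => eLpNorm (g k) 2 μ) atTop (𝓝 0)) :
    Tendsto (fun k => eLpNorm (h k) 2 μ) atTop (𝓝 0) := by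
  have h3 := h1.add h2
  rw [add_zero] at h3
  refine tendsto_of_tendsto_of_tendsto_of_le_of_le tendsto_const_nhds h3 (fun _ => zero_le)
    fun k => ?_
  rw [eLpNorm_congr_ae (hh k)]
  exact eLpNorm_add_le (hf k) (hg k) (by norm_num)

lemma aestronglyMeasurable_sub_sub {φ w : E N → E N} (hφ : Continuous φ)
    (hw : MemHHalf Γ w) :
    AEStronglyMeasurable (fun z : E N × E N => (φ z.1 - w z.1) - (φ z.2 - w z.2)) (surfPair Γ) := by
  have : (fun z : E N × E N => (φ z.1 - w z.1) - (φ z.2 - w z.2))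
      = fun z => (φ z.1 - φ z.2) - (w z.1 - w z.2) := by
    ext1 z
    abel
  rw [this]
  exact (by fun_prop : Continuous fun z : E N × E N => φ z.1 - φ z.2).aestronglyMeasurable.sub
    hw.2.1

lemma IsTrace.add {u v : H1 Ω} {w z : E N → E N} (hu : IsTrace Ω u w) (hv : IsTrace Ω v z) :
    IsTrace Ω (u + v) fun x => w x + z x := by
  obtain ⟨hw, φ, hφ, h1, h2, h3, h4⟩ := hu
  obtain ⟨hz, ψ, hψ, k1, k2, k3, k4⟩ := hv
  have hφc := fun k => (hφ k).1.continuous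
  have hψc := fun k => (hψ k).1.continuous
  refine ⟨hw.add hz, fun k x => φ k x + ψ k x,
    fun k => ⟨(hφ k).1.add (hψ k).1, (hφ k).2.add (hψ k).2⟩, ?_, ?_, ?_, ?_⟩
  · refine tendsto_eLpNorm_add (fun k => (hφc k).aestronglyMeasurable.sub (Lp.aestronglyMeasurable _))
      (fun k => (hψc k).aestronglyMeasurable.sub (Lp.aestronglyMeasurable _)) (fun k => ?_) h1 k1
    filter_upwards [Lp.coeFn_add (disp u) (disp v)] with x hx
    rw [disp_add, hx, Pi.add_apply]
    simp only [Pi.sub_apply]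
    abel
  · refine tendsto_eLpNorm_add
      (fun k => (continuous_gradMat (hφ k).1).aestronglyMeasurable.sub (Lp.aestronglyMeasurable _))
      (fun k => (continuous_gradMat (hψ k).1).aestronglyMeasurable.sub (Lp.aestronglyMeasurable _))
      (fun k => ?_) h2 k2
    filter_upwards [Lp.coeFn_add (wgrad u) (wgrad v)] with x hx
    rw [wgrad_add, hx, Pi.add_apply, gradMat_add (hφ k).1 (hψ k).1]
    simp only [Pi.sub_apply]
    abel
  · refine tendsto_eLpNorm_add (fun k => (hφc k).aestronglyMeasurable.sub hw.1.1)
      (fun k => (hψc k).aestronglyMeasurable.sub hz.1.1) (fun k => ?_) h3 k3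
    filter_upwards with x
    simp only [Pi.sub_apply]
    abel
  · refine tendsto_eLpNorm_add (fun k => aestronglyMeasurable_sub_sub (hφc k) hw)
      (fun k => aestronglyMeasurable_sub_sub (hψc k) hz) (fun k => ?_) h4 k4
    filter_upwards with x
    abel

lemma tendsto_eLpNorm_neg {α G : Type*} [MeasurableSpace α] [NormedAddCommGroup G] {μ : Measure α}
    {f h : ℕ → α → G} (hh : ∀ k, h k =ᵐ[μ] fun x => -f k x)
    (h1 : Tendsto (fun k => eLpNorm (f k) 2 μ) atTop (𝓝 0)) :
    Tendsto (fun k => eLpNorm (h k) 2 μ) atTop (𝓝 0) := by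
  refine h1.congr fun k => ?_
  rw [eLpNorm_congr_ae (hh k)]
  exact (eLpNorm_neg (f k) 2 μ).symm

lemma IsTrace.neg {u : H1 Ω} {w : E N → E N} (hu : IsTrace Ω u w) :
    IsTrace Ω (-u) fun x => -w x := by
  obtain ⟨hw, φ, hφ, h1, h2, h3, h4⟩ := hu
  refine ⟨hw.neg, fun k x => -φ k x, fun k => ⟨(hφ k).1.neg, (hφ k).2.neg⟩, ?_, ?_, ?_, ?_⟩
  · refine tendsto_eLpNorm_neg (fun k => ?_) h1
    filter_upwards [Lp.coeFn_neg (disp u)] with x hx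
    rw [disp_neg, hx, Pi.neg_apply]
    abel
  · refine tendsto_eLpNorm_neg (fun k => ?_) h2
    filter_upwards [Lp.coeFn_neg (wgrad u)] with x hx
    rw [wgrad_neg, hx, Pi.neg_apply, gradMat_neg]
    abel
  · refine tendsto_eLpNorm_neg (fun k => ?_) h3
    filter_upwards with x
    abel
  · refine tendsto_eLpNorm_neg (fun k => ?_) h4
    filter_upwards with x
    abel

lemma IsTrace.sub {u v : H1 Ω} {w z : E N → E N} (hu : IsTrace Ω u w) (hv : IsTrace Ω v z) :
    IsTrace Ω (u - v) fun x => w x - z x := by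
  simpa [sub_eq_add_neg] using hu.add hv.neg

lemma isTrace_trace {u : H1 Ω} (h : ∃ w, IsTrace Ω u w) : IsTrace Ω u (trace u) := by
  unfold trace
  rw [dif_pos h]
  exact h.choose_spec

end Trace

/-! ### Continuity and uniqueness of the trace; Korn's inequality for Sobolev fields. -/

section TraceBound

variable {n : ℕ} {Ω : Set (E (n + 1))}

lemma surf_eq (Γ : Set (E (n + 1))) : surf Γ = (μHE[n] : Measure (E (n + 1))).restrict Γ := rfl

lemma enorm_H1_sq (u : H1 Ω) : ‖u‖ₑ ^ 2 = (∫⁻ x in Ω, ‖disp u x‖ₑ ^ 2)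
    + ∫⁻ x in Ω, ‖wgrad u x‖ₑ ^ 2 := by
  have e : ∀ {G : Type} [NormedAddCommGroup G] (f : Lp G 2 (volume.restrict Ω)),
      ‖f‖ₑ ^ 2 = ∫⁻ x in Ω, ‖f x‖ₑ ^ 2 := fun f => by
    rw [← eLpNorm_two_sq, Lp.enorm_def]
  rw [← e, ← e, enorm_sq_eq_ofReal, enorm_sq_eq_ofReal, enorm_sq_eq_ofReal,
    ← ENNReal.ofReal_add (by positivity) (by positivity)]
  congr 1
  exact WithLp.prod_norm_sq_eq_of_L2 (u : SobolevPair Ω)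

lemma enorm_le_mul_enorm {F G : Type*} [NormedAddCommGroup F] [NormedAddCommGroup G] {x : F} {y : G}
    {C : ℝ≥0} (h : ‖x‖ ≤ C * ‖y‖) : ‖x‖ₑ ≤ C * ‖y‖ₑ := by
  have h' : ‖x‖₊ ≤ C * ‖y‖₊ := by exact_mod_cast h
  rw [enorm_eq_nnnorm, enorm_eq_nnnorm]
  exact_mod_cast h'

/-- The `H¹` error of the smooth approximations of a Sobolev field. -/
lemma sqH1_le_of_approx (u : H1 Ω) {φ : E (n + 1) → E (n + 1)} (hφ : ContDiff ℝ ∞ φ) :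
    sqH1 Ω φ ≤ 2 * (((∫⁻ x in Ω, ‖φ x - disp u x‖ₑ ^ 2)
      + ∫⁻ x in Ω, ‖gradMat φ x - wgrad u x‖ₑ ^ 2) + ‖u‖ₑ ^ 2) := by
  have h1 : ∫⁻ x in Ω, ‖fderiv ℝ φ x‖ₑ ^ 2 ≤ ∫⁻ x in Ω, ‖gradMat φ x‖ₑ ^ 2 := by
    refine lintegral_mono fun x => ?_
    gcongr
    simpa using enorm_le_mul_enorm (C := 1) (by simpa using norm_fderiv_le_gradMat φ x)
  have h2 := lintegral_add_sq_le (volume.restrict Ω) (f := fun x => φ x - disp u x)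
    (hφ.continuous.aestronglyMeasurable.sub (Lp.aestronglyMeasurable _)) (disp u)
  have h3 := lintegral_add_sq_le (volume.restrict Ω) (f := fun x => gradMat φ x - wgrad u x)
    ((continuous_gradMat hφ).aestronglyMeasurable.sub (Lp.aestronglyMeasurable _)) (wgrad u)
  simp only [sub_add_cancel] at h2 h3
  refine (add_le_add h2 (h1.trans h3)).trans_eq ?_
  rw [enorm_H1_sq]
  ring

lemma tendsto_lintegral_of_eLpNorm {α G : Type*} [MeasurableSpace α] [NormedAddCommGroup G]
    {μ : Measure α} {f : ℕ → α → G} (h : Tendsto (fun k => eLpNorm (f k) 2 μ) atTop (𝓝 0)) :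
    Tendsto (fun k => ∫⁻ x, ‖f k x‖ₑ ^ 2 ∂μ) atTop (𝓝 0) := by
  simpa [eLpNorm_two_sq] using ENNReal.Tendsto.pow (n := 2) h

lemma le_mul_of_tendsto {K X s : ℝ≥0∞} (hK : K ≠ ⊤) {a : ℕ → ℝ≥0∞}
    (ha : Tendsto a atTop (𝓝 0)) (h : ∀ k, X ≤ K * (a k + s)) : X ≤ K * s := by
  have h1 := ENNReal.Tendsto.const_mul (ha.add (tendsto_const_nhds (x := s))) (Or.inr hK)
  rw [zero_add] at h1
  exact ge_of_tendsto' h1 h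

/-- Continuity of the trace from `H¹(Ω)` to `L²(∂Ω)`. -/
lemma exists_trace_bound (hΩo : IsOpen Ω) (hΩb : Bornology.IsBounded Ω) (hΩ : IsC11 Ω) :
    ∃ C : ℝ≥0, ∀ (u : H1 Ω) (w : E (n + 1) → E (n + 1)), IsTrace Ω u w →
      ∫⁻ x, ‖w x‖ₑ ^ 2 ∂(surf (frontier Ω)) ≤ C * ‖u‖ₑ ^ 2 := by
  obtain ⟨C, hC⟩ := lintegral_frontier_sq_le hΩo hΩb hΩ
  refine ⟨2 * (C * 2 + 1), fun u w ⟨hw, φ, hφ, h1, h2, h3, _⟩ => ?_⟩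
  have h1 := tendsto_lintegral_of_eLpNorm h1
  have h2 := tendsto_lintegral_of_eLpNorm h2
  have h3 := tendsto_lintegral_of_eLpNorm h3
  have hlim := h3.add (h1.add h2)
  simp only [add_zero] at hlim
  refine le_mul_of_tendsto ENNReal.coe_ne_top hlim fun k => ?_
  have h4 := lintegral_sub_sq_le' (surf (frontier Ω)) (f := fun x => φ k x)
    (hφ k).1.continuous.aestronglyMeasurable (fun x => φ k x - w x)
  have h5 := (hC _ (hφ k).1).trans (mul_le_mul' le_rfl (sqH1_le_of_approx u (hφ k).1))
  simp only [sub_sub_cancel] at h4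
  refine h4.trans ((mul_le_mul' le_rfl (add_le_add h5 le_rfl)).trans ?_)
  generalize ∫⁻ x in Ω, ‖φ k x - disp u x‖ₑ ^ 2 = a
  generalize ∫⁻ x in Ω, ‖gradMat (φ k) x - wgrad u x‖ₑ ^ 2 = b
  generalize ∫⁻ x, ‖φ k x - w x‖ₑ ^ 2 ∂(surf (frontier Ω)) = c
  push_cast
  calc _ = 2 * c + 2 * (C * 2) * (a + b + ‖u‖ₑ ^ 2) := by ring
    _ ≤ 2 * (C * 2 + 1) * c + 2 * (C * 2 + 1) * (a + b + ‖u‖ₑ ^ 2) := by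
        gcongr
        · exact le_mul_of_one_le_right zero_le le_add_self
        · exact le_self_add
    _ = _ := by ring

/-- The difference of two traces of u is a trace of u - u = 0, so the trace bound kills it. This
makes the chosen `trace` additive almost everywhere. -/
lemma IsTrace.ae_eq (hΩo : IsOpen Ω) (hΩb : Bornology.IsBounded Ω) (hΩ : IsC11 Ω) {u : H1 Ω}
    {w z : E (n + 1) → E (n + 1)} (hw : IsTrace Ω u w) (hz : IsTrace Ω u z) :
    w =ᵐ[surf (frontier Ω)] z := by
  obtain ⟨C, hC⟩ := exists_trace_bound hΩo hΩb hΩ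
  have h0 : ‖u - u‖ₑ = 0 := by rw [sub_self, ← ofReal_norm, norm_zero, ENNReal.ofReal_zero]
  have h := hC _ _ (hw.sub hz)
  rw [h0, zero_pow two_ne_zero, mul_zero, nonpos_iff_eq_zero] at h
  have hm : AEMeasurable (fun x => ‖w x - z x‖ₑ ^ 2) (surf (frontier Ω)) :=
    (hw.1.1.1.sub hz.1.1.1).enorm.pow_const 2
  filter_upwards [(lintegral_eq_zero_iff' hm).1 h] with x hx
  have : w x - z x = 0 := by simpa using hx
  exact sub_eq_zero.1 this

/-- Korn's inequality for Sobolev fields that vanish on a part of the boundary. -/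
lemma exists_korn (hΩo : IsOpen Ω) (hΩb : Bornology.IsBounded Ω) (hΩ : IsC11 Ω)
    (hΩc : IsConnected Ω) {Γ : Set (E (n + 1))} (hΓ : Γ ⊆ frontier Ω)
    (hΓ0 : surf Γ univ ≠ 0) :
    ∃ C : ℝ≥0, ∀ (u : H1 Ω) (w : E (n + 1) → E (n + 1)), IsTrace Ω u w →
      (∀ᵐ x ∂(surf Γ), w x = 0) → ‖u‖ₑ ^ 2 ≤ C * ∫⁻ x in Ω, ‖strain u x‖ₑ ^ 2 := by
  rw [surf_eq, Measure.restrict_apply_univ] at hΓ0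
  obtain ⟨C, hC⟩ := korn_first hΩo hΩb hΩ hΩc hΓ hΓ0
  -- The approximants of u need not vanish on Γ, they are only small there; hence the boundary term
  -- in `korn_first`. The factor 4 comes from `norm_symAdd_fderiv_le`, n + 1 from the Frobenius norm
  -- of the gradient, and the factors 2 from splitting into an approximant and an error.
  refine ⟨2 * ((n + 1) * (C * (4 * 2) + 1)), fun u w ⟨hw, φ, hφ, h1, h2, h3, _⟩ hw0 => ?_⟩
  have h1 := tendsto_lintegral_of_eLpNorm h1
  have h2 := tendsto_lintegral_of_eLpNorm h2
  have h3 := tendsto_lintegral_of_eLpNorm h3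
  obtain ⟨a, ha⟩ : ∃ a : ℕ → ℝ≥0∞, ∀ k, a k = ∫⁻ x in Ω, ‖φ k x - disp u x‖ₑ ^ 2 := ⟨_, fun _ => rfl⟩
  obtain ⟨b, hb⟩ : ∃ b : ℕ → ℝ≥0∞, ∀ k, b k = ∫⁻ x in Ω, ‖gradMat (φ k) x - wgrad u x‖ₑ ^ 2 :=
    ⟨_, fun _ => rfl⟩
  obtain ⟨c, hc⟩ : ∃ c : ℕ → ℝ≥0∞, ∀ k, c k = ∫⁻ x, ‖φ k x - w x‖ₑ ^ 2 ∂(surf (frontier Ω)) :=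
    ⟨_, fun _ => rfl⟩
  obtain ⟨s, hs⟩ : ∃ s : ℝ≥0∞, s = ∫⁻ x in Ω, ‖strain u x‖ₑ ^ 2 := ⟨_, rfl⟩
  simp only [← ha] at h1
  simp only [← hb] at h2
  simp only [← hc] at h3
  rw [← hs]
  have hlim := (h1.add h2).add h3
  simp only [add_zero] at hlim
  refine le_mul_of_tendsto ENNReal.coe_ne_top hlim fun k => ?_
  have hφs := (hφ k).1
  have e1 : ∫⁻ x in Ω, ‖disp u x‖ₑ ^ 2 ≤ 2 * (a k + ∫⁻ x in Ω, ‖φ k x‖ₑ ^ 2) := by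
    have h4 := lintegral_sub_sq_le' (volume.restrict Ω) (f := fun x => φ k x)
      hφs.continuous.aestronglyMeasurable (fun x => φ k x - disp u x)
    simp only [sub_sub_cancel] at h4
    rw [ha]
    exact h4.trans_eq (congrArg _ (add_comm _ _))
  have e2 : ∫⁻ x in Ω, ‖wgrad u x‖ₑ ^ 2
      ≤ 2 * (b k + (n + 1) * ∫⁻ x in Ω, ‖fderiv ℝ (φ k) x‖ₑ ^ 2) := by
    have h4 := lintegral_sub_sq_le' (volume.restrict Ω) (f := fun x => gradMat (φ k) x)
      (continuous_gradMat hφs).aestronglyMeasurable (fun x => gradMat (φ k) x - wgrad u x)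
    simp only [sub_sub_cancel] at h4
    rw [hb, add_comm (lintegral _ _)]
    refine h4.trans ?_
    gcongr
    rw [← lintegral_const_mul' _ _ (by finiteness)]
    refine lintegral_mono fun x => ?_
    rw [enorm_sq_eq_ofReal, enorm_sq_eq_ofReal]
    refine (ENNReal.ofReal_le_ofReal (norm_gradMat_sq_le (φ k) x)).trans_eq ?_
    rw [ENNReal.ofReal_mul (by positivity), ENNReal.ofReal_add (by positivity) (by positivity)]
    simp
  have e3 : ∫⁻ x in Ω, ‖symAdd (fderiv ℝ (φ k) x)‖ₑ ^ 2 ≤ 4 * (2 * (b k + s)) := by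
    have h5 : ∫⁻ x in Ω, ‖symAdd (fderiv ℝ (φ k) x)‖ₑ ^ 2
        ≤ 4 * ∫⁻ x in Ω, ‖symPart (gradMat (φ k) x)‖ₑ ^ 2 := by
      rw [← lintegral_const_mul' _ _ (by simp)]
      refine lintegral_mono fun x => ?_
      have := enorm_le_mul_enorm (C := 2) (norm_symAdd_fderiv_le (φ k) x)
      calc _ ≤ (((2 : ℝ≥0) : ℝ≥0∞) * ‖symPart (gradMat (φ k) x)‖ₑ) ^ 2 := by gcongr
        _ = _ := by
          push_cast
          ring
    refine h5.trans ?_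
    gcongr
    have h4 := lintegral_add_sq_le (volume.restrict Ω)
      (f := fun x => symPart (gradMat (φ k) x - wgrad u x))
      (continuous_symPart.comp_aestronglyMeasurable
        ((continuous_gradMat hφs).aestronglyMeasurable.sub (Lp.aestronglyMeasurable _)))
      (fun x => strain u x)
    have e : ∀ x, symPart (gradMat (φ k) x - wgrad u x) + strain u x
        = symPart (gradMat (φ k) x) := fun x => by
      rw [strain, symPart_sub, sub_add_cancel]
    simp only [e] at h4
    rw [hb, hs]
    refine h4.trans ?_
    gcongr
    simpa using enorm_le_mul_enorm (C := 1) (by simpa using norm_symPart_le _)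
  have e4 : ∫⁻ x in Γ, ‖φ k x‖ₑ ^ 2 ∂(μHE[n] : Measure (E (n + 1))) ≤ c k := by
    rw [hc]
    calc _ = ∫⁻ x, ‖φ k x - w x‖ₑ ^ 2 ∂(surf Γ) := by
          refine lintegral_congr_ae ?_
          filter_upwards [hw0] with x hx
          rw [hx, sub_zero]
      _ ≤ _ := lintegral_mono_set hΓ
  have e5 := hC (φ k) hφs (hφ k).2
  have e6 : sqH1 Ω (φ k) ≤ C * (4 * (2 * (b k + s)) + c k) :=
    e5.trans (mul_le_mul' le_rfl (add_le_add e3 e4))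
  rw [enorm_H1_sq]
  refine (add_le_add e1 e2).trans ?_
  have e7 : (∫⁻ x in Ω, ‖φ k x‖ₑ ^ 2) + (n + 1) * ∫⁻ x in Ω, ‖fderiv ℝ (φ k) x‖ₑ ^ 2
      ≤ (n + 1) * sqH1 Ω (φ k) := by
    rw [sqH1, mul_add]
    gcongr
    exact le_mul_of_one_le_left zero_le le_add_self
  push_cast
  calc _ = 2 * (a k + b k) + 2 * ((∫⁻ x in Ω, ‖φ k x‖ₑ ^ 2)
        + (n + 1) * ∫⁻ x in Ω, ‖fderiv ℝ (φ k) x‖ₑ ^ 2) := by ring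
    _ ≤ 2 * (a k + b k) + 2 * ((n + 1) * (C * (4 * (2 * (b k + s)) + c k))) := by
        gcongr
        exact e7.trans (by gcongr)
    _ ≤ 2 * ((n + 1) * (a k + b k + c k + s))
          + 2 * ((n + 1) * (C * (8 * (a k + b k + c k + s)))) := by
        have i1 : a k + b k ≤ (n + 1) * (a k + b k + c k + s) := by
          rw [add_assoc (a k + b k)]
          exact le_self_add.trans (le_mul_of_one_le_left zero_le le_add_self)
        have i2 : 4 * (2 * (b k + s)) + c k ≤ 8 * (a k + b k + c k + s) := by
          have : 8 * (a k + b k + c k + s) = 4 * (2 * (b k + s)) + c k + (8 * a k + 7 * c k) := by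
            ring
          rw [this]
          exact le_self_add
        gcongr
    _ = _ := by ring

end TraceBound

/-! ### The outward normal: uniqueness and Lipschitz continuity. -/

section Normal

variable {N : ℕ} {Ω : Set (E N)}

/-- Moving from x in the direction n' - n goes inside Ω according to n and outside according to n'.
-/
lemma IsOutwardNormal.unique {x n n' : E N} (h : IsOutwardNormal Ω x n)
    (h' : IsOutwardNormal Ω x n') : n = n' := by
  by_contra hne
  set d := n' - n with hd
  have hd0 : 0 < ‖d‖ := norm_pos_iff.2 (sub_ne_zero.2 fun e => hne e.symm)
  have e1 : ⟪d, n⟫ = -(‖d‖ ^ 2 / 2) := by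
    have := norm_sub_sq_real n' n
    rw [h.1, h'.1] at this
    rw [hd, inner_sub_left, real_inner_self_eq_norm_sq, h.1]
    linarith
  have e2 : ⟪d, n'⟫ = ‖d‖ ^ 2 / 2 := by
    have := norm_sub_sq_real n' n
    rw [h.1, h'.1] at this
    rw [hd, inner_sub_left, real_inner_self_eq_norm_sq, h'.1, real_inner_comm]
    linarith
  have hε : 0 < ‖d‖ / 4 := by positivity
  have hlim : Tendsto (fun t : ℝ => x + t • d) (𝓝[>] 0) (𝓝 x) := by
    have hc : Continuous fun t : ℝ => x + t • d := by fun_prop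
    have := hc.tendsto 0
    simp only [zero_smul, add_zero] at this
    exact this.mono_left nhdsWithin_le_nhds
  obtain ⟨t, ⟨h1, h2⟩, ht⟩ := (((hlim.eventually (h.2 _ hε)).and
    (hlim.eventually (h'.2 _ hε))).and self_mem_nhdsWithin).exists
  have ht : 0 < t := ht
  simp only [add_sub_cancel_left, real_inner_smul_left, norm_smul, Real.norm_of_nonneg ht.le, e1,
    e2] at h1 h2
  have hp : 0 < t * ‖d‖ ^ 2 := by positivity
  exact h2.2 (by nlinarith) (h1.1 (by nlinarith))

lemma IsOutwardNormal.eq_outwardNormal {x n : E N} (h : IsOutwardNormal Ω x n) :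
    outwardNormal Ω x = n := by
  have hex : ∃ n, IsOutwardNormal Ω x n := ⟨n, h⟩
  rw [outwardNormal, dif_pos hex]
  exact hex.choose_spec.unique h

lemma norm_outwardNormal_le (x : E N) : ‖outwardNormal Ω x‖ ≤ 1 := by
  unfold outwardNormal
  split_ifs with h
  · exact h.choose_spec.1.le
  · simp

/-- A gradient-normalized level set function gives the outward normal. -/
lemma isOutwardNormal_of_hasFDerivAt {x v : E N} {ψ : E N → ℝ}
    (hψ : HasFDerivAt ψ (innerSL ℝ v) x) (h0 : ψ x = 0) (hv : v ≠ 0)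
    (hΩ : ∀ᶠ y in 𝓝 x, y ∈ Ω ↔ ψ y < 0) : IsOutwardNormal Ω x (‖v‖⁻¹ • v) := by
  have hv' : 0 < ‖v‖ := norm_pos_iff.2 hv
  refine ⟨by rw [norm_smul, norm_inv, norm_norm, inv_mul_cancel₀ hv'.ne'], fun ε hε => ?_⟩
  have h1 := hψ.isLittleO.bound (show 0 < ε * ‖v‖ / 2 by positivity)
  filter_upwards [h1, hΩ] with y hy hyΩ
  rw [h0, sub_zero, innerSL_apply_apply, Real.norm_eq_abs, abs_le, ] at hy
  have e : ⟪y - x, ‖v‖⁻¹ • v⟫ = ‖v‖⁻¹ * ⟪v, y - x⟫ := by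
    rw [real_inner_smul_right, real_inner_comm]
  have e' : ⟪v, y - x⟫ = ‖v‖ * (‖v‖⁻¹ * ⟪v, y - x⟫) := by
    rw [mul_inv_cancel_left₀ hv'.ne']
  rw [e, hyΩ]
  set s := ‖v‖⁻¹ * ⟪v, y - x⟫
  rw [e'] at hy
  have hp : 0 ≤ ε * ‖v‖ * ‖y - x‖ := by positivity
  constructor
  · intro h
    have := mul_lt_mul_of_pos_left h hv'
    nlinarith [hy.2]
  · intro h
    have := mul_lt_mul_of_pos_left h hv'
    nlinarith [hy.1]

lemma norm_normalize_sub_le {v w : E N} (hv : 1 ≤ ‖v‖) (hw : 1 ≤ ‖w‖) :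
    ‖‖v‖⁻¹ • v - ‖w‖⁻¹ • w‖ ≤ 2 * ‖v - w‖ := by
  have hv' : 0 < ‖v‖ := by linarith
  have hw' : 0 < ‖w‖ := by linarith
  have e : ‖v‖⁻¹ • v - ‖w‖⁻¹ • w = ‖v‖⁻¹ • ((v - w) + ((‖w‖ - ‖v‖) * ‖w‖⁻¹) • w) := by
    rw [smul_add, smul_sub, smul_smul]
    have : ‖v‖⁻¹ * ((‖w‖ - ‖v‖) * ‖w‖⁻¹) = ‖v‖⁻¹ - ‖w‖⁻¹ := by
      field_simp
    rw [this, sub_smul]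
    abel
  rw [e, norm_smul, norm_inv, norm_norm]
  have h1 : ‖((‖w‖ - ‖v‖) * ‖w‖⁻¹) • w‖ ≤ ‖v - w‖ := by
    rw [norm_smul, norm_mul, norm_inv, norm_norm, inv_mul_cancel_right₀ hw'.ne', Real.norm_eq_abs,
      abs_sub_comm]
    exact abs_norm_sub_norm_le v w
  calc ‖v‖⁻¹ * _ ≤ 1 * (‖v - w‖ + ‖v - w‖) := by
        gcongr
        · exact inv_le_one_of_one_le₀ hv
        · exact (norm_add_le _ _).trans (by gcongr)
    _ = _ := by ring

/-- The normal is the normalization of ν - ∇γ, the gradient of the level set function ⟪y, ν⟫ - γ(y).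
This vector is Lipschitz since γ is C^{1,1}. -/
lemma exists_lipschitzOnWith_outwardNormal_ball (hΩo : IsOpen Ω) {x₀ ν : E N} {γ : E N → ℝ} {r : ℝ}
    (h : IsC11Graph Ω x₀ ν γ r) :
    ∃ K : ℝ≥0, LipschitzOnWith K (outwardNormal Ω) (frontier Ω ∩ Metric.ball x₀ r) := by
  obtain ⟨hν, hγ, ⟨K, hK⟩, hinv, hr, hgr⟩ := h
  set v : E N → E N := fun x => ν - gradient γ x with hv
  have hvK : ∀ x y, ‖v x - v y‖ ≤ K * ‖x - y‖ := fun x y => by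
    have : v x - v y = gradient γ y - gradient γ x := by
      simp only [hv]
      abel
    rw [this, gradient, gradient, ← map_sub, LinearIsometryEquiv.norm_map, ← dist_eq_norm,
      ← dist_eq_norm, dist_comm x y]
    exact hK.dist_le_mul y x
  have hdiff : ∀ x, DifferentiableAt ℝ γ x := fun x => hγ.differentiable (by simp) x
  -- Its component along ν is 1, as γ is constant along ν; being bounded away from zero, it can be
  -- normalized in a Lipschitz way.
  have hvν : ∀ x, 1 ≤ ‖v x‖ := by
    intro x
    have h1 : fderiv ℝ γ x ν = 0 := by
      have h2 : HasDerivAt (fun t : ℝ => x + t • ν) ν 0 := by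
        simpa using ((hasDerivAt_id (0 : ℝ)).smul_const ν).const_add x
      have h3 : HasFDerivAt γ (fderiv ℝ γ x) (x + (0 : ℝ) • ν) := by
        simpa using (hdiff x).hasFDerivAt
      have h4 := h3.comp_hasDerivAt 0 h2
      have h5 : (γ ∘ fun t : ℝ => x + t • ν) = fun _ => γ x := funext fun t => hinv x t
      rw [h5] at h4
      exact h4.unique (hasDerivAt_const _ _)
    have h6 : ⟪v x, ν⟫ = 1 := by
      rw [hv, inner_sub_left, real_inner_self_eq_norm_sq, hν, gradient,
        InnerProductSpace.toDual_symm_apply, h1]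
      norm_num
    have h7 := real_inner_le_norm (v x) ν
    rwa [h6, hν, mul_one] at h7
  have hn : ∀ x ∈ frontier Ω ∩ Metric.ball x₀ r, outwardNormal Ω x = ‖v x‖⁻¹ • v x := by
    rintro x ⟨hx, hxr⟩
    have hev : ∀ᶠ y in 𝓝 x, y ∈ Ω ↔ ⟪y, ν⟫ - γ y < 0 := by
      filter_upwards [Metric.isOpen_ball.mem_nhds hxr] with y hy
      rw [hgr y hy, sub_neg]
    have hfd : HasFDerivAt (fun y => ⟪y, ν⟫ - γ y) (innerSL ℝ (v x)) x := by
      have h1 : HasFDerivAt (fun y : E N => ⟪y, ν⟫) (innerSL ℝ ν) x := by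
        have := (innerSL ℝ ν).hasFDerivAt (x := x)
        simpa [real_inner_comm] using this
      have e : innerSL ℝ (v x) = innerSL ℝ ν - fderiv ℝ γ x := by
        ext1 y
        rw [sub_apply, innerSL_apply_apply, innerSL_apply_apply, hv, inner_sub_left, gradient,
          InnerProductSpace.toDual_symm_apply]
      rw [e]
      exact h1.sub (hdiff x).hasFDerivAt
    refine (isOutwardNormal_of_hasFDerivAt hfd ?_ ?_ hev).eq_outwardNormal
    · refine le_antisymm ?_ ?_
      · have hcl : x ∈ closure {y | ⟪y, ν⟫ - γ y < 0} := by
          rw [mem_closure_iff_frequently]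
          exact (mem_closure_iff_frequently.1 (frontier_subset_closure hx)).mp
            (hev.mono fun y hy hyΩ => hy.1 hyΩ)
        have hc : Continuous fun y => ⟪y, ν⟫ - γ y := by
          have := hγ.continuous
          fun_prop
        have hsub : {y | ⟪y, ν⟫ - γ y < 0} ⊆ {y | ⟪y, ν⟫ - γ y ≤ 0} := ofPred_subset_ofPred.2 fun y hy => hy.le
        exact closure_minimal hsub (isClosed_le hc continuous_const) hcl
      · have hxΩ : x ∉ Ω := fun hxΩ => by
          rw [hΩo.frontier_eq] at hx
          exact hx.2 hxΩ
        exact not_lt.1 fun hlt => hxΩ (hev.self_of_nhds.2 hlt)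
    · intro h0
      have := hvν x
      rw [h0, norm_zero] at this
      linarith
  refine ⟨2 * K, LipschitzOnWith.of_dist_le_mul fun x hx y hy => ?_⟩
  rw [hn x hx, hn y hy, dist_eq_norm, dist_eq_norm]
  refine (norm_normalize_sub_le (hvν x) (hvν y)).trans ?_
  push_cast
  linarith [hvK x y]

/-- The outward normal to a domain of class `C^{1,1}` is Lipschitz. -/
lemma exists_lipschitzOnWith_outwardNormal (hΩo : IsOpen Ω) (hΩb : Bornology.IsBounded Ω)
    (hΩ : IsC11 Ω) : ∃ K : ℝ≥0, LipschitzOnWith K (outwardNormal Ω) (frontier Ω) := by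
  have hc : IsCompact (frontier Ω) :=
    hΩb.isCompact_closure.of_isClosed_subset isClosed_frontier frontier_subset_closure
  refine LocallyLipschitzOn.exists_lipschitzOnWith_of_compact hc fun x hx => ?_
  obtain ⟨ν, γ, r, h⟩ := hΩ x hx
  obtain ⟨K, hK⟩ := exists_lipschitzOnWith_outwardNormal_ball hΩo h
  exact ⟨K, _, inter_mem_nhdsWithin _ (Metric.ball_mem_nhds x h.2.2.2.2.1), hK⟩

end Normal

/-! ### Lipschitz multipliers and norms in H^{1/2}. -/

section Multiplication

variable {N : ℕ} {Γ : Set (E N)} {F G : Type*} [NormedAddCommGroup F] [NormedAddCommGroup G]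

/-- The property of a hypersurface that makes Lipschitz functions multipliers of `H^{1/2}`. -/
def HasPotentialBound (Γ : Set (E N)) : Prop :=
  MeasurableSet Γ ∧ IsFiniteMeasure (surf Γ) ∧ ∃ C : ℝ≥0, ∀ x : E N,
    ∫⁻ y, ENNReal.ofReal (‖x - y‖ ^ 2 * (1 / ‖x - y‖ ^ N)) ∂(surf Γ) ≤ C

lemma ae_surfPair_mem (hm : MeasurableSet Γ) : ∀ᵐ z ∂(surfPair Γ), z.1 ∈ Γ ∧ z.2 ∈ Γ :=
  ae_surfPair (ae_restrict_mem hm)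

/-- The weight |x - y|² reduces the kernel |x - y|⁻ᴺ to an integrable one; integrating first in the
variable that does not enter v leaves a multiple of the L² norm of v. -/
lemma memLp_surfPair_weight (hΓ : HasPotentialBound Γ) {v : E N → F} (hv : MemLp v 2 (surf Γ)) :
    MemLp (fun z : E N × E N => ‖z.1 - z.2‖ * ‖v z.2‖) 2 (surfPair Γ) := by
  obtain ⟨hm, hfin, C, hC⟩ := hΓ
  have hv2 : AEStronglyMeasurable (fun z : E N × E N => v z.2) ((surf Γ).prod (surf Γ)) :=
    hv.1.comp_quasiMeasurePreserving (quasiMeasurePreserving_snd_aux _)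
  have hsm : AEStronglyMeasurable (fun z : E N × E N => ‖z.1 - z.2‖ * ‖v z.2‖)
      ((surf Γ).prod (surf Γ)) :=
    (by fun_prop : Continuous fun z : E N × E N => ‖z.1 - z.2‖).aestronglyMeasurable.mul hv2.norm
  refine ⟨hsm.mono_ac (withDensity_absolutelyContinuous _ _), ?_⟩
  have key : eLpNorm (fun z : E N × E N => ‖z.1 - z.2‖ * ‖v z.2‖) 2 (surfPair Γ) ^ 2 < ⊤ := by
    have hwm : Measurable fun z : E N × E N => ENNReal.ofReal (1 / ‖z.1 - z.2‖ ^ N) := by fun_prop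
    rw [eLpNorm_two_sq, surfPair, lintegral_withDensity_eq_lintegral_mul₀ hwm.aemeasurable
      (hsm.enorm.pow_const 2), lintegral_prod_symm _ (hwm.aemeasurable.mul (hsm.enorm.pow_const 2))]
    have e : ∀ x y : E N, ENNReal.ofReal (1 / ‖x - y‖ ^ N) * ‖‖x - y‖ * ‖v y‖‖ₑ ^ 2
        = ENNReal.ofReal (‖y - x‖ ^ 2 * (1 / ‖y - x‖ ^ N)) * ‖v y‖ₑ ^ 2 := by
      intro x y
      rw [enorm_sq_eq_ofReal, enorm_sq_eq_ofReal, ← ENNReal.ofReal_mul (by positivity),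
        ← ENNReal.ofReal_mul (by positivity), norm_mul, norm_norm, norm_norm, norm_sub_rev x y]
      congr 1
      ring
    calc _ = ∫⁻ y, ∫⁻ x, ENNReal.ofReal (‖y - x‖ ^ 2 * (1 / ‖y - x‖ ^ N)) * ‖v y‖ₑ ^ 2
          ∂(surf Γ) ∂(surf Γ) := by simp only [Pi.mul_apply, e]
      _ ≤ ∫⁻ y, C * ‖v y‖ₑ ^ 2 ∂(surf Γ) := by
          refine lintegral_mono fun y => ?_
          rw [lintegral_mul_const' _ _ (by finiteness)]
          gcongr
          exact hC y
      _ = C * ∫⁻ y, ‖v y‖ₑ ^ 2 ∂(surf Γ) := lintegral_const_mul' _ _ (by simp)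
      _ < ⊤ := by
          refine ENNReal.mul_lt_top (by simp) ?_
          rw [← eLpNorm_two_sq]
          exact ENNReal.pow_lt_top hv.2
  exact lt_of_not_ge fun h => by simp [top_le_iff.1 h] at key

/-- A field dominated by a field in `H^{1/2}`, with differences dominated up to a Lipschitz
factor, is in `H^{1/2}`. -/
lemma MemHHalf.of_bound (hΓ : HasPotentialBound Γ) {v : E N → F} (hv : MemHHalf Γ v) {ψ : E N → G}
    (hψ : AEStronglyMeasurable ψ (surf Γ)) {M K : ℝ} (h1 : ∀ x ∈ Γ, ‖ψ x‖ ≤ M * ‖v x‖)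
    (h2 : ∀ x ∈ Γ, ∀ y ∈ Γ, ‖ψ x - ψ y‖ ≤ M * ‖v x - v y‖ + K * (‖x - y‖ * ‖v y‖)) :
    MemHHalf Γ ψ := by
  refine ⟨hv.1.of_le_mul hψ ((ae_restrict_mem hΓ.1).mono h1), ?_⟩
  have hsm : AEStronglyMeasurable (fun z : E N × E N => ψ z.1 - ψ z.2) (surfPair Γ) :=
    ((hψ.comp_quasiMeasurePreserving (quasiMeasurePreserving_fst_aux _)).sub
      (hψ.comp_quasiMeasurePreserving (quasiMeasurePreserving_snd_aux _))).mono_ac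
      (withDensity_absolutelyContinuous _ _)
  have hd := (hv.2.norm.const_mul M).add ((memLp_surfPair_weight hΓ hv.1).const_mul K)
  refine hd.mono hsm ?_
  filter_upwards [ae_surfPair_mem hΓ.1] with z hz
  exact (h2 _ hz.1 _ hz.2).trans (le_abs_self _)

lemma MemHHalf.norm (hΓ : HasPotentialBound Γ) {v : E N → F} (hv : MemHHalf Γ v) :
    MemHHalf Γ fun x => ‖v x‖ := by
  refine hv.of_bound hΓ hv.1.1.norm (M := 1) (K := 0) (fun x _ => by simp) fun x _ y _ => ?_
  simpa using abs_norm_sub_norm_le (v x) (v y)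

lemma MemHHalf.inner_lipschitz (hΓ : HasPotentialBound Γ) {v h : E N → E N} (hv : MemHHalf Γ v)
    {K : ℝ≥0} (hK : LipschitzOnWith K h Γ) {M : ℝ} (hM : ∀ x ∈ Γ, ‖h x‖ ≤ M) :
    MemHHalf Γ fun x => ⟪v x, h x⟫ := by
  refine hv.of_bound hΓ (hv.1.1.inner (hK.continuousOn.aestronglyMeasurable hΓ.1)) (M := M)
    (K := K) (fun x hx => ?_) fun x hx y hy => ?_
  · refine (norm_inner_le_norm _ _).trans ?_
    rw [mul_comm]
    gcongr
    exact hM x hx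
  · have e : ⟪v x, h x⟫ - ⟪v y, h y⟫ = ⟪v x - v y, h x⟫ + ⟪v y, h x - h y⟫ := by
      rw [inner_sub_left, inner_sub_right]
      ring
    have h2 := hK.dist_le_mul x hx y hy
    rw [dist_eq_norm, dist_eq_norm] at h2
    rw [e]
    refine (norm_add_le _ _).trans (add_le_add ?_ ?_)
    · refine (norm_inner_le_norm _ _).trans ?_
      rw [mul_comm]
      gcongr
      exact hM x hx
    · refine (norm_inner_le_norm _ _).trans ?_
      calc ‖v y‖ * ‖h x - h y‖ ≤ ‖v y‖ * (K * ‖x - y‖) := by gcongr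
        _ = _ := by ring

lemma MemHHalf.smul_lipschitz [NormedSpace ℝ G] (hΓ : HasPotentialBound Γ) {φ : E N → ℝ}
    {h : E N → G} (hφ : MemHHalf Γ φ) {K : ℝ≥0} (hK : LipschitzOnWith K h Γ)
    (hG : AEStronglyMeasurable h (surf Γ)) {M : ℝ}
    (hM : ∀ x ∈ Γ, ‖h x‖ ≤ M) : MemHHalf Γ fun x => φ x • h x := by
  refine hφ.of_bound hΓ (hφ.1.1.smul hG) (M := M) (K := K) (fun x hx => ?_) fun x hx y hy => ?_
  · rw [norm_smul, mul_comm]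
    gcongr
    exact hM x hx
  · have e : φ x • h x - φ y • h y = (φ x - φ y) • h x + φ y • (h x - h y) := by
      rw [sub_smul, smul_sub]
      abel
    have h2 := hK.dist_le_mul x hx y hy
    rw [dist_eq_norm, dist_eq_norm] at h2
    rw [e]
    refine (norm_add_le _ _).trans (add_le_add ?_ ?_)
    · rw [norm_smul, mul_comm]
      gcongr
      exact hM x hx
    · rw [norm_smul]
      calc ‖φ y‖ * ‖h x - h y‖ ≤ ‖φ y‖ * (K * ‖x - y‖) := by gcongr
        _ = _ := by ring

lemma surf_mono {Γ' : Set (E N)} (h : Γ' ⊆ Γ) : surf Γ' ≤ surf Γ := Measure.restrict_mono h le_rfl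

lemma MemHHalf.mono {Γ' : Set (E N)} (hΓ : IsFiniteMeasure (surf Γ)) (hm : MeasurableSet Γ')
    (h : Γ' ⊆ Γ) {v : E N → F} (hv : MemHHalf Γ v) : MemHHalf Γ' v := by
  refine ⟨hv.1.mono_measure (surf_mono h), ?_⟩
  have e1 : surf Γ' = (surf Γ).restrict Γ' := by
    rw [surf, surf, Measure.restrict_restrict hm, inter_eq_self_of_subset_left h]
  have e2 : surfPair Γ' = (surfPair Γ).restrict (Γ' ×ˢ Γ') := by
    rw [surfPair, e1, Measure.prod_restrict, surfPair, restrict_withDensity (hm.prod hm)]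
  rw [e2]
  exact hv.2.restrict _

lemma HasPotentialBound.mono {Γ' : Set (E N)} (hΓ : HasPotentialBound Γ) (hm : MeasurableSet Γ')
    (h : Γ' ⊆ Γ) : HasPotentialBound Γ' := by
  obtain ⟨-, hfin, C, hC⟩ := hΓ
  refine ⟨hm, ⟨(surf_mono h _).trans_lt (measure_lt_top _ _)⟩, C, fun x => ?_⟩
  exact (lintegral_mono' (surf_mono h) le_rfl).trans (hC x)

lemma hasPotentialBound_frontier {m : ℕ} {Ω : Set (E (m + 2))} (hΩo : IsOpen Ω)
    (hΩb : Bornology.IsBounded Ω) (hΩ : IsC11 Ω) : HasPotentialBound (frontier Ω) := by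
  obtain ⟨C, hC⟩ := lintegral_potential_le hΩo hΩb hΩ
  refine ⟨isClosed_frontier.measurableSet, ⟨?_⟩, C, hC⟩
  rw [surf_eq, Measure.restrict_apply_univ]
  exact measure_frontier_lt_top hΩo hΩb hΩ

end Multiplication

/-! ### The duality pairing on functions. -/

section Pairing

variable {N : ℕ} {Γ : Set (E N)} {F : Type*} [NormedAddCommGroup F] [NormedSpace ℝ F]

lemma pair_of_mem (τ : HMinusHalf Γ F) {φ : E N → F} (h : MemHHalf Γ φ) :
    pair τ φ = τ (toHHalf φ h) := dif_pos h

/-- As `pair` takes the value 0 outside H^{1/2}, linearity in τ holds for every φ, whereas linearity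
in φ, in `pair_add` and after, needs membership. -/
lemma pair_sub_left (τ σ : HMinusHalf Γ F) (φ : E N → F) :
    pair (τ - σ) φ = pair τ φ - pair σ φ := by
  by_cases h : MemHHalf Γ φ
  · simp [pair_of_mem _ h]
  · simp [pair, h]

lemma pair_congr (τ : HMinusHalf Γ F) {φ ψ : E N → F} (h : φ =ᵐ[surf Γ] ψ) :
    pair τ φ = pair τ ψ := by
  by_cases hφ : MemHHalf Γ φ
  · have hψ := hφ.congr h
    rw [pair_of_mem _ hφ, pair_of_mem _ hψ]
    congr 1
    refine Subtype.ext ?_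
    have h1 : hφ.1.toLp φ = hψ.1.toLp ψ := (MemLp.toLp_eq_toLp_iff _ _).2 h
    have h2 : hφ.2.toLp _ = hψ.2.toLp _ := (MemLp.toLp_eq_toLp_iff _ _).2 (by
      filter_upwards [ae_surfPair h] with z hz
      rw [hz.1, hz.2])
    simp only [toHHalf, h1, h2]
  · have hψ : ¬MemHHalf Γ ψ := fun hψ => hφ (hψ.congr h.symm)
    simp [pair, hφ, hψ]

lemma pair_add (τ : HMinusHalf Γ F) {φ ψ : E N → F} (hφ : MemHHalf Γ φ) (hψ : MemHHalf Γ ψ) :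
    pair τ (fun x => φ x + ψ x) = pair τ φ + pair τ ψ := by
  rw [pair_of_mem _ hφ, pair_of_mem _ hψ, pair_of_mem _ (hφ.add hψ), ← map_add]
  congr 1
  refine Subtype.ext ?_
  have h1 : (hφ.add hψ).1.toLp _ = hφ.1.toLp φ + hψ.1.toLp ψ := by
    rw [← MemLp.toLp_add]
    rfl
  have h2 : (hφ.add hψ).2.toLp _ = hφ.2.toLp _ + hψ.2.toLp _ := by
    rw [← MemLp.toLp_add]
    refine (MemLp.toLp_eq_toLp_iff _ _).2 (Eventually.of_forall fun z => ?_)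
    simp only [Pi.add_apply]
    abel
  simp only [toHHalf, h1, h2]
  rfl

lemma pair_neg (τ : HMinusHalf Γ F) {φ : E N → F} (hφ : MemHHalf Γ φ) :
    pair τ (fun x => -φ x) = -pair τ φ := by
  have h := pair_add τ hφ hφ.neg
  have h0 : pair τ (fun x => φ x + -φ x) = 0 := by
    have e : (fun x => φ x + -φ x) = fun _ => (0 : F) := by
      ext1 x
      simp
    have hz : MemHHalf Γ fun _ : E N => (0 : F) := e ▸ hφ.add hφ.neg
    have h3 := pair_add τ hz hz
    simp only [add_zero] at h3
    rw [e]
    linarith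
  linarith

lemma pair_sub (τ : HMinusHalf Γ F) {φ ψ : E N → F} (hφ : MemHHalf Γ φ) (hψ : MemHHalf Γ ψ) :
    pair τ (fun x => φ x - ψ x) = pair τ φ - pair τ ψ := by
  simp only [sub_eq_add_neg]
  rw [pair_add τ hφ hψ.neg, pair_neg τ hψ]

lemma IsNonpos.pair_le {t : HMinusHalf Γ ℝ} (ht : IsNonpos t) {φ ψ : E N → ℝ} (hφ : MemHHalf Γ φ)
    (hψ : MemHHalf Γ ψ) (h : ∀ᵐ x ∂(surf Γ), φ x ≤ ψ x) : pair t ψ ≤ pair t φ := by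
  have := ht _ (hψ.sub hφ) (by filter_upwards [h] with x hx; linarith)
  rw [pair_sub t hψ hφ] at this
  linarith

end Pairing

/-! ### The strain as an L² field. -/

section StrainField

variable {N : ℕ} {Ω : Set (E N)}

lemma memLp_strain (u : H1 Ω) : MemLp (strain u) 2 (volume.restrict Ω) :=
  (Lp.memLp (wgrad u)).mono (continuous_symPart.comp_aestronglyMeasurable (Lp.aestronglyMeasurable _))
    (Eventually.of_forall fun _ => norm_symPart_le _)

lemma strain_add (u v : H1 Ω) :
    strain (u + v) =ᵐ[volume.restrict Ω] fun x => strain u x + strain v x := by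
  filter_upwards [Lp.coeFn_add (wgrad u) (wgrad v)] with x hx
  rw [strain, wgrad_add, hx, Pi.add_apply, symPart_add, strain, strain]

lemma strain_neg (u : H1 Ω) : strain (-u) =ᵐ[volume.restrict Ω] fun x => -strain u x := by
  filter_upwards [Lp.coeFn_neg (wgrad u)] with x hx
  rw [strain, wgrad_neg, hx, Pi.neg_apply, symPart_neg, strain]

end StrainField

/-! ### The final absorption argument, for real numbers. -/

section Real

lemma norm_sq_le_of_enorm {F : Type*} [NormedAddCommGroup F] {x : F} {C : ℝ≥0} {a : ℝ} (ha : 0 ≤ a)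
    (h : ‖x‖ₑ ^ 2 ≤ C * ENNReal.ofReal a) : ‖x‖ ^ 2 ≤ C * a := by
  rw [enorm_sq_eq_ofReal, ← ENNReal.ofReal_coe_nnreal, ← ENNReal.ofReal_mul C.coe_nonneg] at h
  exact (ENNReal.ofReal_le_ofReal_iff (by positivity)).1 h

/-- Here A is the energy norm, w the H¹ norm, X the friction term, c₀ the Korn constant and c₁ that
of the trace. After division by A the term kA, with k < 1, is absorbed on the left, which produces
1/(1 - k). The final + 1 keeps the constant positive even if c₀ = 0. -/
lemma estimate_of_energy {A w dF dT X c₀ c₁ κ k : ℝ} (hA0 : 0 ≤ A) (hw0 : 0 < w) (hc₀ : 0 ≤ c₀)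
    (hc₁ : 0 ≤ c₁) (hdF : 0 ≤ dF) (hdT : 0 ≤ dT) (hκ : κ ≤ k) (hk1 : k < 1)
    (hw : w ≤ c₀ * A) (hle : A ^ 2 ≤ dF * w + c₁ * (dT * w) + X)
    (hX : X / (A * (A + dF + dT)) ≤ κ) :
    w ≤ (c₀ * ((c₀ + c₁ * c₀ + 1) / (1 - k)) + 1) * (dF + dT) := by
  have hpos : 0 < 1 - k := by linarith
  have hA : 0 < A := by
    refine lt_of_le_of_ne hA0 fun h => ?_
    rw [← h, mul_zero] at hw
    linarith
  have hD : 0 < A * (A + dF + dT) := by positivity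
  rw [div_le_iff₀ hD] at hX
  have hX' : κ * (A * (A + dF + dT)) ≤ k * (A * (A + dF + dT)) := by gcongr
  have h6 : A * A ≤ A * (c₀ * dF + c₁ * c₀ * dT + k * (A + dF + dT)) := by
    have i1 : dF * w ≤ dF * (c₀ * A) := by gcongr
    have i2 : c₁ * (dT * w) ≤ c₁ * (dT * (c₀ * A)) := by gcongr
    calc A * A = A ^ 2 := by ring
      _ ≤ dF * (c₀ * A) + c₁ * (dT * (c₀ * A)) + k * (A * (A + dF + dT)) := by linarith
      _ = _ := by ring
  have h7 : A ≤ c₀ * dF + c₁ * c₀ * dT + k * (A + dF + dT) := le_of_mul_le_mul_left h6 hA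
  have h8 : A ≤ (c₀ + c₁ * c₀ + 1) / (1 - k) * (dF + dT) := by
    rw [div_mul_eq_mul_div, le_div_iff₀ hpos]
    have j1 : 0 ≤ c₁ * c₀ * dF := by positivity
    have j2 : 0 ≤ c₀ * dT := by positivity
    have j3 : k * dF ≤ 1 * dF := by gcongr
    have j4 : k * dT ≤ 1 * dT := by gcongr
    linarith
  calc w ≤ c₀ * A := hw
    _ ≤ c₀ * ((c₀ + c₁ * c₀ + 1) / (1 - k) * (dF + dT)) := by gcongr
    _ ≤ _ := by linarith

end Real

namespace Setting

/-! ### The energy form. -/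

section Energy

variable {N : ℕ} (P : Setting N)

lemma memLp_stress (u : H1 P.Ω) :
    MemLp (fun x => P.Λ x (strain u x)) 2 (volume.restrict P.Ω) := by
  obtain ⟨M, hM⟩ : ∃ M : ℝ, ∀ᵐ x ∂(volume.restrict P.Ω), ‖P.Λ x‖ ≤ M := by
    refine ⟨(eLpNorm P.Λ ⊤ (volume.restrict P.Ω)).toReal, ?_⟩
    have h := ae_le_eLpNormEssSup (f := P.Λ) (μ := volume.restrict P.Ω)
    rw [← eLpNorm_exponent_top] at h
    filter_upwards [h] with x hx
    rw [← ofReal_norm] at hx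
    exact (ENNReal.ofReal_le_iff_le_toReal P.Λ_bounded.2.ne).1 hx
  refine (memLp_strain u).of_le_mul (c := M) ?_ ?_
  · exact isBoundedBilinearMap_apply.continuous.comp_aestronglyMeasurable
      (P.Λ_bounded.1.prodMk (memLp_strain u).1)
  · filter_upwards [hM] with x hx
    exact ((P.Λ x).le_opNorm _).trans (by gcongr)

lemma integrable_energy (u v : H1 P.Ω) :
    Integrable (fun x => ⟪strain u x, P.Λ x (strain v x)⟫) (volume.restrict P.Ω) :=
  ((memLp_strain u).norm.integrable_mul (P.memLp_stress v).norm).mono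
    ((memLp_strain u).1.inner (P.memLp_stress v).1)
    (Eventually.of_forall fun _ => (norm_inner_le_norm _ _).trans (le_abs_self _))

lemma a_add_left (u v w : H1 P.Ω) : P.a (u + v) w = P.a u w + P.a v w := by
  rw [a, a, a, ← integral_add (P.integrable_energy u w) (P.integrable_energy v w)]
  refine integral_congr_ae ?_
  filter_upwards [strain_add u v] with x hx
  rw [hx, inner_add_left]

lemma a_neg_left (u w : H1 P.Ω) : P.a (-u) w = -P.a u w := by
  rw [a, a, ← integral_neg]
  refine integral_congr_ae ?_
  filter_upwards [strain_neg u] with x hx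
  rw [hx, inner_neg_left]

lemma a_sub_left (u v w : H1 P.Ω) : P.a (u - v) w = P.a u w - P.a v w := by
  rw [sub_eq_add_neg, a_add_left, a_neg_left, sub_eq_add_neg]

lemma a_neg_right (u w : H1 P.Ω) : P.a u (-w) = -P.a u w := by
  rw [a, a, ← integral_neg]
  refine integral_congr_ae ?_
  filter_upwards [strain_neg w] with x hx
  rw [hx, map_neg, inner_neg_right]

lemma exists_elliptic : ∃ α > 0, ∀ u : H1 P.Ω,
    α * ∫ x in P.Ω, ‖strain u x‖ ^ 2 ≤ P.a u u := by
  obtain ⟨α, hα, h⟩ := P.Λ_elliptic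
  refine ⟨α, hα, fun u => ?_⟩
  rw [← integral_const_mul, a]
  refine integral_mono_ae ((memLp_strain u).norm.integrable_sq.const_mul α)
    (P.integrable_energy u u) ?_
  filter_upwards [h] with x hx
  simpa [real_inner_self_eq_norm_sq] using hx (strain u x)

lemma a_self_nonneg (u : H1 P.Ω) : 0 ≤ P.a u u := by
  obtain ⟨α, hα, h⟩ := P.exists_elliptic
  exact (mul_nonneg hα.le (integral_nonneg fun _ => by positivity)).trans (h u)

lemma normA_sq (u : H1 P.Ω) : P.normA u ^ 2 = P.a u u := Real.sq_sqrt (P.a_self_nonneg u)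

end Energy

/-! ### The space V, normal and tangential components. -/

section Boundary

variable {N : ℕ} (P : Setting N)

lemma ΓU_subset : P.ΓU ⊆ frontier P.Ω := by
  obtain ⟨O, -, h⟩ := P.isRelOpen_ΓU
  exact h ▸ inter_subset_right

lemma ΓT_subset : P.ΓT ⊆ frontier P.Ω := by
  obtain ⟨O, -, h⟩ := P.isRelOpen_ΓT
  exact h ▸ inter_subset_right

lemma ΓC_subset : P.ΓC ⊆ frontier P.Ω := by
  obtain ⟨O, -, h⟩ := P.isRelOpen_ΓC
  exact h ▸ inter_subset_right

lemma measurableSet_ΓC : MeasurableSet P.ΓC := by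
  obtain ⟨O, hO, h⟩ := P.isRelOpen_ΓC
  exact h ▸ hO.measurableSet.inter isClosed_frontier.measurableSet

lemma V_add {u v : H1 P.Ω} (hu : u ∈ P.V) (hv : v ∈ P.V) : u + v ∈ P.V := by
  obtain ⟨w, hw, hw0⟩ := hu
  obtain ⟨z, hz, hz0⟩ := hv
  refine ⟨_, hw.add hz, ?_⟩
  filter_upwards [hw0, hz0] with x h1 h2
  rw [h1, h2, add_zero]

lemma V_neg {u : H1 P.Ω} (hu : u ∈ P.V) : -u ∈ P.V := by
  obtain ⟨w, hw, hw0⟩ := hu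
  refine ⟨_, hw.neg, ?_⟩
  filter_upwards [hw0] with x h1
  rw [h1, neg_zero]

lemma V_sub {u v : H1 P.Ω} (hu : u ∈ P.V) (hv : v ∈ P.V) : u - v ∈ P.V := by
  rw [sub_eq_add_neg]
  exact P.V_add hu (P.V_neg hv)

lemma isTrace_of_mem {u : H1 P.Ω} (hu : u ∈ P.V) : IsTrace P.Ω u (trace u) :=
  isTrace_trace ⟨_, hu.choose_spec.1⟩

lemma normal_sub (v w : E N → E N) (x : E N) :
    P.normal (fun x => v x - w x) x = P.normal v x - P.normal w x := inner_sub_left _ _ _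

lemma tang_sub (v w : E N → E N) (x : E N) :
    P.tang (fun x => v x - w x) x = P.tang v x - P.tang w x := by
  simp only [tang, inner_sub_left, sub_smul]
  abel

lemma normal_congr {v w : E N → E N} {x : E N} (h : v x = w x) : P.normal v x = P.normal w x := by
  simp only [normal, h]

lemma tang_congr {v w : E N → E N} {x : E N} (h : v x = w x) : P.tang v x = P.tang w x := by
  simp only [tang, h]

end Boundary

/-! ### Boundary fields of the contact problem, trace and Korn estimates on V. -/

section BoundarySpaces

variable {m : ℕ} (P : Setting (m + 2))

lemma trace_sub {u v : H1 P.Ω} (hu : u ∈ P.V) (hv : v ∈ P.V) :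
    trace (u - v) =ᵐ[surf (frontier P.Ω)] fun x => trace u x - trace v x :=
  (P.isTrace_of_mem (P.V_sub hu hv)).ae_eq P.isOpen_Ω P.isBounded_Ω P.isC11_Ω
    ((P.isTrace_of_mem hu).sub (P.isTrace_of_mem hv))

lemma trace_neg {u : H1 P.Ω} (hu : u ∈ P.V) :
    trace (-u) =ᵐ[surf (frontier P.Ω)] fun x => -trace u x :=
  (P.isTrace_of_mem (P.V_neg hu)).ae_eq P.isOpen_Ω P.isBounded_Ω P.isC11_Ω
    (P.isTrace_of_mem hu).neg

lemma hasPotentialBound_ΓC : HasPotentialBound P.ΓC :=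
  (hasPotentialBound_frontier P.isOpen_Ω P.isBounded_Ω P.isC11_Ω).mono P.measurableSet_ΓC P.ΓC_subset

lemma exists_lipschitzOnWith_n : ∃ K : ℝ≥0, LipschitzOnWith K P.n P.ΓC := by
  obtain ⟨K, hK⟩ := exists_lipschitzOnWith_outwardNormal P.isOpen_Ω P.isBounded_Ω P.isC11_Ω
  exact ⟨K, hK.mono P.ΓC_subset⟩

lemma memHHalf_smul_n {φ : E (m + 2) → ℝ} (hφ : MemHHalf P.ΓC φ) :
    MemHHalf P.ΓC fun x => φ x • P.n x := by
  obtain ⟨K, hK⟩ := P.exists_lipschitzOnWith_n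
  exact hφ.smul_lipschitz P.hasPotentialBound_ΓC hK
    (hK.continuousOn.aestronglyMeasurable P.measurableSet_ΓC) fun x _ => norm_outwardNormal_le x

lemma memHHalf_normal {v : E (m + 2) → E (m + 2)} (hv : MemHHalf P.ΓC v) :
    MemHHalf P.ΓC (P.normal v) := by
  obtain ⟨K, hK⟩ := P.exists_lipschitzOnWith_n
  exact hv.inner_lipschitz P.hasPotentialBound_ΓC hK fun x _ => norm_outwardNormal_le x

lemma memHHalf_tang {v : E (m + 2) → E (m + 2)} (hv : MemHHalf P.ΓC v) :
    MemHHalf P.ΓC (P.tang v) :=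
  hv.sub (P.memHHalf_smul_n (P.memHHalf_normal hv))

lemma memHHalf_f_mul {φ : E (m + 2) → ℝ} (hφ : MemHHalf P.ΓC φ) :
    MemHHalf P.ΓC fun x => P.f x * φ x := by
  obtain ⟨K, hK⟩ := P.f_lipschitz
  -- The extension serves to see that f, Lipschitz on the bounded set Γ_C, is bounded there.
  obtain ⟨f', hf', hff'⟩ := hK.extend_real
  have hb : Bornology.IsBounded (f' '' P.ΓC) :=
    hf'.isBounded_image ((P.isBounded_Ω.closure.subset frontier_subset_closure).subset P.ΓC_subset)
  obtain ⟨M, hM⟩ := hb.exists_norm_le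
  have h := hφ.smul_lipschitz P.hasPotentialBound_ΓC hK
    (hK.continuousOn.aestronglyMeasurable P.measurableSet_ΓC) fun x hx =>
      (hff' hx).symm ▸ hM _ (mem_image_of_mem _ hx)
  simpa [mul_comm] using h

lemma memHHalf_trace {u : H1 P.Ω} (hu : u ∈ P.V) : MemHHalf P.ΓC (trace u) :=
  (P.isTrace_of_mem hu).1.mono
    (hasPotentialBound_frontier P.isOpen_Ω P.isBounded_Ω P.isC11_Ω).2.1 P.measurableSet_ΓC P.ΓC_subset

/-- The work on Γ_T becomes a scalar product in L²(Γ_T), from which its linearity in T and its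
continuity follow. -/
lemma exists_traceT {v : H1 P.Ω} (hv : v ∈ P.V) : ∃ g : P.L2T, g =ᵐ[surf P.ΓT] trace v ∧
    ∀ T : P.L2T, P.workT T v = ⟪T, g⟫ := by
  have h : MemLp (trace v) 2 (surf P.ΓT) :=
    (P.isTrace_of_mem hv).1.1.mono_measure (surf_mono P.ΓT_subset)
  refine ⟨h.toLp _, h.coeFn_toLp, fun T => ?_⟩
  rw [workT, L2.inner_def]
  refine integral_congr_ae ?_
  filter_upwards [h.coeFn_toLp] with x hx
  rw [hx]

lemma workT_sub_left (T T' : P.L2T) {v : H1 P.Ω} (hv : v ∈ P.V) :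
    P.workT (T - T') v = P.workT T v - P.workT T' v := by
  obtain ⟨g, -, hg⟩ := P.exists_traceT hv
  rw [hg, hg, hg, inner_sub_left]

lemma workT_neg_right (T : P.L2T) {v : H1 P.Ω} (hv : v ∈ P.V) :
    P.workT T (-v) = -P.workT T v := by
  rw [workT, workT, ← integral_neg]
  refine integral_congr_ae ?_
  filter_upwards [ae_mono (surf_mono P.ΓT_subset) (P.trace_neg hv)] with x hx
  rw [hx, inner_neg_right]

lemma exists_workT_le : ∃ c : ℝ, 0 ≤ c ∧ ∀ (T : P.L2T) (v : H1 P.Ω), v ∈ P.V →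
    P.workT T v ≤ c * (‖T‖ * ‖v‖) := by
  obtain ⟨C, hC⟩ := exists_trace_bound P.isOpen_Ω P.isBounded_Ω P.isC11_Ω
  refine ⟨Real.sqrt C, Real.sqrt_nonneg _, fun T v hv => ?_⟩
  obtain ⟨g, hg, hT⟩ := P.exists_traceT hv
  have h1 : ‖g‖ₑ ^ 2 ≤ C * ENNReal.ofReal (‖v‖ ^ 2) := by
    rw [Lp.enorm_def, eLpNorm_two_sq, ← enorm_sq_eq_ofReal]
    calc _ = ∫⁻ x, ‖trace v x‖ₑ ^ 2 ∂(surf P.ΓT) := by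
          refine lintegral_congr_ae ?_
          filter_upwards [hg] with x hx
          rw [hx]
      _ ≤ ∫⁻ x, ‖trace v x‖ₑ ^ 2 ∂(surf (frontier P.Ω)) :=
          lintegral_mono' (surf_mono P.ΓT_subset) le_rfl
      _ ≤ _ := hC _ _ (P.isTrace_of_mem hv)
  have h2 := norm_sq_le_of_enorm (by positivity) h1
  have h3 : ‖g‖ ≤ Real.sqrt C * ‖v‖ := by
    refine le_of_sq_le_sq ?_ (by positivity)
    rw [mul_pow, Real.sq_sqrt C.coe_nonneg]
    exact h2
  rw [hT]
  calc ⟪T, g⟫ ≤ ‖T‖ * ‖g‖ := real_inner_le_norm _ _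
    _ ≤ ‖T‖ * (Real.sqrt C * ‖v‖) := by gcongr
    _ = _ := by ring

/-- Korn's inequality, with Γ_U as the part of positive measure, combined with the ellipticity of Λ.
-/
lemma exists_norm_le_normA : ∃ c : ℝ, 0 ≤ c ∧ ∀ v ∈ P.V, ‖v‖ ≤ c * P.normA v := by
  obtain ⟨C, hC⟩ := exists_korn P.isOpen_Ω P.isBounded_Ω P.isC11_Ω P.isConnected_Ω P.ΓU_subset
    P.ΓU_pos.ne'
  obtain ⟨α, hα, hell⟩ := P.exists_elliptic
  refine ⟨Real.sqrt (C / α), Real.sqrt_nonneg _, fun v ⟨w, hw, hw0⟩ => ?_⟩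
  have h1 := hC v w hw hw0
  have h2 : ∫⁻ x in P.Ω, ‖strain v x‖ₑ ^ 2
      = ENNReal.ofReal (∫ x in P.Ω, ‖strain v x‖ ^ 2) := by
    rw [ofReal_integral_eq_lintegral_ofReal (memLp_strain v).norm.integrable_sq
      (Eventually.of_forall fun _ => by positivity)]
    simp only [enorm_sq_eq_ofReal]
  rw [h2] at h1
  have h3 := norm_sq_le_of_enorm (integral_nonneg fun _ => by positivity) h1
  refine le_of_sq_le_sq ?_ (mul_nonneg (Real.sqrt_nonneg _) (Real.sqrt_nonneg _))
  rw [mul_pow, Real.sq_sqrt (by positivity), normA_sq]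
  have h4 := hell v
  calc ‖v‖ ^ 2 ≤ C * ∫ x in P.Ω, ‖strain v x‖ ^ 2 := h3
    _ = C / α * (α * ∫ x in P.Ω, ‖strain v x‖ ^ 2) := by field_simp
    _ ≤ C / α * P.a v v := by gcongr

lemma norm_disp_le (v : H1 P.Ω) : ‖disp v‖ ≤ ‖v‖ := by
  refine le_of_sq_le_sq ?_ (norm_nonneg _)
  have := WithLp.prod_norm_sq_eq_of_L2 (v : SobolevPair P.Ω)
  have h2 : ‖v‖ ^ 2 = ‖disp v‖ ^ 2 + ‖wgrad v‖ ^ 2 := this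
  rw [h2]
  nlinarith [sq_nonneg ‖wgrad v‖]

end BoundarySpaces

/-! ### The energy estimate. -/

section Estimate

variable {m : ℕ} (P : Setting (m + 2))

/-- A solution of the incremental problem is admissible. -/
lemma IsIncrementalSolution.mem_admissible {P : Setting (m + 2)} {F : P.L2Ω} {T : P.L2T}
    {u₁ u : H1 P.Ω} (hu₁ : u₁ ∈ P.V)
    (h : P.IsIncrementalSolution F T (P.tang (trace u₁)) u) : u ∈ P.Admissible F T := by
  obtain ⟨hu, t, ht, hineq⟩ := h
  refine ⟨hu, t, ht, fun v hv => ?_⟩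
  have huv := P.V_add hu hv
  -- The incremental inequality is tested with u + v, so that the increment of the test field is v.
  have h1 := hineq (u + v) huv
  rw [add_sub_cancel_left] at h1
  have htr : ∀ᵐ x ∂(surf P.ΓC), trace v x = trace (u + v) x - trace u x := by
    have := ae_mono (surf_mono P.ΓC_subset) (P.trace_sub huv hu)
    rwa [add_sub_cancel_left] at this
  have h2 : pair t (P.normal (trace v))
      = pair t (fun x => P.normal (trace (u + v)) x - P.normal (trace u) x) := by
    refine pair_congr t ?_
    filter_upwards [htr] with x hx
    rw [P.normal_congr (w := fun x => trace (u + v) x - trace u x) hx, normal_sub]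
  have htm : ∀ {z : H1 P.Ω}, z ∈ P.V → MemHHalf P.ΓC (P.tang (trace z)) := fun hz =>
    P.memHHalf_tang (P.memHHalf_trace hz)
  have hdm : ∀ {z : H1 P.Ω}, z ∈ P.V →
      MemHHalf P.ΓC fun x => ‖P.tang (trace z) x - P.tang (trace u₁) x‖ := fun hz =>
    ((htm hz).sub (htm hu₁)).norm P.hasPotentialBound_ΓC
  -- The triangle inequality bounds the friction increment by f |v_t|, and t ≤ 0 reverses the order.
  have h3 : pair t (fun x => P.f x * ‖P.tang (trace v) x‖)
      ≤ pair t (fun x => P.f x * (‖P.tang (trace (u + v)) x - P.tang (trace u₁) x‖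
        - ‖P.tang (trace u) x - P.tang (trace u₁) x‖)) := by
    refine ht.2.1.pair_le (P.memHHalf_f_mul ((hdm huv).sub (hdm hu)))
      (P.memHHalf_f_mul ((htm hv).norm P.hasPotentialBound_ΓC)) ?_
    filter_upwards [htr, ae_restrict_mem P.measurableSet_ΓC] with x hx hxC
    refine mul_le_mul_of_nonneg_left ?_ (P.f_nonneg x hxC)
    rw [P.tang_congr (w := fun x => trace (u + v) x - trace u x) hx, tang_sub]
    refine (norm_sub_norm_le _ _).trans_eq ?_
    congr 1
    abel
  linarith

lemma hasStressData_sub {u u' : H1 P.Ω} {h h' : P.L2Ω} {p p' : P.L2T} {τ τ' : HMinusHalf P.ΓC (E (m + 2))}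
    (hu : P.HasStressData u h p τ) (hu' : P.HasStressData u' h' p' τ') :
    P.HasStressData (u - u') (h - h') (p - p') (τ - τ') := by
  intro v hv
  rw [pair_sub_left, hu v hv, hu' v hv, a_sub_left, inner_sub_left, P.workT_sub_left _ _ hv]
  ring

/-- The energy of the difference of the solution of an incremental problem and of the previous
state. -/
lemma a_sub_le {F₁ F₂ : P.L2Ω} {T₁ T₂ : P.L2T} {u₁ u₂ : H1 P.Ω} (h₁ : u₁ ∈ P.Admissible F₁ T₁)
    (h₂ : P.IsIncrementalSolution F₂ T₂ (P.tang (trace u₁)) u₂) :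
    ∃ τ : HMinusHalf P.ΓC (E (m + 2)),
      P.HasStressData (u₂ - u₁) (-F₂ - -F₁) (T₂ - T₁) τ ∧
      P.a (u₂ - u₁) (u₂ - u₁) ≤ ⟪F₂ - F₁, disp (u₂ - u₁)⟫ + P.workT (T₂ - T₁) (u₂ - u₁)
        + pair τ (fun x => (P.f x * ‖P.tang (trace u₂) x - P.tang (trace u₁) x‖) • P.n x) := by
  obtain ⟨hu₁, t₁, ⟨⟨τ₁, hτ₁, hn₁⟩, hneg₁, hcon₁⟩, hineq₁⟩ := h₁
  obtain ⟨hu₂, t₂, ⟨⟨τ₂, hτ₂, hn₂⟩, hneg₂, hcon₂⟩, hineq₂⟩ := h₂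
  refine ⟨τ₂ - τ₁, P.hasStressData_sub hτ₂ hτ₁, ?_⟩
  have hw := P.V_sub hu₂ hu₁
  set w := u₂ - u₁ with hwdef
  have hN₁ := P.memHHalf_normal (P.memHHalf_trace hu₁)
  have hN₂ := P.memHHalf_normal (P.memHHalf_trace hu₂)
  have hT := ((P.memHHalf_tang (P.memHHalf_trace hu₂)).sub
    (P.memHHalf_tang (P.memHHalf_trace hu₁))).norm P.hasPotentialBound_ΓC
  have hfT := P.memHHalf_f_mul hT
  have htr : ∀ᵐ x ∂(surf P.ΓC), trace w x = trace u₂ x - trace u₁ x :=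
    ae_mono (surf_mono P.ΓC_subset) (P.trace_sub hu₂ hu₁)
  have i₁ := hineq₁ w hw
  have e1 : pair t₁ (P.normal (trace w)) = pair t₁ (P.normal (trace u₂)) - pair t₁ (P.normal (trace u₁)) := by
    rw [← pair_sub t₁ hN₂ hN₁]
    refine pair_congr t₁ ?_
    filter_upwards [htr] with x hx
    rw [P.normal_congr (w := fun x => trace u₂ x - trace u₁ x) hx, normal_sub]
  have e2 : pair t₁ (fun x => P.f x * ‖P.tang (trace w) x‖)
      = pair t₁ (fun x => P.f x * ‖P.tang (trace u₂) x - P.tang (trace u₁) x‖) := by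
    refine pair_congr t₁ ?_
    filter_upwards [htr] with x hx
    rw [P.tang_congr (w := fun x => trace u₂ x - trace u₁ x) hx, tang_sub]
  rw [e1, e2] at i₁
  -- With the test field u₁, the friction term of the test field vanishes, as u₁ is the previous
  -- state; only -f t₂ |w_t| is left.
  have i₂ := hineq₂ u₁ hu₁
  have e3 : u₁ - u₂ = -w := (neg_sub u₂ u₁).symm
  have e4 : pair t₂ (fun x => P.f x * (‖P.tang (trace u₁) x - P.tang (trace u₁) x‖
      - ‖P.tang (trace u₂) x - P.tang (trace u₁) x‖))
      = -pair t₂ (fun x => P.f x * ‖P.tang (trace u₂) x - P.tang (trace u₁) x‖) := by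
    rw [← pair_neg t₂ hfT]
    congr 1
    ext1 x
    rw [sub_self, norm_zero]
    ring
  rw [e3, disp_neg, inner_neg_right, P.workT_neg_right _ hw, a_neg_right, e4,
    pair_sub t₂ hN₁ hN₂] at i₂
  -- Each contact condition is tested with the other pressure. In the sum the gap cancels, and ∫ (t₂
  -- - t₁)(u₂ - u₁)_n ≤ 0 remains.
  have c₁ := hcon₁ t₂ hneg₂
  have c₂ := hcon₂ t₁ hneg₁
  rw [pair_sub_left, pair_sub _ hN₁ P.g_mem, pair_sub _ hN₁ P.g_mem] at c₁
  rw [pair_sub_left, pair_sub _ hN₂ P.g_mem, pair_sub _ hN₂ P.g_mem] at c₂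
  have e5 : P.a w w = P.a u₂ w - P.a u₁ w := by
    conv_lhs => rw [hwdef, a_sub_left]
  -- A traction paired with a multiple of n is its normal component paired with the multiplier, so
  -- τ₂ - τ₁ gives back t₂ - t₁.
  rw [e5, pair_sub_left, ← hn₂ _ hfT, ← hn₁ _ hfT, inner_sub_left, P.workT_sub_left _ _ hw]
  linarith

-- The bound on the quotient is assumed for the pair (u₂, u₁) only, so that the constant depends on
-- κ and on the setting alone and serves for both forms of the condition.
set_option maxHeartbeats 1000000 in
lemma exists_estimate {κ : ℝ} (hκ : κ < 1) : ∃ C : ℝ, 0 < C ∧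
    ∀ (F₁ F₂ : P.L2Ω) (T₁ T₂ : P.L2T) (u₁ u₂ : H1 P.Ω), u₁ ∈ P.Admissible F₁ T₁ →
      P.IsIncrementalSolution F₂ T₂ (P.tang (trace u₁)) u₂ →
      (u₂ ≠ u₁ → ∀ (h : P.L2Ω) (p : P.L2T) (τ : HMinusHalf P.ΓC (E (m + 2))),
        P.HasStressData (u₂ - u₁) h p τ →
        pair τ (fun x => (P.f x * ‖P.tang (trace u₂) x - P.tang (trace u₁) x‖) • P.n x)
          / (P.normA (u₂ - u₁) * (P.normA (u₂ - u₁) + ‖h‖ + ‖p‖)) ≤ κ) →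
      ‖u₂ - u₁‖ ≤ C * (‖F₂ - F₁‖ + ‖T₂ - T₁‖) := by
  obtain ⟨c₀, hc₀, hK⟩ := P.exists_norm_le_normA
  obtain ⟨c₁, hc₁, hW⟩ := P.exists_workT_le
  -- The bound κ < 1 may be negative; the absorption is carried out with a nonnegative one.
  set k := max κ 0 with hk
  have hk1 : k < 1 := max_lt hκ one_pos
  refine ⟨c₀ * ((c₀ + c₁ * c₀ + 1) / (1 - k)) + 1, ?_, ?_⟩
  · have : 0 < 1 - k := by linarith
    positivity
  intro F₁ F₂ T₁ T₂ u₁ u₂ h₁ h₂ hq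
  have hpos : 0 < 1 - k := by linarith
  by_cases hne : u₂ = u₁
  · rw [hne, sub_self, norm_zero]
    positivity
  obtain ⟨τ, hτ, hle⟩ := P.a_sub_le h₁ h₂
  have hwV := P.V_sub h₂.1 h₁.1
  have hq := hq hne _ _ τ hτ
  -- The divergence of the stress is the opposite of the load, and the quotient only involves its
  -- norm.
  have hnF : ‖-F₂ - -F₁‖ = ‖F₂ - F₁‖ := by
    rw [neg_sub_neg, norm_sub_rev]
  rw [hnF] at hq
  have hw0 : 0 < ‖u₂ - u₁‖ := norm_pos_iff.2 (sub_ne_zero.2 hne)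
  have h3 := hK _ hwV
  have h4 := hW (T₂ - T₁) _ hwV
  have h5 : ⟪F₂ - F₁, disp (u₂ - u₁)⟫ ≤ ‖F₂ - F₁‖ * ‖u₂ - u₁‖ :=
    (real_inner_le_norm _ _).trans (by gcongr; exact P.norm_disp_le _)
  rw [← normA_sq] at hle
  exact estimate_of_energy (Real.sqrt_nonneg _) hw0 hc₀ hc₁ (norm_nonneg _) (norm_nonneg _)
    (le_max_left _ _) hk1 h3 (hle.trans (add_le_add (add_le_add h5 h4) le_rfl)) hq

end Estimate

end Setting

end Coulomb
theorem mainTheorem2 {N : ℕ} (hN : N = 2 ∨ N = 3) (P : Coulomb.Setting N) :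
    (∀ (S : ℝ) (F : ℝ → P.L2Ω) (T : ℝ → P.L2T), 0 ≤ S →
      Coulomb.IsBVPlus S F → Coulomb.IsBVPlus S T → P.ConditionC S F T →
      ∃ C : ℝ, 0 < C ∧ ∀ s₁ ∈ Icc 0 S, ∀ s₂ ∈ Icc 0 S, ∀ u₁ ∈ P.Admissible (F s₁) (T s₁),
        ∀ u₂, P.IsIncrementalSolution (F s₂) (T s₂) (P.tang (Coulomb.trace u₁)) u₂ →
          ‖u₂ - u₁‖ ≤ C * (‖F s₂ - F s₁‖ + ‖T s₂ - T s₁‖)) ∧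
    (P.UniformConditionC →
      ∃ C : ℝ, 0 < C ∧ ∀ (S : ℝ) (F : ℝ → P.L2Ω) (T : ℝ → P.L2T), 0 ≤ S →
        Coulomb.IsBVPlus S F → Coulomb.IsBVPlus S T →
        ∀ s₁ ∈ Icc 0 S, ∀ s₂ ∈ Icc 0 S, ∀ u₁ ∈ P.Admissible (F s₁) (T s₁),
        ∀ u₂, P.IsIncrementalSolution (F s₂) (T s₂) (P.tang (Coulomb.trace u₁)) u₂ →
          ‖u₂ - u₁‖ ≤ C * (‖F s₂ - F s₁‖ + ‖T s₂ - T s₁‖)) := by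
  obtain ⟨m, rfl⟩ : ∃ m, N = m + 2 := ⟨N - 2, by omega⟩
  constructor
  · rintro S F T - - - ⟨κ, hκ, hq⟩
    obtain ⟨C, hC, h⟩ := P.exists_estimate hκ
    refine ⟨C, hC, fun s₁ hs₁ s₂ hs₂ u₁ hu₁ u₂ hu₂ => h _ _ _ _ _ _ hu₁ hu₂ fun hne => ?_⟩
    -- Both states are in the union over [0, S]: u₁ at time s₁, and u₂ at time s₂ because
    -- incremental solutions are admissible.
    exact hq u₂ (mem_iUnion₂.2 ⟨s₂, hs₂, hu₂.mem_admissible hu₁.1⟩) u₁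
      (mem_iUnion₂.2 ⟨s₁, hs₁, hu₁⟩) hne
  · rintro ⟨κ, hκ, hq⟩
    -- Here κ comes from the uniform condition, so C is fixed before S, F and T.
    obtain ⟨C, hC, h⟩ := P.exists_estimate hκ
    refine ⟨C, hC, fun S F T _ _ _ s₁ _ s₂ _ u₁ hu₁ u₂ hu₂ => h _ _ _ _ _ _ hu₁ hu₂ fun hne => ?_⟩
    exact hq u₂ (mem_iUnion₂.2 ⟨_, _, hu₂.mem_admissible hu₁.1⟩) u₁
      (mem_iUnion₂.2 ⟨_, _, hu₁⟩) hne
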